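/- **Conventions.** Let $\mathbb R^{n+1,n}$ have coordinates $(x,t,y)$, $x,y\in\mathbb R^n$, $t\in\mathbb R$, and metric $2x\cdot y+t^2$, and let $\mathbb R^{n+1,n+1}=\mathbb R^{n+1,n}\oplus\mathbb R$ have metric $2x\cdot y+t^2-r^2$. Let $G=SO(n+1,n)$ with Lie algebra $\mathfrak g$, let $P\subset G$ be the stabilizer of the isotropic $n$-plane $\{(x,0,0)\}$, let $\hat G=SO(n+1,n+1)$ with Lie algebra $\hat{\mathfrak g}$, and let $\hat P\subset\hat G$ be the stabilizer of the isotropic $(n+1)$-plane $\{(x,t,0;t)\}$. Let $i:G\to\hat G$, $g\mapsto\mathrm{diag}(g,1)$. For real $c\neq0$ let $s_c$ be the linear map $x\mapsto x$, $t+r\mapsto t+r$, $y\mapsto cy$, $t-r\mapsto c(t-r)$, which multiplies the metric by $c$ and preserves the isotropic $(n+1)$-plane. Put $i_c(g)=s_c\,i(g)\,s_c^{-1}$ and $v_c=s_c(0,0,0;1)$, a vector of square length $-c$; thus $i_1=i$. A Cartan geometry of type $(G,P)$ on a smooth manifold $M$ is a smooth principal $P$-bundle $\mathcal P\to M$ with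 a one-form $\omega\in\Omega^1(\mathcal P,\mathfrak g)$ that is $P$-equivariant, reproduces the generators of fundamental vector fields, and is an isomorphism $T_u\mathcal P\to\mathfrak g$ at every $u$; likewise for $(\hat G,\hat P)$. A Cartan geometry of type $(\hat G,\hat P)$ is called an *almost-spinorial geometry*. Let $\mathfrak g=\mathfrak g_{(-2)}\supset\mathfrak g_{(-1)}\supset\mathfrak g_{(0)}=\mathfrak p\supset\mathfrak g_{(1)}\supset\mathfrak g_{(2)}$ be the filtration of $\mathfrak g$ defined by $\mathfrak p$. A Cartan geometry of type $(G,P)$ is *regular* if its curvature $\kappa$ maps $\mathfrak g_{(k)}\times\mathfrak g_{(l)}$ to $\mathfrak g_{(k+l+1)}$ for all $k,l$. Its underlying distribution $H\subset TM$ is the projection of $\omega^{-1}(\mathfrak g_{(-1)})$. A smooth distribution $H$ of rank $n$ is a *free $n$-distribution* if the Lie bracket of its sections induces an isomorphism $\wedge^2H\to TM/H$. **Proposition.** 1. (Algebraic conditions.) For every $c\ne0$, $i_c$ is an injective homomorphism $G\to\hat G$ whose image is the stabilizer of $v_c$ in $\hat G$, $i_c^{-1}(\hat P)=P$, and the induced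 map $G/P\to\hat G/\hat P$ is an open embedding. 2. (Fefferman construction.) Let $(\mathcal P,\omega)$ be a Cartan geometry of type $(G,P)$ on $M$ (for example the regular normal one belonging to a free $n$-distribution). Its underlying distribution $H$ is smooth of rank $n$, and it is a free $n$-distribution if $\omega$ is regular. The projection $\mathcal P\to M$ induces a homeomorphism $\hat M=\mathcal P/i^{-1}(\hat P)\cong M$. There are an almost-spinorial geometry $(\hat{\mathcal P},\hat\omega)$ on the same manifold $M$ and a smooth map $j:\mathcal P\to\hat{\mathcal P}$ over $\mathrm{id}_M$, equivariant along $i$, with $j^*\hat\omega=i_*\omega$. The pair $(\hat{\mathcal P},\hat\omega)$, $j$ is unique up to isomorphism. Moreover the standard tractor bundle $\hat{\mathcal P}\times_{\hat P}\mathbb R^{n+1,n+1}$ has a section of square length $-1$ that is parallel for the tractor connection and is represented along $j(\mathcal P)$ by the constant vector $v_1$. 3. (Converse.) Let $(\hat{\mathcal P},\hat\omega)$ be an almost-spinorial geometry on $M$ and $\tau$ a smooth section of its standard tractor bundle that is parallel for the tractor connection and has nowhere vanishing square length. Write this square length as $-c$, with $c:M\to\mathbb R\setminus\{0\}$. Then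 $c$ is locally constant, and there are a Cartan geometry $(\mathcal P,\omega)$ of type $(G,P)$ on $M$ and a smooth injective map $j:\mathcal P\to\hat{\mathcal P}$ over $\mathrm{id}_M$, equivariant along $i_{c}$, with $j^*\hat\omega=(i_{c})_*\omega$, whose image is the set of points where $\tau$ (as an equivariant function on $\hat{\mathcal P}$) equals $v_{c}$. The underlying distribution $H$ of $(\mathcal P,\omega)$ is smooth of rank $n$, and it is a free $n$-distribution if $\omega$ is regular. -/

import Mathlib

open scoped Manifold ContDiff Topology
open Matrix

universe u v

noncomputable section

namespace FreeDist

/-! ## Matrix groups -/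

section Groups

variable {N : Type} [Fintype N] [DecidableEq N]

/-- The group `SO(S)` of real matrices of determinant one preserving the bilinear form with
Gram matrix `S`. -/
def SO (S : Matrix N N ℝ) : Subgroup (Matrix N N ℝ)ˣ where
  carrier := {g | (g : Matrix N N ℝ)ᵀ * S * g = S ∧ (g : Matrix N N ℝ).det = 1}
  one_mem' := by simp
  mul_mem' := by
    rintro a b ⟨ha, ha'⟩ ⟨hb, hb'⟩
    refine ⟨?_, by simp [ha', hb']⟩
    calc ((a * b : (Matrix N N ℝ)ˣ) : Matrix N N ℝ)ᵀ * S * ((a * b : (Matrix N N ℝ)ˣ) : Matrix N N ℝ)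
        = (b : Matrix N N ℝ)ᵀ * ((a : Matrix N N ℝ)ᵀ * S * a) * b := by
          simp only [Units.val_mul, Matrix.transpose_mul, Matrix.mul_assoc]
      _ = S := by rw [ha, hb]
  inv_mem' := by
    rintro a ⟨ha, ha'⟩
    have h1 : (a : Matrix N N ℝ) * ((a⁻¹ : (Matrix N N ℝ)ˣ) : Matrix N N ℝ) = 1 := a.mul_inv
    have h2 : (((a⁻¹ : (Matrix N N ℝ)ˣ) : Matrix N N ℝ))ᵀ * (a : Matrix N N ℝ)ᵀ = 1 := by
      rw [← Matrix.transpose_mul, h1, Matrix.transpose_one]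
    refine ⟨?_, ?_⟩
    · calc ((a⁻¹ : (Matrix N N ℝ)ˣ) : Matrix N N ℝ)ᵀ * S * ((a⁻¹ : (Matrix N N ℝ)ˣ) : Matrix N N ℝ)
          = ((a⁻¹ : (Matrix N N ℝ)ˣ) : Matrix N N ℝ)ᵀ * ((a : Matrix N N ℝ)ᵀ * S * a)
              * ((a⁻¹ : (Matrix N N ℝ)ˣ) : Matrix N N ℝ) := by rw [ha]
        _ = ((((a⁻¹ : (Matrix N N ℝ)ˣ) : Matrix N N ℝ))ᵀ * (a : Matrix N N ℝ)ᵀ) * S *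
              ((a : Matrix N N ℝ) * ((a⁻¹ : (Matrix N N ℝ)ˣ) : Matrix N N ℝ)) := by
            simp only [Matrix.mul_assoc]
        _ = S := by rw [h1, h2]; simp
    · have h3 := congrArg Matrix.det h1
      rw [Matrix.det_mul, ha', Matrix.det_one, one_mul] at h3
      exact h3

/-- The invertible matrices mapping the subspace `W` onto itself. -/
def stab (W : Submodule ℝ (N → ℝ)) : Subgroup (Matrix N N ℝ)ˣ where
  carrier := {g | ∀ w, (g : Matrix N N ℝ) *ᵥ w ∈ W ↔ w ∈ W}
  one_mem' := by intro w; simp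
  mul_mem' := by
    intro a b ha hb w
    rw [Units.val_mul, ← Matrix.mulVec_mulVec, ha, hb]
  inv_mem' := by
    intro a ha w
    rw [← ha, Matrix.mulVec_mulVec, a.mul_inv, Matrix.one_mulVec]

end Groups

/-- Indices of the coordinates `(x, t, y)` of `ℝ^(n+1,n) = ℝⁿ × ℝ × ℝⁿ`. -/
abbrev Idx (n : ℕ) : Type := Fin n ⊕ Unit ⊕ Fin n

/-- Indices of the coordinates `(x, t, y; r)` of `ℝ^(n+1,n+1) = ℝ^(n+1,n) × ℝ`. -/
abbrev IdxHat (n : ℕ) : Type := Idx n ⊕ Unit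

/-- The metric `2 x·y + t²`, of signature `(n+1,n)`. -/
def form (n : ℕ) : Matrix (Idx n) (Idx n) ℝ := Matrix.of fun a b =>
  match a, b with
  | Sum.inl i, Sum.inr (Sum.inr j) => if i = j then 1 else 0
  | Sum.inr (Sum.inr i), Sum.inl j => if i = j then 1 else 0
  | Sum.inr (Sum.inl _), Sum.inr (Sum.inl _) => 1
  | _, _ => 0

/-- The metric `2 x·y + t² - r²`, of signature `(n+1,n+1)`. -/
def formHat (n : ℕ) : Matrix (IdxHat n) (IdxHat n) ℝ := Matrix.fromBlocks (form n) 0 0 (-1)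

/-- `SO(n+1,n)`. -/
def G (n : ℕ) : Subgroup (Matrix (Idx n) (Idx n) ℝ)ˣ := SO (form n)

/-- `SO(n+1,n+1)`. -/
def GHat (n : ℕ) : Subgroup (Matrix (IdxHat n) (IdxHat n) ℝ)ˣ := SO (formHat n)

/-- The isotropic `n`-plane `{(x, 0, 0)}`. -/
def plane (n : ℕ) : Submodule ℝ (Idx n → ℝ) where
  carrier := {w | ∀ b, w (Sum.inr b) = 0}
  add_mem' := by intro a b ha hb c; simp [ha c, hb c]
  zero_mem' := by intro c; rfl
  smul_mem' := by intro r a ha c; simp [ha c]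

/-- The isotropic `(n+1)`-plane `{(x, t, 0; t)}`. -/
def planeHat (n : ℕ) : Submodule ℝ (IdxHat n → ℝ) where
  carrier := {w | (∀ i, w (Sum.inl (Sum.inr (Sum.inr i))) = 0) ∧
    w (Sum.inl (Sum.inr (Sum.inl ()))) = w (Sum.inr ())}
  add_mem' := by
    rintro a b ⟨ha, ha'⟩ ⟨hb, hb'⟩
    exact ⟨fun i => by simp [ha i, hb i], by simp [ha', hb']⟩
  zero_mem' := ⟨fun _ => rfl, rfl⟩
  smul_mem' := by
    rintro r a ⟨ha, ha'⟩
    exact ⟨fun i => by simp [ha i], by simp [ha']⟩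

/-- The parabolic subgroup of `SO(n+1,n)` stabilizing an isotropic `n`-plane. -/
def P (n : ℕ) : Subgroup (Matrix (Idx n) (Idx n) ℝ)ˣ := G n ⊓ stab (plane n)

/-- The parabolic subgroup of `SO(n+1,n+1)` stabilizing an isotropic `(n+1)`-plane. -/
def PHat (n : ℕ) : Subgroup (Matrix (IdxHat n) (IdxHat n) ℝ)ˣ := GHat n ⊓ stab (planeHat n)

/-- `𝔰𝔬(n+1,n)`. -/
def lieG (n : ℕ) : Submodule ℝ (Matrix (Idx n) (Idx n) ℝ) :=
  skewAdjointMatricesSubmodule (form n)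

/-- `𝔰𝔬(n+1,n+1)`. -/
def lieGHat (n : ℕ) : Submodule ℝ (Matrix (IdxHat n) (IdxHat n) ℝ) :=
  skewAdjointMatricesSubmodule (formHat n)

/-- The coordinates `x`, `t`, `y` have weights `1`, `0`, `-1`. -/
def weight {n : ℕ} : Idx n → ℤ
  | Sum.inl _ => 1
  | Sum.inr (Sum.inl _) => 0
  | Sum.inr (Sum.inr _) => -1

/-- The filtration `𝔤 = 𝔤₍₋₂₎ ⊃ 𝔤₍₋₁₎ ⊃ 𝔤₍₀₎ = 𝔭 ⊃ 𝔤₍₁₎ ⊃ 𝔤₍₂₎` of `𝔰𝔬(n+1,n)` belonging to the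
parabolic subalgebra `𝔭`: the elements of `𝔤₍ₖ₎` raise weights by at least `k`. -/
def filt (n : ℕ) (k : ℤ) : Set (Matrix (Idx n) (Idx n) ℝ) :=
  {X | X ∈ lieG n ∧ ∀ a b, weight a < weight b + k → X a b = 0}

/-! ## The inclusions of `SO(n+1,n)` into `SO(n+1,n+1)` -/

/-- The linear map with `x ↦ x`, `t + r ↦ t + r`, `y ↦ c y`, `t - r ↦ c (t - r)`. It multiplies the
metric of `ℝ^(n+1,n+1)` by `c` and preserves the isotropic plane `planeHat`. -/
def simMat (n : ℕ) (c : ℝ) : Matrix (IdxHat n) (IdxHat n) ℝ :=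
  Matrix.fromBlocks
    (Matrix.diagonal fun a => match a with
      | Sum.inl _ => 1
      | Sum.inr (Sum.inl _) => (1 + c) / 2
      | Sum.inr (Sum.inr _) => c)
    (Matrix.of fun a _ => match a with
      | Sum.inr (Sum.inl _) => (1 - c) / 2
      | _ => 0)
    (Matrix.of fun _ a => match a with
      | Sum.inr (Sum.inl _) => (1 - c) / 2
      | _ => 0)
    (Matrix.of fun _ _ => (1 + c) / 2)

lemma simMat_mul (n : ℕ) (c d : ℝ) : simMat n c * simMat n d = simMat n (c * d) := by
  ext a b
  rcases a with (a | a | a) | a <;> rcases b with (b | b | b) | b <;>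
    simp [simMat, Matrix.mul_apply, Matrix.diagonal_apply] <;>
    ring

lemma simMat_one (n : ℕ) : simMat n 1 = 1 := by
  ext a b
  rcases a with (a | a | a) | a <;> rcases b with (b | b | b) | b <;>
    simp [simMat, Matrix.one_apply, Matrix.diagonal_apply]

lemma simMat_form (n : ℕ) (c : ℝ) :
    (simMat n c)ᵀ * formHat n * simMat n c = c • formHat n := by
  ext a b
  rcases a with (a | a | a) | a <;> rcases b with (b | b | b) | b <;>
    simp [simMat, formHat, form, Matrix.mul_apply, Matrix.diagonal_apply] <;>
    ring

/-- `simMat` as an invertible matrix. -/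
def sim (n : ℕ) (c : ℝˣ) : (Matrix (IdxHat n) (IdxHat n) ℝ)ˣ where
  val := simMat n c
  inv := simMat n (c⁻¹ : ℝˣ)
  val_inv := by rw [simMat_mul, Units.mul_inv, simMat_one]
  inv_val := by rw [simMat_mul, Units.inv_mul, simMat_one]

/-- `g ↦ diag(g, 1)`. -/
def blockHom (n : ℕ) : Matrix (Idx n) (Idx n) ℝ →* Matrix (IdxHat n) (IdxHat n) ℝ where
  toFun g := Matrix.fromBlocks g 0 0 1
  map_one' := by simp
  map_mul' a b := by simp [Matrix.fromBlocks_multiply]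

/-- The inclusion of `SO(n+1,n)` as the stabilizer of the vector `vec n c` of square length `-c`:
the evident inclusion `g ↦ diag(g, 1)`, conjugated by `sim n c` (which is `1` for `c = 1`). -/
def inclGL (n : ℕ) (c : ℝˣ) :
    (Matrix (Idx n) (Idx n) ℝ)ˣ →* (Matrix (IdxHat n) (IdxHat n) ℝ)ˣ :=
  (MulAut.conj (sim n c)).toMonoidHom.comp (Units.map (blockHom n))

lemma inclGL_mem (n : ℕ) (c : ℝˣ) (g : (Matrix (Idx n) (Idx n) ℝ)ˣ) (hg : g ∈ G n) :
    inclGL n c g ∈ GHat n := by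
  obtain ⟨h1, h2⟩ := hg
  have hs := simMat_form n (c : ℝ)
  have hs' := simMat_form n ((c⁻¹ : ℝˣ) : ℝ)
  have hb : (blockHom n g)ᵀ * formHat n * blockHom n g = formHat n := by
    simp [blockHom, formHat, Matrix.fromBlocks_transpose, Matrix.fromBlocks_multiply, h1]
  have hval : ((inclGL n c g : (Matrix (IdxHat n) (IdxHat n) ℝ)ˣ) : Matrix _ _ ℝ) =
      simMat n c * blockHom n g * simMat n (c⁻¹ : ℝˣ) := rfl
  refine ⟨?_, ?_⟩
  · rw [hval]
    calc (simMat n c * blockHom n g * simMat n (c⁻¹ : ℝˣ))ᵀ * formHat n *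
          (simMat n c * blockHom n g * simMat n (c⁻¹ : ℝˣ))
        = (simMat n (c⁻¹ : ℝˣ))ᵀ * ((blockHom n g)ᵀ *
            ((simMat n c)ᵀ * formHat n * simMat n c) * blockHom n g) * simMat n (c⁻¹ : ℝˣ) := by
          simp only [Matrix.transpose_mul, Matrix.mul_assoc]
      _ = (c : ℝ) • ((simMat n (c⁻¹ : ℝˣ))ᵀ * formHat n * simMat n (c⁻¹ : ℝˣ)) := by
          rw [hs]; simp only [Matrix.mul_smul, Matrix.smul_mul, hb]
      _ = formHat n := by
          rw [hs', smul_smul, Units.mul_inv, one_smul]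
  · have h3 : simMat n c * simMat n (c⁻¹ : ℝˣ) = 1 := by
      rw [simMat_mul, Units.mul_inv, simMat_one]
    have h4 := congrArg Matrix.det h3
    rw [Matrix.det_mul, Matrix.det_one] at h4
    have h5 : (blockHom n g).det = 1 := by simp [blockHom, h2]
    rw [hval, Matrix.det_mul, Matrix.det_mul, h5, mul_one, h4]

/-- The inclusion `SO(n+1,n) → SO(n+1,n+1)`. -/
def incl (n : ℕ) (c : ℝˣ) : G n →* GHat n :=
  ((inclGL n c).comp (G n).subtype).codRestrict (GHat n) fun g => inclGL_mem n c g g.2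

/-- The derivative of `incl`, on Lie algebras. -/
def dincl (n : ℕ) (c : ℝˣ) (X : Matrix (Idx n) (Idx n) ℝ) : Matrix (IdxHat n) (IdxHat n) ℝ :=
  simMat n c * Matrix.fromBlocks X 0 0 0 * simMat n (c⁻¹ : ℝˣ)

/-- The vector fixed by `incl n c`; for `c = 1` it is the unit vector of the coordinate `r`. -/
def vec (n : ℕ) (c : ℝˣ) : IdxHat n → ℝ := simMat n c *ᵥ Pi.single (Sum.inr ()) 1

/-! ## Cartan geometries -/

/-- The entries of a matrix, in the normed space `N → N → ℝ`, in which matrix valued maps are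
differentiated. -/
def entries {N : Type} (A : Matrix N N ℝ) : N → N → ℝ := fun i j => A i j

/-- A Cartan geometry on the manifold `M`, for a closed matrix group `P` and a space `𝔤` of matrices,
a Lie algebra containing that of `P`: a smooth principal (right) `P`-bundle `proj : Total → M` with
a Cartan connection `conn`. Maps into the embedded submanifold `P` of the space of matrices are
smooth when they are smooth as matrix valued maps. -/
structure CartanGeometry {N : Type} [Fintype N] [DecidableEq N]
    (𝔤 : Submodule ℝ (Matrix N N ℝ)) (P : Subgroup (Matrix N N ℝ)ˣ)
    {m : ℕ} (M : Type u) [TopologicalSpace M] [ChartedSpace (EuclideanSpace ℝ (Fin m)) M] where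
  /-- the total space, a smooth manifold of dimension `dim` -/
  Total : Type v
  dim : ℕ
  [top : TopologicalSpace Total]
  [charts : ChartedSpace (EuclideanSpace ℝ (Fin dim)) Total]
  [manifold : IsManifold (𝓡 dim) ∞ Total]
  /-- the bundle projection -/
  proj : Total → M
  proj_smooth : ContMDiff (𝓡 dim) (𝓡 m) ∞ proj
  /-- the right action of `P`: a smooth free action along the fibres -/
  act : Total → P → Total
  act_one : ∀ x, act x 1 = x
  act_mul : ∀ x g h, act x (g * h) = act (act x g) h
  act_free : ∀ x g, act x g = x → g = 1
  /-- smoothness of the action: `(z, y) ↦ z · q y` is smooth wherever `q : F → P` is smooth -/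
  act_smooth : ∀ (F : Type) [NormedAddCommGroup F] [NormedSpace ℝ F] [FiniteDimensional ℝ F]
    (q : F → P) (x₀ : Total) (y₀ : F),
    ContDiffAt ℝ ∞ (fun y => entries (q y).1.val) y₀ →
    ContMDiffAt ((𝓡 dim).prod 𝓘(ℝ, F)) (𝓡 dim) ∞
      (fun z : Total × F => act z.1 (q z.2)) (x₀, y₀)
  proj_act : ∀ x g, proj (act x g) = proj x
  /-- local triviality: smooth local sections `s`, and smooth fibre coordinates `k` in `P` -/
  locallyTrivial : ∀ b : M, ∃ U : Set M, IsOpen U ∧ b ∈ U ∧ ∃ (s : M → Total) (k : Total → P),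
    ContMDiffOn (𝓡 m) (𝓡 dim) ∞ s U ∧
    ContMDiffOn (𝓡 dim) 𝓘(ℝ, N → N → ℝ) ∞ (fun x => entries (k x).1.val) (proj ⁻¹' U) ∧
    (∀ y ∈ U, proj (s y) = y) ∧ ∀ x, proj x ∈ U → act (s (proj x)) (k x) = x
  /-- the Cartan connection, a smooth one-form with values in `𝔤` -/
  conn : ∀ x : Total, TangentSpace (𝓡 dim) x →ₗ[ℝ] Matrix N N ℝ
  conn_smooth : ContMDiff (𝓡 dim).tangent 𝓘(ℝ, N → N → ℝ) ∞
    (fun ξ : TangentBundle (𝓡 dim) Total => entries (conn ξ.1 ξ.2))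
  /-- the Cartan connection is `P`-equivariant -/
  conn_equivariant : ∀ x (g : P) ξ,
    conn (act x g) (mfderiv (𝓡 dim) (𝓡 dim) (fun z => act z g) x ξ) =
      (g⁻¹).1.val * conn x ξ * g.1.val
  /-- the Cartan connection maps the fundamental vector field of an element of the Lie algebra of
  `P`, the velocity of a curve `γ` in `P` at `γ 0 = 1`, to this element -/
  conn_fundamental : ∀ x (γ : ℝ → P), ContDiff ℝ ∞ (fun t => entries (γ t).1.val) → γ 0 = 1 →
    entries (conn (act x (γ 0)) (mfderiv 𝓘(ℝ, ℝ) (𝓡 dim) (fun t => act x (γ t)) 0 (1 : ℝ))) =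
      deriv (fun t => entries (γ t).1.val) 0
  /-- the Cartan connection is an isomorphism of each tangent space with `𝔤` -/
  conn_injective : ∀ x, Function.Injective (conn x)
  conn_range : ∀ x, Set.range (conn x) = (𝔤 : Set (Matrix N N ℝ))

attribute [instance] CartanGeometry.top CartanGeometry.charts CartanGeometry.manifold

section Geometry

variable {n m : ℕ} {M : Type u} [TopologicalSpace M] [ChartedSpace (EuclideanSpace ℝ (Fin m)) M]

/-- Cartan geometries of type `(SO(n+1,n), P)`. -/
abbrev FreeGeometry (n m : ℕ) (M : Type u) [TopologicalSpace M]
    [ChartedSpace (EuclideanSpace ℝ (Fin m)) M] :=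
  CartanGeometry.{u, v} (lieG n) (P n) (m := m) M

/-- Almost-spinorial geometries: Cartan geometries of type `(SO(n+1,n+1), PHat)`. -/
abbrev AlmostSpinorial (n m : ℕ) (M : Type u) [TopologicalSpace M]
    [ChartedSpace (EuclideanSpace ℝ (Fin m)) M] :=
  CartanGeometry.{u, v} (lieGHat n) (PHat n) (m := m) M

/-- Isomorphisms of almost-spinorial geometries over the identity of `M`. -/
def IsIso (B B' : AlmostSpinorial.{u, v} n m M)
    (φ : Diffeomorph (𝓡 B.dim) (𝓡 B'.dim) B.Total B'.Total ∞) : Prop :=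
  (∀ x, B'.proj (φ x) = B.proj x) ∧ (∀ x g, φ (B.act x g) = B'.act (φ x) g) ∧
  ∀ x ξ, B'.conn (φ x) (mfderiv (𝓡 B.dim) (𝓡 B'.dim) φ x ξ) = B.conn x ξ

/-- `j` is an inclusion of principal bundles over the identity of `M`, along the inclusion
`incl n (c b)` of structure groups over `b : M`, which pulls the Cartan connection back to the given
one. For `c = 1`, this says that `B` is the Fefferman extension of `C`. -/
def IsReduction (c : M → ℝˣ) (C : FreeGeometry.{u, v} n m M) (B : AlmostSpinorial.{u, v} n m M)
    (j : C.Total → B.Total) : Prop :=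
  ContMDiff (𝓡 C.dim) (𝓡 B.dim) ∞ j ∧ (∀ x, B.proj (j x) = C.proj x) ∧
  (∀ x (g : P n) (g' : PHat n), g'.1 = inclGL n (c (C.proj x)) g → j (C.act x g) = B.act (j x) g') ∧
  ∀ x ξ, B.conn (j x) (mfderiv (𝓡 C.dim) (𝓡 B.dim) j x ξ) = dincl n (c (C.proj x)) (C.conn x ξ)

/-- The base `M̂ = Total / (PHat ∩ SO(n+1,n))` of the Fefferman construction, with its quotient
topology. -/
abbrev FeffermanBase (C : FreeGeometry.{u, v} n m M) : Type v :=
  Quot fun x y : C.Total => ∃ g : P n, inclGL n 1 g ∈ PHat n ∧ y = C.act x g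

/-- Sections of the standard tractor bundle `Total ×_PHat ℝ^(n+1,n+1)`, as smooth equivariant
functions. -/
def IsTractor (B : AlmostSpinorial.{u, v} n m M) (t : B.Total → IdxHat n → ℝ) : Prop :=
  ContMDiff (𝓡 B.dim) 𝓘(ℝ, IdxHat n → ℝ) ∞ t ∧
  ∀ x (g : PHat n), t (B.act x g) =
    (g⁻¹).1.val *ᵥ t x

/-- The tractor connection induced by `conn` on equivariant functions is `∇t = dt + ω · t`; this says
that `∇t = 0`. -/
def IsParallel (B : AlmostSpinorial.{u, v} n m M) (t : B.Total → IdxHat n → ℝ) : Prop :=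
  ∀ x (ξ : TangentSpace (𝓡 B.dim) x),
    mfderiv (𝓡 B.dim) 𝓘(ℝ, IdxHat n → ℝ) t x ξ = (-(B.conn x ξ *ᵥ t x) : IdxHat n → ℝ)

/-- The square length of a vector of `ℝ^(n+1,n+1)`. -/
def sqLen (w : IdxHat n → ℝ) : ℝ := w ⬝ᵥ (formHat n *ᵥ w)

/-- The subbundle `T₍₋₁₎` of `TM` defined by a Cartan geometry of type `(SO(n+1,n), P)`: the
projection to `M` of the vectors `ξ` with `conn ξ ∈ 𝔤₍₋₁₎`. -/
def distribution (C : FreeGeometry.{u, v} n m M) (b : M) : Submodule ℝ (TangentSpace (𝓡 m) b) :=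
  Submodule.span ℝ {X | ∃ ξ : TangentBundle (𝓡 C.dim) C.Total, C.conn ξ.1 ξ.2 ∈ filt n (-1) ∧
    tangentMap (𝓡 C.dim) (𝓡 m) C.proj ξ = (⟨b, X⟩ : TangentBundle (𝓡 m) M)}

/-- Regularity: the curvature `κ = dω + [ω, ω]` of `ω = conn` maps `𝔤₍ₖ₎ × 𝔤₍ₗ₎` to `𝔤₍ₖ₊ₗ₊₁₎`. On vector fields
`X`, `Y` with constant `ω X = a` and `ω Y = b`, one has `κ(X, Y) = [a, b] - ω([X, Y])`. -/
def IsRegular (C : FreeGeometry.{u, v} n m M) : Prop :=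
  ∀ (k l : ℤ), ∀ a ∈ filt n k, ∀ b ∈ filt n l,
  ∀ X Y : (x : C.Total) → TangentSpace (𝓡 C.dim) x,
    (∀ x, C.conn x (X x) = a) → (∀ x, C.conn x (Y x) = b) →
    ∀ x, a * b - b * a - C.conn x (VectorField.mlieBracket (𝓡 C.dim) X Y x) ∈ filt n (k + l + 1)

/-- Smooth vector fields on an open subset `U` of `M`. -/
def IsSmoothField [IsManifold (𝓡 m) ∞ M] (X : (b : M) → TangentSpace (𝓡 m) b) (U : Set M) : Prop :=
  ContMDiffOn (𝓡 m) (𝓡 m).tangent ∞ (fun b => (⟨b, X b⟩ : TangentBundle (𝓡 m) M)) U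

/-- `H` is a smooth distribution of rank `n` in `TM`. -/
def IsSmoothDistribution [IsManifold (𝓡 m) ∞ M] (n : ℕ)
    (H : (b : M) → Submodule ℝ (TangentSpace (𝓡 m) b)) : Prop :=
  ∀ b₀ : M, ∃ U : Set M, IsOpen U ∧ b₀ ∈ U ∧
    ∃ X : Fin n → (b : M) → TangentSpace (𝓡 m) b, (∀ i, IsSmoothField (X i) U) ∧
      ∀ b ∈ U, LinearIndependent ℝ (fun i => X i b) ∧
        Submodule.span ℝ (Set.range fun i => X i b) = H b

/-- `H` is a free `n`-distribution: it has rank `n`, and the Lie bracket of its sections induces an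
isomorphism of `H ∧ H` with `TM / H`. -/
def IsFree [IsManifold (𝓡 m) ∞ M] (n : ℕ)
    (H : (b : M) → Submodule ℝ (TangentSpace (𝓡 m) b)) : Prop :=
  IsSmoothDistribution n H ∧
  ∀ b : M, ∃ L : (⋀[ℝ]^2 (H b)) ≃ₗ[ℝ] (TangentSpace (𝓡 m) b ⧸ H b),
    ∀ (U : Set M) (hb : b ∈ U) (X Y : (b : M) → TangentSpace (𝓡 m) b), IsOpen U →
      IsSmoothField X U → IsSmoothField Y U →
      ∀ (hX : ∀ b' ∈ U, X b' ∈ H b') (hY : ∀ b' ∈ U, Y b' ∈ H b'),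
        L (exteriorPower.ιMulti ℝ 2 ![⟨X b, hX b hb⟩, ⟨Y b, hY b hb⟩]) =
          (H b).mkQ (VectorField.mlieBracket (𝓡 m) X Y b)

end Geometry

end FreeDist

end

/-! The group `G` is the stabilizer in `GHat` of the nonisotropic vector v_c = `vec n c`, and three
algebraic facts carry both constructions. First, `PHat` meets the image of `G` in the image of `P`:
since s_c is the identity on `planeHat`, this is a statement about diag(g, 1), and the determinant
condition forces the t-t entry of an element of `P` to be 1 (`inclGL_mem_iff`, `P_apply_tt`).
Second, the Lie algebra of `GHat` is the sum of the image of 𝔤 and the Lie algebra of `PHat`, and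
these meet in the image of 𝔭, so the two quotients by the parabolic subalgebras agree
(`exists_sub_dincl_mem`, `dincl_mem_iff`). Third, `PHat` moves v_c to every vector of square length
-c, smoothly in the target (`exists_mover`): in coordinates p, q with metric 2 p·q, already GL(n+1)
is transitive on pairs with a given nonzero p·q. The open embedding of homogeneous spaces follows
from the third fact: an element near i_c(g) falls into the stabilizer of v_c after right
multiplication by an element of `PHat`.

Cartan geometries are handled through local sections s and their gauge forms s*ω. A gauge form
induces an isomorphism of each tangent space of M with 𝔤/𝔭, and a change of section acts by A ↦
k⁻¹Ak + k⁻¹dk. Conversely, sections with smooth transition functions and gauge forms with these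
properties determine a Cartan geometry (`GaugeData.geometry`). The Cayley transform plays the part
of the exponential map: it is rational, and it identifies the group near 1 with its Lie algebra near
0.

For the extension, the associated bundle `Ext` gets the images of the gauge forms of the given
geometry; the second fact makes them gauge forms of a Cartan connection. The function [x, h] ↦ h⁻¹v₁
is well defined because the image of `P` fixes v₁, and parallel because the image of 𝔤 annihilates
v₁. Every point of an extension is some j(z)g, so j(z)g ↦ j'(z)g is the only candidate for an
isomorphism (`exists_isIso`). For the converse, ∇τ = 0 and skewness of the connection make the
square length locally constant. The third fact gives local sections along which τ is the constant
v_c. Being parallel then means that their gauge forms annihilate v_c, hence come from 𝔤, and their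
transition functions fix v_c, hence come from `P` (`redData`).

The distribution is the preimage of 𝔤₍₋₁₎/𝔭 under a gauge form, so it is smooth of rank n. If ω is
regular, then ω([X, Y]) and [ωX, ωY] agree modulo 𝔤₍₋₁₎ for sections X, Y of the distribution
(`IsRegular.pull_mlieBracket_apply`), and the algebraic bracket sends a pair of vectors to the
alternating matrix of their wedge product (`commutator_apply`). This is freeness. -/

open scoped Manifold ContDiff Topology
open Matrix

noncomputable section

namespace FreeDist

set_option linter.unusedSectionVars false
set_option linter.unusedVariables false

/-! ## Smooth matrix valued maps -/

section MatrixCalculus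

variable {N : Type} [Fintype N] [DecidableEq N]
  {E : Type*} [NormedAddCommGroup E] [NormedSpace ℝ E] {H : Type*} [TopologicalSpace H]
  {I : ModelWithCorners ℝ E H} {X : Type*} [TopologicalSpace X] [ChartedSpace H X]
  {E' : Type*} [NormedAddCommGroup E'] [NormedSpace ℝ E'] {H' : Type*} [TopologicalSpace H']
  {I' : ModelWithCorners ℝ E' H'} {X' : Type*} [TopologicalSpace X'] [ChartedSpace H' X']
  {F : Type*} [NormedAddCommGroup F] [NormedSpace ℝ F]

/-- The derivative of a map to a vector space, with values in this vector space. -/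
def vderiv (I : ModelWithCorners ℝ E H) (f : X → F) (x : X) (ξ : TangentSpace I x) : F :=
  mfderiv I 𝓘(ℝ, F) f x ξ

/-- The derivative of a matrix valued map. -/
def mderiv (I : ModelWithCorners ℝ E H) (A : X → Matrix N N ℝ) (x : X) (ξ : TangentSpace I x) :
    Matrix N N ℝ :=
  vderiv (F := N → N → ℝ) I (fun y => entries (A y)) x ξ

/-- The entries of a matrix, as a linear equivalence. -/
def entriesL (N : Type) : Matrix N N ℝ ≃ₗ[ℝ] (N → N → ℝ) := LinearEquiv.refl ℝ _

lemma mfderiv_bilinear {F₁ F₂ F₃ : Type*} [NormedAddCommGroup F₁] [NormedSpace ℝ F₁]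
    [NormedAddCommGroup F₂] [NormedSpace ℝ F₂] [NormedAddCommGroup F₃] [NormedSpace ℝ F₃]
    (L : F₁ →L[ℝ] F₂ →L[ℝ] F₃) {f : X → F₁} {g : X → F₂} {x : X}
    (hf : MDifferentiableAt I 𝓘(ℝ, F₁) f x) (hg : MDifferentiableAt I 𝓘(ℝ, F₂) g x)
    (ξ : TangentSpace I x) :
    vderiv I (fun y => L (f y) (g y)) x ξ = L (vderiv I f x ξ) (g x) + L (f x) (vderiv I g x ξ) := by
  have h1 := hf.hasMFDerivAt
  have h2 := hg.hasMFDerivAt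
  have h3 : HasMFDerivAt I 𝓘(ℝ, F₃) (fun y => L (f y) (g y)) x
      ((L.precompR E (f x) (mfderiv I 𝓘(ℝ, F₂) g x) +
        L.precompL E (mfderiv I 𝓘(ℝ, F₁) f x) (g x) : E →L[ℝ] F₃)) := by
    refine ⟨?_, ?_⟩
    · exact (L.continuous.continuousAt.comp h1.1).clm_apply h2.1
    · have h4 := L.hasFDerivWithinAt_of_bilinear h1.2 h2.2
      simp only [writtenInExtChartAt, extChartAt_model_space_eq_id, PartialEquiv.refl_coe,
        Function.comp_def, id, extChartAt_to_inv] at h4 ⊢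
      exact h4
  unfold vderiv
  rw [h3.mfderiv]
  exact add_comm _ _

lemma mfderiv_linear {F' : Type*} [NormedAddCommGroup F'] [NormedSpace ℝ F'] (L : F →L[ℝ] F')
    {f : X → F} {x : X} (hf : MDifferentiableAt I 𝓘(ℝ, F) f x) (ξ : TangentSpace I x) :
    vderiv I (fun y => L (f y)) x ξ = L (vderiv I f x ξ) := by
  unfold vderiv
  have h := mfderiv_comp_apply (I := I) (I' := 𝓘(ℝ, F)) (I'' := 𝓘(ℝ, F')) (g := L) x
    L.differentiableAt.mdifferentiableAt hf ξ
  rw [mfderiv_eq_fderiv, L.fderiv] at h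
  exact h

lemma vderiv_comp {f : X' → F} {g : X → X'} {x : X}
    (hf : MDifferentiableAt I' 𝓘(ℝ, F) f (g x)) (hg : MDifferentiableAt I I' g x)
    (ξ : TangentSpace I x) :
    vderiv I (fun y => f (g y)) x ξ = vderiv I' f (g x) (mfderiv I I' g x ξ) :=
  mfderiv_comp_apply x hf hg ξ

lemma vderiv_congr {f g : X → F} {x : X} (h : f =ᶠ[𝓝 x] g) (ξ : TangentSpace I x) :
    vderiv I f x ξ = vderiv I g x ξ := by
  unfold vderiv
  have := h.mfderiv_eq (I := I) (I' := 𝓘(ℝ, F))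
  exact congrArg (fun L : TangentSpace I x →L[ℝ] F => L ξ) this

@[simp] lemma vderiv_const (c : F) (x : X) (ξ : TangentSpace I x) :
    vderiv I (fun _ => c) x ξ = 0 := by
  unfold vderiv
  rw [mfderiv_const]; rfl

lemma vderiv_add {f g : X → F} {x : X} (hf : MDifferentiableAt I 𝓘(ℝ, F) f x)
    (hg : MDifferentiableAt I 𝓘(ℝ, F) g x) (ξ : TangentSpace I x) :
    vderiv I (fun y => f y + g y) x ξ = vderiv I f x ξ + vderiv I g x ξ :=
  congrArg (fun L : E →L[ℝ] F => L ξ) (hf.hasMFDerivAt.add hg.hasMFDerivAt).mfderiv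

lemma vderiv_sub {f g : X → F} {x : X} (hf : MDifferentiableAt I 𝓘(ℝ, F) f x)
    (hg : MDifferentiableAt I 𝓘(ℝ, F) g x) (ξ : TangentSpace I x) :
    vderiv I (fun y => f y - g y) x ξ = vderiv I f x ξ - vderiv I g x ξ :=
  congrArg (fun L : E →L[ℝ] F => L ξ) (hf.hasMFDerivAt.sub hg.hasMFDerivAt).mfderiv

/-- The unit tangent vector of the real line. -/
def unitVec (t : ℝ) : TangentSpace 𝓘(ℝ, ℝ) t := (1 : ℝ)

lemma vderiv_unitVec {f : ℝ → F} {f' : F} {t : ℝ} (h : HasDerivAt f f' t) :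
    vderiv 𝓘(ℝ, ℝ) f t (unitVec t) = f' := by
  have h2 := h.deriv
  rw [← fderiv_apply_one_eq_deriv, ← mfderiv_eq_fderiv] at h2
  exact h2

/-- The matrix product, as a continuous bilinear map. -/
def mulEntries (N : Type) [Fintype N] [DecidableEq N] :
    (N → N → ℝ) →L[ℝ] (N → N → ℝ) →L[ℝ] (N → N → ℝ) :=
  LinearMap.toContinuousBilinearMap
    (((LinearMap.mul ℝ (Matrix N N ℝ)) : Matrix N N ℝ →ₗ[ℝ] Matrix N N ℝ →ₗ[ℝ] Matrix N N ℝ) :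
      (N → N → ℝ) →ₗ[ℝ] (N → N → ℝ) →ₗ[ℝ] (N → N → ℝ))

/-- Smoothness of a matrix valued map at a point. -/
def MSmoothAt (I : ModelWithCorners ℝ E H) (A : X → Matrix N N ℝ) (x : X) : Prop :=
  ContMDiffAt I 𝓘(ℝ, N → N → ℝ) ∞ (fun y => entries (A y)) x

lemma MSmoothAt.mdiff {A : X → Matrix N N ℝ} {x : X} (h : MSmoothAt I A x) :
    MDifferentiableAt I 𝓘(ℝ, N → N → ℝ) (fun y => entries (A y)) x :=
  ContMDiffAt.mdifferentiableAt h (by simp)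

lemma MSmoothAt.mul {A B : X → Matrix N N ℝ} {x : X} (hA : MSmoothAt I A x)
    (hB : MSmoothAt I B x) : MSmoothAt I (fun y => A y * B y) x := by
  have h : ContMDiffAt I 𝓘(ℝ, (N → N → ℝ) →L[ℝ] (N → N → ℝ)) ∞
      (fun y => mulEntries N (entries (A y))) x :=
    (mulEntries N).contMDiff.contMDiffAt.comp x hA
  exact h.clm_apply hB

lemma mderiv_mul {A B : X → Matrix N N ℝ} {x : X} (hA : MSmoothAt I A x)
    (hB : MSmoothAt I B x) (ξ : TangentSpace I x) :
    mderiv I (fun y => A y * B y) x ξ = mderiv I A x ξ * B x + A x * mderiv I B x ξ :=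
  mfderiv_bilinear (mulEntries N) hA.mdiff hB.mdiff ξ

lemma MSmoothAt.const (A : Matrix N N ℝ) (x : X) : MSmoothAt I (fun _ => A) x :=
  contMDiffAt_const

@[simp] lemma mderiv_const (A : Matrix N N ℝ) (x : X) (ξ : TangentSpace I x) :
    mderiv I (fun _ => A) x ξ = 0 := vderiv_const (F := N → N → ℝ) (entries A) x ξ

lemma mderiv_add {A B : X → Matrix N N ℝ} {x : X} (hA : MSmoothAt I A x)
    (hB : MSmoothAt I B x) (ξ : TangentSpace I x) :
    mderiv I (fun y => A y + B y) x ξ = mderiv I A x ξ + mderiv I B x ξ :=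
  vderiv_add hA.mdiff hB.mdiff ξ

lemma mderiv_sub {A B : X → Matrix N N ℝ} {x : X} (hA : MSmoothAt I A x)
    (hB : MSmoothAt I B x) (ξ : TangentSpace I x) :
    mderiv I (fun y => A y - B y) x ξ = mderiv I A x ξ - mderiv I B x ξ :=
  vderiv_sub hA.mdiff hB.mdiff ξ

lemma mderiv_const_mul (A : Matrix N N ℝ) {B : X → Matrix N N ℝ} {x : X}
    (hB : MSmoothAt I B x) (ξ : TangentSpace I x) :
    mderiv I (fun y => A * B y) x ξ = A * mderiv I B x ξ := by
  rw [mderiv_mul (MSmoothAt.const A x) hB]; simp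

lemma MSmoothAt.congr {A B : X → Matrix N N ℝ} {x : X} (hA : MSmoothAt I A x)
    (h : B =ᶠ[𝓝 x] A) : MSmoothAt I B x :=
  ContMDiffAt.congr_of_eventuallyEq hA (h.mono fun y hy => congrArg entries hy)

lemma mderiv_congr {A B : X → Matrix N N ℝ} {x : X} (h : A =ᶠ[𝓝 x] B) (ξ : TangentSpace I x) :
    mderiv I A x ξ = mderiv I B x ξ :=
  vderiv_congr (h.mono fun y hy => congrArg entries hy) ξ

lemma MSmoothAt.comp {A : X' → Matrix N N ℝ} {g : X → X'} {x : X}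
    (hA : MSmoothAt I' A (g x)) (hg : ContMDiffAt I I' ∞ g x) : MSmoothAt I (fun y => A (g y)) x :=
  ContMDiffAt.comp x hA hg

lemma mderiv_comp {A : X' → Matrix N N ℝ} {g : X → X'} {x : X}
    (hA : MSmoothAt I' A (g x)) (hg : ContMDiffAt I I' ∞ g x) (ξ : TangentSpace I x) :
    mderiv I (fun y => A (g y)) x ξ = mderiv I' A (g x) (mfderiv I I' g x ξ) :=
  vderiv_comp hA.mdiff (hg.mdifferentiableAt (by simp)) ξ

/-- A linear map on matrices, as a continuous linear map on entries. -/
def onEntries (L : Matrix N N ℝ →ₗ[ℝ] F) : (N → N → ℝ) →L[ℝ] F :=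
  LinearMap.toContinuousLinearMap (L ∘ₗ (entriesL N).symm.toLinearMap)

lemma MSmoothAt.linear {A : X → Matrix N N ℝ} {x : X} (hA : MSmoothAt I A x)
    (L : Matrix N N ℝ →ₗ[ℝ] F) : ContMDiffAt I 𝓘(ℝ, F) ∞ (fun y => L (A y)) x :=
  (onEntries L).contMDiff.contMDiffAt.comp x hA

lemma vderiv_linear {A : X → Matrix N N ℝ} {x : X} (hA : MSmoothAt I A x)
    (L : Matrix N N ℝ →ₗ[ℝ] F) (ξ : TangentSpace I x) :
    vderiv I (fun y => L (A y)) x ξ = L (mderiv I A x ξ) :=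
  mfderiv_linear (onEntries L) hA.mdiff ξ

lemma MSmoothAt.mlinear {N' : Type} [Fintype N'] {A : X → Matrix N N ℝ} {x : X}
    (hA : MSmoothAt I A x) (L : Matrix N N ℝ →ₗ[ℝ] Matrix N' N' ℝ) :
    MSmoothAt I (fun y => L (A y)) x :=
  hA.linear ((entriesL N').toLinearMap ∘ₗ L)

lemma mderiv_linear {N' : Type} [Fintype N'] {A : X → Matrix N N ℝ} {x : X}
    (hA : MSmoothAt I A x) (L : Matrix N N ℝ →ₗ[ℝ] Matrix N' N' ℝ) (ξ : TangentSpace I x) :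
    mderiv I (fun y => L (A y)) x ξ = L (mderiv I A x ξ) :=
  vderiv_linear hA ((entriesL N').toLinearMap ∘ₗ L) ξ

lemma mSmoothAt_iff {A : X → Matrix N N ℝ} {x : X} :
    MSmoothAt I A x ↔ ∀ i j, ContMDiffAt I 𝓘(ℝ, ℝ) ∞ (fun y => A y i j) x := by
  unfold MSmoothAt
  rw [contMDiffAt_pi_space]
  exact forall_congr' fun i => contMDiffAt_pi_space

lemma MSmoothAt.det {A : X → Matrix N N ℝ} {x : X} (hA : MSmoothAt I A x) :
    ContMDiffAt I 𝓘(ℝ, ℝ) ∞ (fun y => (A y).det) x := by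
  rw [mSmoothAt_iff] at hA
  simp only [Matrix.det_apply]
  refine contMDiffAt_finsetSum fun σ _ => ?_
  simp only [Units.smul_def, zsmul_eq_mul]
  refine contMDiffAt_const.mul ?_
  exact contMDiffAt_finsetProd fun i _ => hA _ _

lemma MSmoothAt.inv {A : X → Matrix N N ℝ} {x : X} (hA : MSmoothAt I A x)
    (h : IsUnit (A x).det) : MSmoothAt I (fun y => (A y)⁻¹) x := by
  rw [mSmoothAt_iff]
  intro i j
  have h1 : ContMDiffAt I 𝓘(ℝ, ℝ) ∞ (fun y => ((A y).det)⁻¹) x :=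
    (contDiffAt_inv ℝ h.ne_zero).contMDiffAt.comp x hA.det
  have h2 : ContMDiffAt I 𝓘(ℝ, ℝ) ∞ (fun y => (A y).adjugate i j) x := by
    simp only [Matrix.adjugate_apply]
    refine MSmoothAt.det ?_
    rw [mSmoothAt_iff] at hA ⊢
    intro a b
    by_cases hj : a = j
    · subst hj; simp only [Matrix.updateRow_self]; exact contMDiffAt_const
    · simp only [Matrix.updateRow_ne hj]; exact hA a b
  have h3 : (fun y => (A y)⁻¹ i j) = fun y => ((A y).det)⁻¹ * (A y).adjugate i j := by
    funext y
    rw [Matrix.inv_def, Ring.inverse_eq_inv', Matrix.smul_apply, smul_eq_mul]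
  rw [h3]
  exact h1.mul h2

lemma MSmoothAt.add {A B : X → Matrix N N ℝ} {x : X} (hA : MSmoothAt I A x)
    (hB : MSmoothAt I B x) : MSmoothAt I (fun y => A y + B y) x :=
  ContMDiffAt.add hA hB

lemma MSmoothAt.sub {A B : X → Matrix N N ℝ} {x : X} (hA : MSmoothAt I A x)
    (hB : MSmoothAt I B x) : MSmoothAt I (fun y => A y - B y) x :=
  ContMDiffAt.sub hA hB

lemma MSmoothAt.continuousAt_det {A : X → Matrix N N ℝ} {x : X} (hA : MSmoothAt I A x) :
    ContinuousAt (fun y => (A y).det) x := hA.det.continuousAt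

lemma unit_inv_val (g : (Matrix N N ℝ)ˣ) : (g⁻¹).val = (g.val)⁻¹ := Matrix.coe_units_inv g

lemma unit_det (g : (Matrix N N ℝ)ˣ) : IsUnit g.val.det :=
  (Matrix.isUnit_iff_isUnit_det _).1 g.isUnit

/-- Smoothness of a map to a matrix group at a point. -/
def GSmoothAt (I : ModelWithCorners ℝ E H) {P : Subgroup (Matrix N N ℝ)ˣ} (k : X → P) (x : X) :
    Prop := MSmoothAt I (fun y => (k y).1.val) x

variable {P : Subgroup (Matrix N N ℝ)ˣ}

lemma GSmoothAt.mul {k l : X → P} {x : X} (hk : GSmoothAt I k x) (hl : GSmoothAt I l x) :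
    GSmoothAt I (fun y => k y * l y) x := MSmoothAt.mul hk hl

lemma GSmoothAt.const (g : P) (x : X) : GSmoothAt I (fun _ => g) x := MSmoothAt.const _ x

lemma GSmoothAt.inv {k : X → P} {x : X} (hk : GSmoothAt I k x) :
    GSmoothAt I (fun y => (k y)⁻¹) x := by
  refine MSmoothAt.congr (MSmoothAt.inv hk (unit_det _)) (Filter.Eventually.of_forall fun y => ?_)
  exact unit_inv_val _

lemma GSmoothAt.comp {k : X' → P} {g : X → X'} {x : X}
    (hk : GSmoothAt I' k (g x)) (hg : ContMDiffAt I I' ∞ g x) : GSmoothAt I (fun y => k (g y)) x :=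
  MSmoothAt.comp (I' := I') (A := fun y => (k y).1.val) hk hg

/-- The derivative of a map to a matrix group. -/
def gderiv (I : ModelWithCorners ℝ E H) (k : X → P) (x : X) (ξ : TangentSpace I x) :
    Matrix N N ℝ := mderiv I (fun y => (k y).1.val) x ξ

lemma gderiv_mul {k l : X → P} {x : X} (hk : GSmoothAt I k x) (hl : GSmoothAt I l x)
    (ξ : TangentSpace I x) : gderiv I (fun y => k y * l y) x ξ =
      gderiv I k x ξ * (l x).1.val + (k x).1.val * gderiv I l x ξ := mderiv_mul hk hl ξ

@[simp] lemma inv_mul_val (g : P) : (g⁻¹).1.val * g.1.val = 1 := by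
  rw [← Units.val_mul, ← Subgroup.coe_mul, inv_mul_cancel]; rfl

@[simp] lemma mul_inv_val (g : P) : g.1.val * (g⁻¹).1.val = 1 := by
  rw [← Units.val_mul, ← Subgroup.coe_mul, mul_inv_cancel]; rfl

@[simp] lemma inv_mul_val_assoc (g : P) (A : Matrix N N ℝ) : (g⁻¹).1.val * (g.1.val * A) = A := by
  rw [← Matrix.mul_assoc, inv_mul_val, Matrix.one_mul]

@[simp] lemma mul_inv_val_assoc (g : P) (A : Matrix N N ℝ) : g.1.val * ((g⁻¹).1.val * A) = A := by
  rw [← Matrix.mul_assoc, mul_inv_val, Matrix.one_mul]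

lemma gderiv_inv {k : X → P} {x : X} (hk : GSmoothAt I k x) (ξ : TangentSpace I x) :
    gderiv I (fun y => (k y)⁻¹) x ξ =
      -(((k x)⁻¹).1.val * gderiv I k x ξ * ((k x)⁻¹).1.val) := by
  have h := gderiv_mul hk hk.inv ξ
  have h0 : gderiv I (fun y => k y * (k y)⁻¹) x ξ = 0 := by
    have : (fun y => k y * (k y)⁻¹) = fun _ => (1 : P) := by funext y; simp
    rw [this]; exact mderiv_const _ _ _
  rw [h0] at h
  have h2 := congrArg (fun A => ((k x)⁻¹).1.val * A) h
  simp only [Matrix.mul_add, inv_mul_val_assoc, Matrix.mul_zero] at h2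
  rw [Matrix.mul_assoc, eq_neg_iff_add_eq_zero, add_comm]
  exact h2.symm

lemma gderiv_comp {k : X' → P} {g : X → X'} {x : X}
    (hk : GSmoothAt I' k (g x)) (hg : ContMDiffAt I I' ∞ g x) (ξ : TangentSpace I x) :
    gderiv I (fun y => k (g y)) x ξ = gderiv I' k (g x) (mfderiv I I' g x ξ) :=
  mderiv_comp hk hg ξ

@[simp] lemma gderiv_const (g : P) (x : X) (ξ : TangentSpace I x) :
    gderiv I (fun _ => g) x ξ = 0 := mderiv_const _ x ξ

lemma gderiv_congr {k l : X → P} {x : X} (h : k =ᶠ[𝓝 x] l) (ξ : TangentSpace I x) :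
    gderiv I k x ξ = gderiv I l x ξ :=
  mderiv_congr (h.mono fun y hy => by simp only [hy]) ξ

lemma GSmoothAt.congr {k l : X → P} {x : X} (hk : GSmoothAt I k x) (h : l =ᶠ[𝓝 x] k) :
    GSmoothAt I l x :=
  MSmoothAt.congr hk (h.mono fun y hy => by simp only [hy])

/-- The subspace is the kernel of a linear endomorphism, whose composite with `f` vanishes near `x`.
-/
lemma vderiv_mem (p : Submodule ℝ F) [FiniteDimensional ℝ F] {f : X → F} {x : X}
    (hf : MDifferentiableAt I 𝓘(ℝ, F) f x) (h : ∀ᶠ y in 𝓝 x, f y ∈ p) (ξ : TangentSpace I x) :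
    vderiv I f x ξ ∈ p := by
  obtain ⟨q, hq⟩ := p.exists_isCompl
  obtain ⟨π, hπ⟩ : ∃ π : F →ₗ[ℝ] F, LinearMap.ker π = p := by
    refine ⟨q.subtype ∘ₗ Submodule.projectionOnto q p hq.symm, ?_⟩
    rw [LinearMap.ker_comp_of_ker_eq_bot _ (Submodule.ker_subtype q)]
    exact Submodule.ker_projectionOnto _
  have h1 := mfderiv_linear (LinearMap.toContinuousLinearMap π) hf ξ
  have h2 : (fun y => LinearMap.toContinuousLinearMap π (f y)) =ᶠ[𝓝 x] fun _ => (0 : F) := by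
    filter_upwards [h] with y hy
    rw [← hπ] at hy
    exact hy
  rw [vderiv_congr h2, vderiv_const] at h1
  rw [← hπ]
  exact h1.symm

lemma mderiv_mem (p : Submodule ℝ (Matrix N N ℝ)) {A : X → Matrix N N ℝ} {x : X}
    (hA : MSmoothAt I A x) (h : ∀ᶠ y in 𝓝 x, A y ∈ p) (ξ : TangentSpace I x) :
    mderiv I A x ξ ∈ p := by
  have := vderiv_mem (p.map (entriesL N).toLinearMap) hA.mdiff
    (h.mono fun y hy => ⟨A y, hy, rfl⟩) ξ
  obtain ⟨B, hB, hB'⟩ := this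
  have : B = mderiv I A x ξ := hB'
  rwa [← this]

end MatrixCalculus

/-! ## Cartan geometries: sections and gauge forms -/

section CartanCalculus

variable {N : Type} [Fintype N] [DecidableEq N] {𝔤 : Submodule ℝ (Matrix N N ℝ)}
  {P : Subgroup (Matrix N N ℝ)ˣ} {m : ℕ} {M : Type u} [TopologicalSpace M]
  [ChartedSpace (EuclideanSpace ℝ (Fin m)) M]
  {E : Type*} [NormedAddCommGroup E] [NormedSpace ℝ E] {H : Type*} [TopologicalSpace H]
  {I : ModelWithCorners ℝ E H} {Y : Type*} [TopologicalSpace Y] [ChartedSpace H Y]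
  {E' : Type*} [NormedAddCommGroup E'] [NormedSpace ℝ E'] {H' : Type*} [TopologicalSpace H']
  {I' : ModelWithCorners ℝ E' H'} {Y' : Type*} [TopologicalSpace Y'] [ChartedSpace H' Y']
  {d : ℕ} {X : Type*} [TopologicalSpace X] [ChartedSpace (EuclideanSpace ℝ (Fin d)) X]

namespace CartanGeometry

/-- The pullback of the Cartan connection along a map. -/
def pull (I : ModelWithCorners ℝ E H) (C : CartanGeometry.{u, v} 𝔤 P (m := m) M)
    (f : Y → C.Total) (x : Y) (ξ : TangentSpace I x) : Matrix N N ℝ :=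
  C.conn (f x) (mfderiv I (𝓡 C.dim) f x ξ)

variable (C : CartanGeometry.{u, v} 𝔤 P (m := m) M)

lemma conn_eq_of_eq {p q : C.Total} (h : p = q) (w : EuclideanSpace ℝ (Fin C.dim)) :
    C.conn p w = C.conn q w := by subst h; rfl

lemma pull_congr {f g : Y → C.Total} {x : Y} (h : f =ᶠ[𝓝 x] g) (ξ : TangentSpace I x) :
    C.pull I f x ξ = C.pull I g x ξ := by
  have h1 := h.mfderiv_eq (I := I) (I' := 𝓡 C.dim)
  have h2 : (mfderiv I (𝓡 C.dim) f x ξ : EuclideanSpace ℝ (Fin C.dim)) =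
      mfderiv I (𝓡 C.dim) g x ξ :=
    congrArg (fun L : E →L[ℝ] EuclideanSpace ℝ (Fin C.dim) => L ξ) h1
  unfold pull
  exact (C.conn_eq_of_eq h.self_of_nhds _).trans (congrArg (C.conn (g x)) h2)

lemma pull_comp {f : Y' → C.Total} {c : Y → Y'} {x : Y}
    (hf : MDifferentiableAt I' (𝓡 C.dim) f (c x)) (hc : MDifferentiableAt I I' c x)
    (ξ : TangentSpace I x) :
    C.pull I (fun y => f (c y)) x ξ = C.pull I' f (c x) (mfderiv I I' c x ξ) := by
  unfold pull
  exact congrArg (C.conn (f (c x))) (mfderiv_comp_apply x hf hc ξ)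

/-- The base point of a tangent vector is part of its type, so base points are replaced by this
lemma instead of by rewriting. -/
lemma pull_point {F : Type*} [NormedAddCommGroup F] [NormedSpace ℝ F] {f : F → C.Total} {a b : F}
    (h : a = b) {w w' : F} (hw : w = w') : C.pull 𝓘(ℝ, F) f a w = C.pull 𝓘(ℝ, F) f b w' := by
  subst h hw; rfl

lemma gderiv_point {F : Type*} [NormedAddCommGroup F] [NormedSpace ℝ F] {f : F → P} {a b : F}
    (h : a = b) {w w' : F} (hw : w = w') : gderiv 𝓘(ℝ, F) f a w = gderiv 𝓘(ℝ, F) f b w' := by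
  subst h hw; rfl

lemma pull_id (x : C.Total) (ξ : TangentSpace (𝓡 C.dim) x) :
    C.pull (𝓡 C.dim) (fun y => y) x ξ = C.conn x ξ := by
  have : mfderiv (𝓡 C.dim) (𝓡 C.dim) (fun y : C.Total => y) x ξ = ξ := by
    have := mfderiv_id (I := 𝓡 C.dim) (x := x)
    exact congrArg (fun L : TangentSpace (𝓡 C.dim) x →L[ℝ] TangentSpace (𝓡 C.dim) x => L ξ) this
  exact congrArg (C.conn x) this

lemma act_smoothAt_vector {F : Type} [NormedAddCommGroup F] [NormedSpace ℝ F]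
    [FiniteDimensional ℝ F] {q : F → P} {z : Y → C.Total} {c : Y → F} {x : Y}
    (hq : GSmoothAt 𝓘(ℝ, F) q (c x)) (hz : ContMDiffAt I (𝓡 C.dim) ∞ z x)
    (hc : ContMDiffAt I 𝓘(ℝ, F) ∞ c x) :
    ContMDiffAt I (𝓡 C.dim) ∞ (fun y => C.act (z y) (q (c y))) x := by
  have h := C.act_smooth F q (z x) (c x) hq.contDiffAt
  exact ContMDiffAt.comp (f := fun y => (z y, c y)) x h (hz.prodMk hc)

lemma chart_coord_smooth [IsManifold (𝓡 d) ∞ X] {k : X → P} {x y : X}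
    (hy : y ∈ (extChartAt (𝓡 d) x).source) (hk : GSmoothAt (𝓡 d) k y) :
    GSmoothAt 𝓘(ℝ, EuclideanSpace ℝ (Fin d)) (fun e => k ((extChartAt (𝓡 d) x).symm e))
      (extChartAt (𝓡 d) x y) := by
  refine GSmoothAt.comp (I' := 𝓡 d) ?_ ?_
  · rwa [(extChartAt (𝓡 d) x).left_inv hy]
  · exact (contMDiffOn_extChartAt_symm x).contMDiffAt
      (extChartAt_target_mem_nhds' ((extChartAt (𝓡 d) x).map_source hy))

/-- The axiom `act_smooth` concerns group elements parametrized by a vector space. A map `k` on a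
manifold is brought to this form by reading it in a chart. -/
lemma act_smoothAt [IsManifold (𝓡 d) ∞ X] {z : X → C.Total} {k : X → P} {x : X}
    (hz : ContMDiffAt (𝓡 d) (𝓡 C.dim) ∞ z x) (hk : GSmoothAt (𝓡 d) k x) :
    ContMDiffAt (𝓡 d) (𝓡 C.dim) ∞ (fun y => C.act (z y) (k y)) x := by
  have h := C.act_smoothAt_vector (c := extChartAt (𝓡 d) x)
    (chart_coord_smooth (mem_extChartAt_source x) hk) hz contMDiffAt_extChartAt
  refine h.congr_of_eventuallyEq ?_
  filter_upwards [extChartAt_source_mem_nhds (I := 𝓡 d) x] with y hy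
  rw [(extChartAt (𝓡 d) x).left_inv hy]

/-- The axiom `conn_fundamental` asks for curves smooth on the whole line. This reparametrization
has unit speed at 0 and stays in [-δ, δ], so it turns a locally smooth family into such a curve. -/
lemma sin_curve (δ : ℝ) (hδ : 0 < δ) : HasDerivAt (fun t : ℝ => δ * Real.sin (t / δ)) 1 0 := by
  have h := ((Real.hasDerivAt_sin (0 / δ)).comp (0 : ℝ) ((hasDerivAt_id (0 : ℝ)).div_const δ))
  have h2 := h.const_mul δ
  simp only [zero_div, Real.cos_zero, one_mul] at h2
  rw [mul_one_div_cancel hδ.ne'] at h2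
  exact h2

/-- Along the orbit of a fixed point, the family can be left translated to pass through 1; there the
connection is given by `conn_fundamental`. -/
lemma conn_act_const {F : Type} [NormedAddCommGroup F] [NormedSpace ℝ F]
    [FiniteDimensional ℝ F] {q : F → P} {y₀ : F} (hq : ∀ᶠ y in 𝓝 y₀, GSmoothAt 𝓘(ℝ, F) q y)
    (z₀ : C.Total) (w : F) :
    C.pull 𝓘(ℝ, F) (fun e => C.act z₀ (q e)) y₀ w =
      ((q y₀)⁻¹).1.val * gderiv 𝓘(ℝ, F) q y₀ w := by
  obtain ⟨ε, hε, hball⟩ := Metric.eventually_nhds_iff_ball.1 hq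
  obtain ⟨δ, hδ, hδw⟩ : ∃ δ : ℝ, 0 < δ ∧ δ * ‖w‖ < ε := by
    refine ⟨ε / (2 * (‖w‖ + 1)), by positivity, ?_⟩
    have : 0 ≤ ‖w‖ := norm_nonneg w
    rw [div_mul_eq_mul_div, div_lt_iff₀ (by positivity)]
    nlinarith
  set c : ℝ → F := fun t => y₀ + (δ * Real.sin (t / δ)) • w with hc
  have hc0 : c 0 = y₀ := by simp [hc]
  have hcs : ContDiff ℝ ∞ c := by
    refine contDiff_const.add (ContDiff.smul ?_ contDiff_const)
    exact contDiff_const.mul (Real.contDiff_sin.comp (contDiff_id.div_const δ))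
  have hcd : HasDerivAt c w 0 := by
    have := ((sin_curve δ hδ).smul_const w).const_add y₀
    rw [one_smul] at this
    exact this
  have hcb : ∀ t, c t ∈ Metric.ball y₀ ε := by
    intro t
    rw [mem_ball_iff_norm, hc]
    simp only [add_sub_cancel_left, norm_smul, norm_mul, Real.norm_eq_abs, abs_of_pos hδ]
    calc δ * |Real.sin (t / δ)| * ‖w‖ ≤ δ * 1 * ‖w‖ := by
          gcongr; exact Real.abs_sin_le_one _
      _ < ε := by rwa [mul_one]
  have hqc : ∀ t, GSmoothAt 𝓘(ℝ, ℝ) (fun t => q (c t)) t := fun t =>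
    GSmoothAt.comp (I' := 𝓘(ℝ, F)) (hball _ (hcb t)) hcs.contMDiff.contMDiffAt
  -- Seen from the base point `act z₀ (q y₀)`, the curve in the orbit is given by `γ`, which starts
  -- at 1.
  set γ : ℝ → P := fun t => (q y₀)⁻¹ * q (c t) with hγ
  have hγs : ∀ t, GSmoothAt 𝓘(ℝ, ℝ) γ t := fun t => (GSmoothAt.const _ t).mul (hqc t)
  have hγ0 : γ 0 = 1 := by simp [hγ, hc0]
  have hfund := C.conn_fundamental (C.act z₀ (q y₀)) γ
    (contDiff_iff_contDiffAt.2 fun t => (hγs t).contDiffAt) hγ0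
  have hfun : (fun t => C.act (C.act z₀ (q y₀)) (γ t)) = fun t => C.act z₀ (q (c t)) := by
    funext t
    rw [← C.act_mul, hγ, mul_inv_cancel_left]
  have hcm : MDifferentiableAt 𝓘(ℝ, ℝ) 𝓘(ℝ, F) c 0 :=
    (hcs.contMDiff.contMDiffAt (x := (0 : ℝ))).mdifferentiableAt (by simp)
  have hcderiv : mfderiv 𝓘(ℝ, ℝ) 𝓘(ℝ, F) c 0 (unitVec 0) = w := vderiv_unitVec (F := F) hcd
  have hd : MDifferentiableAt 𝓘(ℝ, F) (𝓡 C.dim) (fun e => C.act z₀ (q e)) (c 0) := by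
    refine (C.act_smoothAt_vector (c := fun e => e) ?_ contMDiffAt_const
      contMDiffAt_id).mdifferentiableAt (by simp)
    exact hball _ (hcb 0)
  have h1 : C.pull 𝓘(ℝ, ℝ) (fun t => C.act (C.act z₀ (q y₀)) (γ t)) 0 (unitVec 0) =
      C.pull 𝓘(ℝ, F) (fun e => C.act z₀ (q e)) y₀ w := by
    rw [hfun]
    refine (C.pull_comp (f := fun e => C.act z₀ (q e)) hd hcm (unitVec 0)).trans ?_
    exact C.pull_point (F := F) (w := mfderiv 𝓘(ℝ, ℝ) 𝓘(ℝ, F) c 0 (unitVec 0)) hc0 hcderiv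
  have h2 : gderiv 𝓘(ℝ, ℝ) γ 0 (unitVec 0) = ((q y₀)⁻¹).1.val * gderiv 𝓘(ℝ, F) q y₀ w := by
    refine (gderiv_mul (GSmoothAt.const _ _) (hqc 0) _).trans ?_
    rw [gderiv_const, Matrix.zero_mul, zero_add]
    refine congrArg (fun A => ((q y₀)⁻¹).1.val * A) ?_
    refine (gderiv_comp (I' := 𝓘(ℝ, F)) (hball _ (hcb 0)) hcs.contMDiff.contMDiffAt _).trans ?_
    exact gderiv_point (F := F) hc0 hcderiv
  rw [← h1, ← h2]
  have h3 : gderiv 𝓘(ℝ, ℝ) γ 0 (unitVec 0) = Matrix.of (deriv (fun t => entries (γ t).1.val) 0) :=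
    vderiv_unitVec (F := N → N → ℝ) ((contDiff_iff_contDiffAt.2 fun t => (hγs t).contDiffAt).differentiable
      (by simp) 0).hasDerivAt
  rw [h3, ← hfund]
  rfl

/-- The Maurer-Cartan formula for the pullback of the connection along `y ↦ z y · q (c y)`. -/
lemma conn_act_vector {F : Type} [NormedAddCommGroup F] [NormedSpace ℝ F]
    [FiniteDimensional ℝ F] {q : F → P} {z : Y → C.Total} {c : Y → F} {x : Y}
    (hq : ∀ᶠ y in 𝓝 (c x), GSmoothAt 𝓘(ℝ, F) q y) (hz : ContMDiffAt I (𝓡 C.dim) ∞ z x)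
    (hc : ContMDiffAt I 𝓘(ℝ, F) ∞ c x) (ξ : TangentSpace I x) :
    C.pull I (fun y => C.act (z y) (q (c y))) x ξ =
      ((q (c x))⁻¹).1.val * C.pull I z x ξ * (q (c x)).1.val +
      ((q (c x))⁻¹).1.val * gderiv I (fun y => q (c y)) x ξ := by
  have hΦ : MDifferentiableAt ((𝓡 C.dim).prod 𝓘(ℝ, F)) (𝓡 C.dim)
      (fun w : C.Total × F => C.act w.1 (q w.2)) (z x, c x) :=
    (C.act_smooth F q (z x) (c x) hq.self_of_nhds.contDiffAt).mdifferentiableAt (by simp)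
  have hz' := hz.mdifferentiableAt (by simp)
  have hc' := hc.mdifferentiableAt (by simp)
  have h1 : mfderiv I (𝓡 C.dim) (fun y => C.act (z y) (q (c y))) x ξ =
      mfderiv ((𝓡 C.dim).prod 𝓘(ℝ, F)) (𝓡 C.dim)
        (fun w : C.Total × F => C.act w.1 (q w.2)) (z x, c x)
        (mfderiv I ((𝓡 C.dim).prod 𝓘(ℝ, F)) (fun y => (z y, c y)) x ξ) :=
    mfderiv_comp_apply (f := fun y => (z y, c y)) x hΦ (hz'.prodMk hc') ξ
  -- The derivative of the action splits into partial derivatives: equivariance evaluates the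
  -- connection on the first, `conn_act_const` on the second.
  rw [mfderiv_prod_eq_add_apply hΦ] at h1
  rw [mfderiv_prodMk hz' hc'] at h1
  have h2 : C.pull I (fun y => C.act (z y) (q (c y))) x ξ =
      C.conn (C.act (z x) (q (c x)))
        (mfderiv (𝓡 C.dim) (𝓡 C.dim) (fun w => C.act w (q (c x))) (z x)
          (mfderiv I (𝓡 C.dim) z x ξ)) +
      C.conn (C.act (z x) (q (c x))) (mfderiv 𝓘(ℝ, F) (𝓡 C.dim) (fun e => C.act (z x) (q e)) (c x)
          (mfderiv I 𝓘(ℝ, F) c x ξ)) :=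
    (congrArg (C.conn (C.act (z x) (q (c x)))) h1).trans (map_add _ _ _)
  rw [h2, C.conn_equivariant]
  congr 1
  rw [gderiv_comp (I' := 𝓘(ℝ, F)) hq.self_of_nhds hc]
  exact C.conn_act_const hq (z x) _

lemma conn_act [IsManifold (𝓡 d) ∞ X] {z : X → C.Total} {k : X → P} {x : X}
    (hz : ContMDiffAt (𝓡 d) (𝓡 C.dim) ∞ z x) (hk : ∀ᶠ y in 𝓝 x, GSmoothAt (𝓡 d) k y)
    (ξ : TangentSpace (𝓡 d) x) :
    C.pull (𝓡 d) (fun y => C.act (z y) (k y)) x ξ =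
      ((k x)⁻¹).1.val * C.pull (𝓡 d) z x ξ * (k x).1.val +
      ((k x)⁻¹).1.val * gderiv (𝓡 d) k x ξ := by
  set χ := extChartAt (𝓡 d) x with hχ
  have hk' : k =ᶠ[𝓝 x] fun y => k (χ.symm (χ y)) := by
    filter_upwards [extChartAt_source_mem_nhds (I := 𝓡 d) x] with y hy
    rw [χ.left_inv hy]
  have hq : ∀ᶠ e in 𝓝 (χ x),
      GSmoothAt 𝓘(ℝ, EuclideanSpace ℝ (Fin d)) (fun e => k (χ.symm e)) e := by
    have h1 := (continuousAt_extChartAt_symm (I := 𝓡 d) x).tendsto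
    rw [extChartAt_to_inv] at h1
    filter_upwards [h1.eventually hk, extChartAt_target_mem_nhds (I := 𝓡 d) x] with e he he'
    have := chart_coord_smooth (x := x) (χ.map_target he') he
    rwa [← hχ, χ.right_inv he'] at this
  have h := C.conn_act_vector (q := fun e => k (χ.symm e)) (c := χ) hq hz contMDiffAt_extChartAt ξ
  have hx : χ.symm (χ x) = x := extChartAt_to_inv x
  rw [hx, ← gderiv_congr hk'] at h
  rw [← h]
  refine C.pull_congr ?_ ξ
  filter_upwards [hk'] with y hy
  rw [← hy]

lemma act_inv_act (x : C.Total) (g : P) : C.act (C.act x g) g⁻¹ = x := by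
  rw [← C.act_mul, mul_inv_cancel, C.act_one]

lemma act_cancel {x : C.Total} {g h : P} (hgh : C.act x g = C.act x h) : g = h := by
  have h1 : C.act x (g * h⁻¹) = x := by rw [C.act_mul, hgh, C.act_inv_act]
  exact mul_inv_eq_one.1 (C.act_free x _ h1)

/-- Transitivity on fibres is not an axiom; it holds because local triviality makes both points
translates of the same value of a local section. -/
lemma exists_act_eq {x y : C.Total} (h : C.proj x = C.proj y) : ∃ g, C.act x g = y := by
  obtain ⟨U, -, hb, s, k, -, -, -, hk⟩ := C.locallyTrivial (C.proj x)
  have h1 := hk x hb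
  have h2 := hk y (h ▸ hb)
  have h3 : C.act x (k x)⁻¹ = s (C.proj x) := by
    have h4 := C.act_inv_act (s (C.proj x)) (k x)
    rwa [h1] at h4
  exact ⟨(k x)⁻¹ * k y, by rw [C.act_mul, h3, h, h2]⟩

lemma exists_proj_eq (b : M) : ∃ x, C.proj x = b := by
  obtain ⟨U, -, hb, s, k, -, -, hs, -⟩ := C.locallyTrivial b
  exact ⟨s b, hs b hb⟩

/-- Smooth sections of the principal bundle over an open set. -/
structure IsSection (U : Set M) (s : M → C.Total) : Prop where
  isOpen : IsOpen U
  smooth : ∀ y ∈ U, ContMDiffAt (𝓡 m) (𝓡 C.dim) ∞ s y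
  proj_eq : ∀ y ∈ U, C.proj (s y) = y

variable {C}

lemma IsSection.mono {U V : Set M} {s : M → C.Total} (hs : C.IsSection U s) (hV : IsOpen V)
    (hVU : V ⊆ U) : C.IsSection V s :=
  ⟨hV, fun y hy => hs.smooth y (hVU hy), fun y hy => hs.proj_eq y (hVU hy)⟩

lemma IsSection.act [IsManifold (𝓡 m) ∞ M] {U : Set M} {s : M → C.Total} (hs : C.IsSection U s)
    {k : M → P} (hk : ∀ y ∈ U, GSmoothAt (𝓡 m) k y) :
    C.IsSection U (fun y => C.act (s y) (k y)) :=
  ⟨hs.isOpen, fun y hy => C.act_smoothAt (hs.smooth y hy) (hk y hy),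
    fun y hy => by rw [C.proj_act, hs.proj_eq y hy]⟩

variable (C)

lemma exists_section [IsManifold (𝓡 m) ∞ M] (x : C.Total) :
    ∃ U s, C.proj x ∈ U ∧ C.IsSection U s ∧ s (C.proj x) = x := by
  obtain ⟨U, hU, hb, s, k, hs, -, hs', hk⟩ := C.locallyTrivial (C.proj x)
  -- The trivializing section, translated by the constant `k x`, passes through `x`.
  have h : C.IsSection U s := ⟨hU, fun y hy => hs.contMDiffAt (hU.mem_nhds hy), hs'⟩
  exact ⟨U, _, hb, h.act (k := fun _ => k x) (fun y _ => GSmoothAt.const _ y), hk x hb⟩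

open Classical in
/-- The coordinate in the fibre with respect to a section. -/
def coord (s : M → C.Total) (x : C.Total) : P :=
  if h : ∃ g, C.act (s (C.proj x)) g = x then h.choose else 1

variable {C}

lemma IsSection.act_coord {U : Set M} {s : M → C.Total} (hs : C.IsSection U s) {x : C.Total}
    (hx : C.proj x ∈ U) : C.act (s (C.proj x)) (C.coord s x) = x := by
  have h : ∃ g, C.act (s (C.proj x)) g = x := C.exists_act_eq (hs.proj_eq _ hx)
  unfold coord
  rw [dif_pos h]
  exact h.choose_spec

lemma IsSection.coord_eq {U : Set M} {s : M → C.Total} (hs : C.IsSection U s) {x : C.Total}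
    (hx : C.proj x ∈ U) {g : P} (hg : C.act (s (C.proj x)) g = x) : C.coord s x = g :=
  C.act_cancel ((hs.act_coord hx).trans hg.symm)

lemma IsSection.coord_act {U : Set M} {s : M → C.Total} (hs : C.IsSection U s) {x : C.Total}
    (hx : C.proj x ∈ U) (g : P) : C.coord s (C.act x g) = C.coord s x * g := by
  refine hs.coord_eq (by rwa [C.proj_act]) ?_
  rw [C.proj_act, C.act_mul, hs.act_coord hx]

/-- Local triviality provides a smooth fibre coordinate `k` for one particular section only. For an
arbitrary section the coordinate of y is k(s(π y))⁻¹ k(y). -/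
lemma IsSection.coord_smooth {U : Set M} {s : M → C.Total} (hs : C.IsSection U s) {x : C.Total}
    (hx : C.proj x ∈ U) : GSmoothAt (𝓡 C.dim) (C.coord s) x := by
  obtain ⟨V, hV, hb, t, k, -, hk, -, htk⟩ := C.locallyTrivial (C.proj x)
  have hkx : ∀ y, C.proj y ∈ V → GSmoothAt (𝓡 C.dim) k y := fun y hy =>
    hk.contMDiffAt ((hV.preimage C.proj_smooth.continuous).mem_nhds hy)
  have hsx : C.proj (s (C.proj x)) = C.proj x := hs.proj_eq _ hx
  have h1 : GSmoothAt (𝓡 C.dim) (fun y => (k (s (C.proj y)))⁻¹ * k y) x := by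
    refine (GSmoothAt.inv ?_).mul (hkx x hb)
    refine GSmoothAt.comp (I' := 𝓡 C.dim) (g := fun y => s (C.proj y)) (hkx _ (by rwa [hsx])) ?_
    exact ContMDiffAt.comp x (hs.smooth _ hx) (C.proj_smooth x)
  refine h1.congr ?_
  filter_upwards [(hs.isOpen.preimage C.proj_smooth.continuous).mem_nhds hx,
    (hV.preimage C.proj_smooth.continuous).mem_nhds hb] with y hy hy'
  refine hs.coord_eq hy ?_
  have hsy : C.proj (s (C.proj y)) = C.proj y := hs.proj_eq _ hy
  have h2 := htk (s (C.proj y)) (by rw [hsy]; exact hy')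
  rw [hsy] at h2
  have h3 : C.act (s (C.proj y)) (k (s (C.proj y)))⁻¹ = t (C.proj y) := by
    have h4 := C.act_inv_act (t (C.proj y)) (k (s (C.proj y)))
    rwa [h2] at h4
  rw [C.act_mul, h3, htk y hy']

/-- The identity of the total space is y ↦ s(π y) · (coordinate of y), and `conn_act` applies to it.
The connection is thus recovered from the gauge form. -/
lemma IsSection.conn_eq {U : Set M} {s : M → C.Total} (hs : C.IsSection U s) {x : C.Total}
    (hx : C.proj x ∈ U) (ξ : TangentSpace (𝓡 C.dim) x) :
    C.conn x ξ = ((C.coord s x)⁻¹).1.val *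
        C.pull (𝓡 m) s (C.proj x) (mfderiv (𝓡 C.dim) (𝓡 m) C.proj x ξ) * (C.coord s x).1.val +
      ((C.coord s x)⁻¹).1.val * gderiv (𝓡 C.dim) (C.coord s) x ξ := by
  have hU : ∀ᶠ y in 𝓝 x, C.proj y ∈ U :=
    (hs.isOpen.preimage C.proj_smooth.continuous).mem_nhds hx
  have h := C.conn_act (z := fun y => s (C.proj y)) (k := C.coord s) (x := x)
    (ContMDiffAt.comp x (hs.smooth _ hx) (C.proj_smooth x))
    (hU.mono fun y hy => hs.coord_smooth hy) ξ
  rw [C.pull_comp (I' := 𝓡 m) (f := s) ((hs.smooth _ hx).mdifferentiableAt (by simp))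
    ((C.proj_smooth x).mdifferentiableAt (by simp))] at h
  rw [← h, ← C.pull_id]
  refine C.pull_congr ?_ ξ
  filter_upwards [hU] with y hy
  exact (hs.act_coord hy).symm

end CartanGeometry

/-! ### The Cayley transform, vertical vectors, and gauge forms modulo the Lie algebra of the
structure group -/

/-- The Cayley transform identifies a neighbourhood of `1` in the group `P` with a neighbourhood of
`0` in `𝔭`. -/
structure IsCayleyPair (P : Subgroup (Matrix N N ℝ)ˣ) (𝔭 : Submodule ℝ (Matrix N N ℝ)) : Prop where
  cayley_mem : ∀ g ∈ P, IsUnit (g.val + 1).det → (g.val - 1) * (g.val + 1)⁻¹ ∈ 𝔭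
  inv_cayley_mem : ∀ X ∈ 𝔭, IsUnit (1 - X).det → ∃ g ∈ P, g.val = (1 + X) * (1 - X)⁻¹

section Pair

variable {𝔭 : Submodule ℝ (Matrix N N ℝ)}

lemma isUnit_two_det : IsUnit ((1 : Matrix N N ℝ) + 1).det := by
  have : (1 : Matrix N N ℝ) + 1 = (2 : ℝ) • 1 := by rw [two_smul]
  rw [this, Matrix.det_smul]
  simp

lemma MSmoothAt.eventually_isUnit_det {A : Y → Matrix N N ℝ} {x : Y} (hA : MSmoothAt I A x)
    (h : IsUnit (A x).det) : ∀ᶠ y in 𝓝 x, IsUnit (A y).det :=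
  (hA.continuousAt_det.eventually_ne h.ne_zero).mono fun _ hy => isUnit_iff_ne_zero.2 hy

/-- After left translation the map takes the value 1 at `x`. Its Cayley transform takes values in
the subspace `𝔭`, hence so does the derivative of that, which is half the logarithmic derivative
since the Cayley transform has derivative 1/2 at 1. -/
lemma IsCayleyPair.log_deriv_mem (hP : IsCayleyPair P 𝔭) {k : Y → P} {x : Y}
    (hk : GSmoothAt I k x) (ξ : TangentSpace I x) :
    ((k x)⁻¹).1.val * gderiv I k x ξ ∈ 𝔭 := by
  set A : Y → Matrix N N ℝ := fun y => ((k x)⁻¹ * k y).1.val with hA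
  have hAs : MSmoothAt I A x := (GSmoothAt.const (k x)⁻¹ x).mul hk
  have hAx : A x = 1 := by simp [hA]
  have hA1 : MSmoothAt I (fun y => A y + 1) x := hAs.add (MSmoothAt.const 1 x)
  have hu : IsUnit (A x + 1).det := by rw [hAx]; exact isUnit_two_det
  have hA2 : MSmoothAt I (fun y => (A y + 1)⁻¹) x := hA1.inv hu
  have hAm : MSmoothAt I (fun y => A y - 1) x := hAs.sub (MSmoothAt.const 1 x)
  have h1 := mderiv_mem 𝔭 (hAm.mul hA2) (by
    filter_upwards [hA1.eventually_isUnit_det hu] with y hy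
    exact hP.cayley_mem _ ((k x)⁻¹ * k y).2 hy) ξ
  rw [mderiv_mul hAm hA2, hAx, sub_self, Matrix.zero_mul, add_zero] at h1
  have h2 : mderiv I (fun y => A y - 1) x ξ = ((k x)⁻¹).1.val * gderiv I k x ξ := by
    rw [mderiv_sub hAs (MSmoothAt.const 1 x), mderiv_const, sub_zero]
    exact mderiv_const_mul _ hk ξ
  rw [h2] at h1
  have h7 : ((1 : Matrix N N ℝ) + 1)⁻¹ = (1 / 2 : ℝ) • 1 := by
    refine Matrix.inv_eq_left_inv ?_
    rw [Matrix.smul_mul, Matrix.one_mul, ← two_smul ℝ (1 : Matrix N N ℝ), smul_smul]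
    norm_num
  rw [h7, Matrix.mul_smul, Matrix.mul_one] at h1
  have := 𝔭.smul_mem 2 h1
  rwa [smul_smul, show (2 : ℝ) * (1 / 2) = 1 by norm_num, one_smul] at this

open Classical in
/-- The inverse Cayley transform. -/
def invCayley (P : Subgroup (Matrix N N ℝ)ˣ) (X : Matrix N N ℝ) : P :=
  if h : ∃ g ∈ P, g.val = (1 + X) * (1 - X)⁻¹ then ⟨h.choose, h.choose_spec.1⟩ else 1

lemma IsCayleyPair.invCayley_val (hP : IsCayleyPair P 𝔭) {X : Matrix N N ℝ} (hX : X ∈ 𝔭)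
    (h : IsUnit (1 - X).det) : (invCayley P X).1.val = (1 + X) * (1 - X)⁻¹ := by
  have h1 := hP.inv_cayley_mem X hX h
  unfold invCayley
  rw [dif_pos h1]
  exact h1.choose_spec.2

lemma IsCayleyPair.invCayley_smooth (hP : IsCayleyPair P 𝔭) {A : Y → Matrix N N ℝ} {x : Y}
    (hA : MSmoothAt I A x) (hA' : ∀ᶠ y in 𝓝 x, A y ∈ 𝔭) (h : IsUnit (1 - A x).det) :
    GSmoothAt I (fun y => invCayley P (A y)) x := by
  have h1 : MSmoothAt I (fun y => 1 - A y) x := (MSmoothAt.const 1 x).sub hA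
  refine MSmoothAt.congr (((MSmoothAt.const 1 x).add hA).mul (h1.inv h)) ?_
  filter_upwards [h1.eventually_isUnit_det h, hA'] with y hy hy'
  exact hP.invCayley_val hy' hy

namespace CartanGeometry

variable (C : CartanGeometry.{u, v} 𝔤 P (m := m) M)

/-- The vector is the velocity of the orbit of `x` under a curve in `P` with velocity `A` at 1,
obtained from a line in `𝔭` by the inverse Cayley transform. -/
lemma exists_vertical (hP : IsCayleyPair P 𝔭) (x : C.Total) {A : Matrix N N ℝ} (hA : A ∈ 𝔭) :
    ∃ ξ : TangentSpace (𝓡 C.dim) x, C.conn x ξ = A ∧ mfderiv (𝓡 C.dim) (𝓡 m) C.proj x ξ = 0 := by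
  -- The factor 1/2 compensates for the derivative 2 of (1 + X)(1 - X)⁻¹ at X = 0.
  set L : ℝ → Matrix N N ℝ := fun t => t • ((1 / 2 : ℝ) • A) with hL
  have hLs : ∀ t, MSmoothAt 𝓘(ℝ, ℝ) L t := by
    intro t
    rw [mSmoothAt_iff]
    intro i j
    simp only [hL, Matrix.smul_apply, smul_eq_mul]
    exact (contDiff_id.mul contDiff_const).contMDiff.contMDiffAt
  have hLm : ∀ t, L t ∈ 𝔭 := fun t => 𝔭.smul_mem _ (𝔭.smul_mem _ hA)
  have hL1 : ∀ t, MSmoothAt 𝓘(ℝ, ℝ) (fun t => 1 - L t) t := fun t =>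
    (MSmoothAt.const 1 t).sub (hLs t)
  have hL0 : L 0 = 0 := by simp [hL]
  have hu : IsUnit (1 - L 0).det := by rw [hL0]; simp
  set q : ℝ → P := fun t => invCayley P (L t) with hq
  have hqs : ∀ᶠ t in 𝓝 (0 : ℝ), GSmoothAt 𝓘(ℝ, ℝ) q t := by
    filter_upwards [(hL1 0).eventually_isUnit_det hu] with t ht
    exact hP.invCayley_smooth (hLs t) (Filter.Eventually.of_forall hLm) ht
  have hqv : ∀ᶠ t in 𝓝 (0 : ℝ), (q t).1.val * (1 - L t) = 1 + L t := by
    filter_upwards [(hL1 0).eventually_isUnit_det hu] with t ht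
    rw [hq, hP.invCayley_val (hLm t) ht, Matrix.mul_assoc, Matrix.nonsing_inv_mul _ ht,
      Matrix.mul_one]
  have hq0 : q 0 = 1 := by
    have := hqv.self_of_nhds
    rw [hL0, sub_zero, add_zero, Matrix.mul_one] at this
    exact Subtype.ext (Units.ext this)
  have hLd : mderiv 𝓘(ℝ, ℝ) L 0 (unitVec 0) = (1 / 2 : ℝ) • A := by
    refine vderiv_unitVec (f := fun t => entries (L t)) (f' := entries ((1 / 2 : ℝ) • A)) ?_
    have := (hasDerivAt_id (0 : ℝ)).smul_const (entries ((1 / 2 : ℝ) • A))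
    rw [one_smul] at this
    exact this
  have hqd : gderiv 𝓘(ℝ, ℝ) q 0 (unitVec 0) = A := by
    have h1 := mderiv_congr (I := 𝓘(ℝ, ℝ)) hqv (unitVec 0)
    rw [mderiv_mul (I := 𝓘(ℝ, ℝ)) (A := fun t => (q t).1.val) (B := fun t => 1 - L t)
      hqs.self_of_nhds (hL1 0), mderiv_add (MSmoothAt.const 1 0) (hLs 0),
      mderiv_sub (MSmoothAt.const 1 0) (hLs 0), hLd, hq0, mderiv_const, hL0, sub_zero,
      Matrix.mul_one, zero_add, zero_sub] at h1
    have h5 := eq_sub_of_add_eq h1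
    refine h5.trans ?_
    simp only [Subgroup.coe_one, Units.val_one, Matrix.one_mul, sub_neg_eq_add, ← add_smul]
    norm_num
  have hpull := C.conn_act_const hqs x (unitVec 0)
  rw [hqd, hq0] at hpull
  simp only [inv_one, Subgroup.coe_one, Units.val_one, Matrix.one_mul] at hpull
  have hd : MDifferentiableAt 𝓘(ℝ, ℝ) (𝓡 C.dim) (fun e => C.act x (q e)) 0 :=
    (C.act_smoothAt_vector (c := fun e : ℝ => e) hqs.self_of_nhds contMDiffAt_const
      contMDiffAt_id).mdifferentiableAt (by simp)
  have hx0 : C.act x (q 0) = x := by rw [hq0, C.act_one]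
  have hproj : mfderiv (𝓡 C.dim) (𝓡 m) C.proj (C.act x (q 0))
      (mfderiv 𝓘(ℝ, ℝ) (𝓡 C.dim) (fun e => C.act x (q e)) 0 (unitVec 0)) = 0 := by
    have h1 := mfderiv_comp_apply (I := 𝓘(ℝ, ℝ)) (I' := 𝓡 C.dim) (I'' := 𝓡 m) (0 : ℝ)
      (g := C.proj) (f := fun e => C.act x (q e))
      ((C.proj_smooth _).mdifferentiableAt (by simp)) hd (unitVec 0)
    rw [← h1]
    have h2 : C.proj ∘ (fun e => C.act x (q e)) = fun _ : ℝ => C.proj x := by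
      funext e; exact C.proj_act x _
    rw [h2, mfderiv_const]
    rfl
  have key : ∀ p : C.Total, p = x → ∀ w : EuclideanSpace ℝ (Fin C.dim), C.conn p w = A →
      mfderiv (𝓡 C.dim) (𝓡 m) C.proj p w = 0 →
      ∃ ξ : TangentSpace (𝓡 C.dim) x, C.conn x ξ = A ∧
        mfderiv (𝓡 C.dim) (𝓡 m) C.proj x ξ = 0 := by
    rintro p rfl w h1 h2; exact ⟨w, h1, h2⟩
  exact key _ hx0 _ hpull hproj

variable {C}

lemma IsSection.mfderiv_proj {U : Set M} {s : M → C.Total} (hs : C.IsSection U s) {b : M}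
    (hb : b ∈ U) (ξ : TangentSpace (𝓡 m) b) :
    mfderiv (𝓡 C.dim) (𝓡 m) C.proj (s b) (mfderiv (𝓡 m) (𝓡 C.dim) s b ξ) =
      (ξ : EuclideanSpace ℝ (Fin m)) := by
  have h1 := mfderiv_comp_apply (I := 𝓡 m) (I' := 𝓡 C.dim) (I'' := 𝓡 m) b
      (g := C.proj) (f := s) ((C.proj_smooth _).mdifferentiableAt (by simp))
      ((hs.smooth b hb).mdifferentiableAt (by simp)) ξ
  have h2 : (C.proj ∘ s) =ᶠ[𝓝 b] id := by
    filter_upwards [hs.isOpen.mem_nhds hb] with y hy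
    exact hs.proj_eq y hy
  have h3 := h2.mfderiv_eq (I := 𝓡 m) (I' := 𝓡 m)
  rw [mfderiv_id] at h3
  have h4 := congrArg (fun L : EuclideanSpace ℝ (Fin m) →L[ℝ] EuclideanSpace ℝ (Fin m) => L ξ) h3
  exact h1.symm.trans h4

/-- At a point of the section the fibre coordinate is 1, so the two terms of `conn_eq` are the gauge
form of the projected vector and a logarithmic derivative, which lies in `𝔭`. -/
lemma IsSection.conn_sub_mem (hP : IsCayleyPair P 𝔭) {U : Set M} {s : M → C.Total}
    (hs : C.IsSection U s) {x : C.Total} (hb : C.proj x ∈ U) (hx : s (C.proj x) = x)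
    (ξ : TangentSpace (𝓡 C.dim) x) :
    C.conn x ξ - C.pull (𝓡 m) s (C.proj x) (mfderiv (𝓡 C.dim) (𝓡 m) C.proj x ξ) ∈ 𝔭 := by
  have h1 := hs.conn_eq hb ξ
  have h2 : C.coord s x = 1 := hs.coord_eq hb (by rw [C.act_one, hx])
  have h3 := hP.log_deriv_mem (hs.coord_smooth hb) ξ
  rw [h1]
  rw [h2] at h3 ⊢
  simpa using h3

lemma pull_mem {s : M → C.Total} (b : M) (ξ : TangentSpace (𝓡 m) b) :
    C.pull (𝓡 m) s b ξ ∈ 𝔤 := by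
  have : C.pull (𝓡 m) s b ξ ∈ Set.range (C.conn (s b)) := ⟨_, rfl⟩
  rwa [C.conn_range] at this

/-- A value in `𝔭` is also attained on a vertical vector. By injectivity of the connection the
derivative of the section along `ξ` is this vertical vector, while it projects to `ξ`. -/
lemma IsSection.eq_zero_of_pull_mem (hP : IsCayleyPair P 𝔭) {U : Set M} {s : M → C.Total}
    (hs : C.IsSection U s) {b : M} (hb : b ∈ U) {ξ : TangentSpace (𝓡 m) b}
    (h : C.pull (𝓡 m) s b ξ ∈ 𝔭) : ξ = 0 := by
  obtain ⟨η, h1, h2⟩ := C.exists_vertical hP (s b) h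
  have h3 : η = mfderiv (𝓡 m) (𝓡 C.dim) s b ξ := C.conn_injective _ h1
  rw [h3] at h2
  exact (hs.mfderiv_proj hb ξ).symm.trans h2

/-- Project to the base a vector on which the connection has the value `A`. Together with
`eq_zero_of_pull_mem` this identifies the tangent space of the base with 𝔤/𝔭. -/
lemma IsSection.exists_pull_sub_mem (hP : IsCayleyPair P 𝔭) {U : Set M} {s : M → C.Total}
    (hs : C.IsSection U s) {b : M} (hb : b ∈ U) {A : Matrix N N ℝ} (hA : A ∈ 𝔤) :
    ∃ ξ : TangentSpace (𝓡 m) b, C.pull (𝓡 m) s b ξ - A ∈ 𝔭 := by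
  have hA' : A ∈ Set.range (C.conn (s b)) := by rw [C.conn_range]; exact hA
  obtain ⟨η, hη⟩ := hA'
  have hb' := hs.proj_eq b hb
  have h := hs.conn_sub_mem hP (x := s b) (by rwa [hb']) (by rw [hb']) η
  rw [hη] at h
  have key : ∀ c : M, c = b → ∀ w : EuclideanSpace ℝ (Fin m), A - C.pull (𝓡 m) s c w ∈ 𝔭 →
      ∃ ξ : TangentSpace (𝓡 m) b, C.pull (𝓡 m) s b ξ - A ∈ 𝔭 := by
    rintro c rfl w hw
    exact ⟨w, by simpa using 𝔭.neg_mem hw⟩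
  exact key _ hb' _ h

lemma IsSection.pull_smooth [IsManifold (𝓡 m) ∞ M] {U : Set M} {s : M → C.Total}
    (hs : C.IsSection U s) :
    ∀ ξ : TangentBundle (𝓡 m) M, ξ.1 ∈ U → ContMDiffAt (𝓡 m).tangent 𝓘(ℝ, N → N → ℝ) ∞
      (fun ξ : TangentBundle (𝓡 m) M => entries (C.pull (𝓡 m) s ξ.1 ξ.2)) ξ := by
  intro ξ hξ
  have h1 : ContMDiffOn (𝓡 m) (𝓡 C.dim) ∞ s U := fun y hy => (hs.smooth y hy).contMDiffWithinAt
  have : IsManifold (𝓡 m) 1 M := IsManifold.of_le (n := ∞) (by simp)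
  have : IsManifold (𝓡 C.dim) 1 C.Total := IsManifold.of_le (n := ∞) (by simp)
  have h2 := h1.contMDiffOn_tangentMapWithin (m := ∞) (by simp) hs.isOpen.uniqueMDiffOn
  have hopen : IsOpen (Bundle.TotalSpace.proj ⁻¹' U : Set (TangentBundle (𝓡 m) M)) :=
    hs.isOpen.preimage (FiberBundle.continuous_proj _ _)
  have h3 := C.conn_smooth.contMDiffAt.comp ξ (h2.contMDiffAt (hopen.mem_nhds hξ))
  refine h3.congr_of_eventuallyEq ?_
  filter_upwards [hopen.mem_nhds hξ] with η hη
  simp only [Function.comp_apply]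
  rw [tangentMapWithin_eq_tangentMap (hs.isOpen.uniqueMDiffOn _ hη)
    ((hs.smooth _ hη).mdifferentiableAt (by simp))]
  rfl

end CartanGeometry

end Pair

end CartanCalculus

/-! ## Cartan geometries from gauge data -/

section Gauge

variable {N : Type} [Fintype N] [DecidableEq N]

/-- The Cayley transform. -/
def cay (A : Matrix N N ℝ) : Matrix N N ℝ := (A - 1) * (A + 1)⁻¹

lemma isUnit_det_of_mul_eq_smul_one {A B : Matrix N N ℝ} {r : ℝ} (hr : r ≠ 0)
    (h : A * B = r • 1) : IsUnit A.det := by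
  have h1 := congrArg Matrix.det h
  rw [Matrix.det_mul, Matrix.det_smul, Matrix.det_one, mul_one] at h1
  exact isUnit_of_mul_isUnit_left (h1 ▸ (isUnit_iff_ne_zero.2 (pow_ne_zero _ hr)))

lemma one_sub_cay {A : Matrix N N ℝ} (h : IsUnit (A + 1).det) :
    1 - cay A = (2 : ℝ) • (A + 1)⁻¹ := by
  have h1 : (A + 1) * (A + 1)⁻¹ = 1 := Matrix.mul_nonsing_inv _ h
  unfold cay
  calc 1 - (A - 1) * (A + 1)⁻¹ = (A + 1) * (A + 1)⁻¹ - (A - 1) * (A + 1)⁻¹ := by rw [h1]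
    _ = _ := by rw [← Matrix.sub_mul, show A + 1 - (A - 1) = (2 : ℝ) • 1 by rw [two_smul]; abel,
      Matrix.smul_mul, Matrix.one_mul]

lemma one_add_cay {A : Matrix N N ℝ} (h : IsUnit (A + 1).det) :
    1 + cay A = (2 : ℝ) • (A * (A + 1)⁻¹) := by
  have h1 : (A + 1) * (A + 1)⁻¹ = 1 := Matrix.mul_nonsing_inv _ h
  unfold cay
  calc 1 + (A - 1) * (A + 1)⁻¹ = (A + 1) * (A + 1)⁻¹ + (A - 1) * (A + 1)⁻¹ := by rw [h1]
    _ = _ := by rw [← Matrix.add_mul, show A + 1 + (A - 1) = (2 : ℝ) • A by rw [two_smul]; abel,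
      Matrix.smul_mul]

lemma isUnit_one_sub_cay {A : Matrix N N ℝ} (h : IsUnit (A + 1).det) :
    IsUnit (1 - cay A).det := by
  rw [one_sub_cay h]
  refine isUnit_det_of_mul_eq_smul_one (B := A + 1) (r := 2) two_ne_zero ?_
  rw [Matrix.smul_mul, Matrix.nonsing_inv_mul _ h]

lemma inv_cay_cay {A : Matrix N N ℝ} (h : IsUnit (A + 1).det) :
    (1 + cay A) * (1 - cay A)⁻¹ = A := by
  have h1 : (1 - cay A)⁻¹ = (1 / 2 : ℝ) • (A + 1) := by
    refine Matrix.inv_eq_left_inv ?_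
    rw [one_sub_cay h, Matrix.smul_mul, Matrix.mul_smul, Matrix.mul_nonsing_inv _ h, smul_smul]
    norm_num
  rw [h1, one_add_cay h, Matrix.smul_mul, Matrix.mul_smul, Matrix.mul_assoc,
    Matrix.nonsing_inv_mul _ h, smul_smul, Matrix.mul_one]
  norm_num

lemma inv_cay_add_one {X : Matrix N N ℝ} (h : IsUnit (1 - X).det) :
    (1 + X) * (1 - X)⁻¹ + 1 = (2 : ℝ) • (1 - X)⁻¹ := by
  have h1 : (1 - X) * (1 - X)⁻¹ = 1 := Matrix.mul_nonsing_inv _ h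
  calc (1 + X) * (1 - X)⁻¹ + 1 = (1 + X) * (1 - X)⁻¹ + (1 - X) * (1 - X)⁻¹ := by rw [h1]
    _ = _ := by rw [← Matrix.add_mul, show 1 + X + (1 - X) = (2 : ℝ) • 1 by rw [two_smul]; abel,
      Matrix.smul_mul, Matrix.one_mul]

lemma isUnit_inv_cay_add_one {X : Matrix N N ℝ} (h : IsUnit (1 - X).det) :
    IsUnit ((1 + X) * (1 - X)⁻¹ + 1).det := by
  rw [inv_cay_add_one h]
  refine isUnit_det_of_mul_eq_smul_one (B := 1 - X) (r := 2) two_ne_zero ?_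
  rw [Matrix.smul_mul, Matrix.nonsing_inv_mul _ h]

lemma cay_inv_cay {X : Matrix N N ℝ} (h : IsUnit (1 - X).det) :
    cay ((1 + X) * (1 - X)⁻¹) = X := by
  have h1 : (1 - X) * (1 - X)⁻¹ = 1 := Matrix.mul_nonsing_inv _ h
  have h2 : ((1 + X) * (1 - X)⁻¹ + 1)⁻¹ = (1 / 2 : ℝ) • (1 - X) := by
    refine Matrix.inv_eq_left_inv ?_
    rw [inv_cay_add_one h, Matrix.smul_mul, Matrix.mul_smul, h1, smul_smul]
    norm_num
  have h3 : (1 + X) * (1 - X)⁻¹ - 1 = (2 : ℝ) • (X * (1 - X)⁻¹) := by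
    calc (1 + X) * (1 - X)⁻¹ - 1 = (1 + X) * (1 - X)⁻¹ - (1 - X) * (1 - X)⁻¹ := by rw [h1]
      _ = _ := by rw [← Matrix.sub_mul, show 1 + X - (1 - X) = (2 : ℝ) • X by rw [two_smul]; abel,
        Matrix.smul_mul]
  unfold cay
  rw [h2, h3, Matrix.smul_mul, Matrix.mul_smul, Matrix.mul_assoc, Matrix.nonsing_inv_mul _ h,
    smul_smul, Matrix.mul_one]
  norm_num

/-- A closed matrix group `P` with Lie algebra `𝔭` acting on a space `𝔤 ⊇ 𝔭` of matrices. -/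
structure IsParabolicPair (𝔤 𝔭 : Submodule ℝ (Matrix N N ℝ)) (P : Subgroup (Matrix N N ℝ)ˣ) : Prop
    extends IsCayleyPair P 𝔭 where
  le : 𝔭 ≤ 𝔤
  conj_mem : ∀ g ∈ P, ∀ A ∈ 𝔤, (g⁻¹).val * A * g.val ∈ 𝔤

/-! ### Gauge data and the manifold structure of their total space -/

/-- A principal `P`-bundle without topology, with sections over open sets of `M` that are related by
smooth transition functions, and the gauge forms of a Cartan connection. -/
structure GaugeData (𝔤 𝔭 : Submodule ℝ (Matrix N N ℝ)) (P : Subgroup (Matrix N N ℝ)ˣ) {m : ℕ}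
    (M : Type u) [TopologicalSpace M] [ChartedSpace (EuclideanSpace ℝ (Fin m)) M]
    [IsManifold (𝓡 m) ∞ M] where
  pair : IsParabolicPair 𝔤 𝔭 P
  T : Type v
  proj : T → M
  act : T → P → T
  act_one : ∀ x, act x 1 = x
  act_mul : ∀ x g h, act x (g * h) = act (act x g) h
  act_free : ∀ x g, act x g = x → g = 1
  proj_act : ∀ x g, proj (act x g) = proj x
  act_trans : ∀ x y, proj x = proj y → ∃ g, act x g = y
  U : M → Set M
  isOpen : ∀ b, IsOpen (U b)
  mem : ∀ b, b ∈ U b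
  sec : M → M → T
  proj_sec : ∀ b, ∀ y ∈ U b, proj (sec b y) = y
  trans : M → M → M → P
  sec_eq : ∀ a b, ∀ y ∈ U a, y ∈ U b → act (sec a y) (trans a b y) = sec b y
  trans_smooth : ∀ a b, ∀ y ∈ U a, y ∈ U b → GSmoothAt (𝓡 m) (trans a b) y
  form : M → ∀ y : M, TangentSpace (𝓡 m) y →ₗ[ℝ] Matrix N N ℝ
  form_smooth : ∀ b, ∀ ξ : TangentBundle (𝓡 m) M, ξ.1 ∈ U b →
    ContMDiffAt (𝓡 m).tangent 𝓘(ℝ, N → N → ℝ) ∞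
      (fun ξ : TangentBundle (𝓡 m) M => entries (form b ξ.1 ξ.2)) ξ
  form_mem : ∀ b, ∀ y ∈ U b, ∀ ξ, form b y ξ ∈ 𝔤
  form_trans : ∀ a b, ∀ y ∈ U a, y ∈ U b → ∀ ξ, form b y ξ =
    ((trans a b y)⁻¹).1.val * form a y ξ * (trans a b y).1.val +
      ((trans a b y)⁻¹).1.val * gderiv (𝓡 m) (trans a b) y ξ
  -- This and the next condition say that the gauge form induces an isomorphism of the tangent space
  -- with 𝔤/𝔭.
  form_injective : ∀ b, ∀ y ∈ U b, ∀ ξ, form b y ξ ∈ 𝔭 → ξ = 0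
  form_surjective : ∀ b, ∀ y ∈ U b, ∀ A ∈ 𝔤, ∃ ξ, form b y ξ - A ∈ 𝔭

namespace GaugeData

variable {𝔤 𝔭 : Submodule ℝ (Matrix N N ℝ)} {P : Subgroup (Matrix N N ℝ)ˣ} {m : ℕ}
  {M : Type u} [TopologicalSpace M] [ChartedSpace (EuclideanSpace ℝ (Fin m)) M]
  [IsManifold (𝓡 m) ∞ M] (D : GaugeData.{u, v} 𝔤 𝔭 P (m := m) M)
  {E : Type*} [NormedAddCommGroup E] [NormedSpace ℝ E] {H : Type*} [TopologicalSpace H]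
  {I : ModelWithCorners ℝ E H} {Y : Type*} [TopologicalSpace Y] [ChartedSpace H Y]

open Classical in
/-- The coordinate in the fibre with respect to the section `D.sec b`. -/
def coord (b : M) (x : D.T) : P :=
  if h : ∃ g, D.act (D.sec b (D.proj x)) g = x then h.choose else 1

lemma act_coord {b : M} {x : D.T} (hx : D.proj x ∈ D.U b) :
    D.act (D.sec b (D.proj x)) (D.coord b x) = x := by
  have h : ∃ g, D.act (D.sec b (D.proj x)) g = x := D.act_trans _ _ (D.proj_sec b _ hx)
  unfold coord
  rw [dif_pos h]
  exact h.choose_spec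

lemma act_cancel {x : D.T} {g h : P} (hgh : D.act x g = D.act x h) : g = h := by
  have h1 : D.act x (g * h⁻¹) = x := by
    rw [D.act_mul, hgh, ← D.act_mul, mul_inv_cancel, D.act_one]
  exact mul_inv_eq_one.1 (D.act_free x _ h1)

lemma coord_eq {b : M} {x : D.T} (hx : D.proj x ∈ D.U b) {g : P}
    (hg : D.act (D.sec b (D.proj x)) g = x) : D.coord b x = g :=
  D.act_cancel ((D.act_coord hx).trans hg.symm)

lemma coord_act {b : M} {x : D.T} (hx : D.proj x ∈ D.U b) (g : P) :
    D.coord b (D.act x g) = D.coord b x * g := by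
  refine D.coord_eq (by rwa [D.proj_act]) ?_
  rw [D.proj_act, D.act_mul, D.act_coord hx]

lemma coord_sec {b y : M} (hy : y ∈ D.U b) : D.coord b (D.sec b y) = 1 := by
  refine D.coord_eq (by rwa [D.proj_sec b y hy]) ?_
  rw [D.proj_sec b y hy, D.act_one]

lemma coord_trans {a b : M} {x : D.T} (ha : D.proj x ∈ D.U a) (hb : D.proj x ∈ D.U b) :
    D.coord a x = D.trans a b (D.proj x) * D.coord b x := by
  refine D.coord_eq ha ?_
  rw [D.act_mul, D.sec_eq a b _ ha hb, D.act_coord hb]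

/-- A map to the total space is smooth when its base and fibre coordinates are smooth. -/
def SmoothAt (I : ModelWithCorners ℝ E H) (f : Y → D.T) (x : Y) : Prop :=
  ContMDiffAt I (𝓡 m) ∞ (fun y => D.proj (f y)) x ∧
    GSmoothAt I (fun y => D.coord (D.proj (f x)) (f y)) x

variable {D}

/-- The definition of `SmoothAt` uses the section attached to the image point; smooth transition
functions make it independent of that choice. The converse is `smoothAt_of_coord`. -/
lemma SmoothAt.coord {f : Y → D.T} {x : Y} (hf : D.SmoothAt I f x) {b : M}
    (hb : D.proj (f x) ∈ D.U b) : GSmoothAt I (fun y => D.coord b (f y)) x := by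
  have h1 : GSmoothAt I (fun y => D.trans b (D.proj (f x)) (D.proj (f y)) *
      D.coord (D.proj (f x)) (f y)) x := by
    refine GSmoothAt.mul ?_ hf.2
    exact GSmoothAt.comp (I' := 𝓡 m) (g := fun y => D.proj (f y))
      (D.trans_smooth b _ _ hb (D.mem _)) hf.1
  refine h1.congr ?_
  have hc := hf.1.continuousAt
  filter_upwards [hc ((D.isOpen b).mem_nhds hb), hc ((D.isOpen _).mem_nhds (D.mem _))] with y h2 h3
  exact D.coord_trans h2 h3

lemma smoothAt_of_coord {f : Y → D.T} {x : Y} {b : M} (hb : D.proj (f x) ∈ D.U b)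
    (h1 : ContMDiffAt I (𝓡 m) ∞ (fun y => D.proj (f y)) x)
    (h2 : GSmoothAt I (fun y => D.coord b (f y)) x) : D.SmoothAt I f x := by
  refine ⟨h1, ?_⟩
  have h3 : GSmoothAt I (fun y => D.trans (D.proj (f x)) b (D.proj (f y)) *
      D.coord b (f y)) x := by
    refine GSmoothAt.mul ?_ h2
    exact GSmoothAt.comp (I' := 𝓡 m) (g := fun y => D.proj (f y))
      (D.trans_smooth _ b _ (D.mem _) hb) h1
  refine h3.congr ?_
  have hc := h1.continuousAt
  filter_upwards [hc ((D.isOpen b).mem_nhds hb), hc ((D.isOpen _).mem_nhds (D.mem _))] with y h2 h3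
  exact D.coord_trans h3 h2

lemma SmoothAt.congr {f g : Y → D.T} {x : Y} (hf : D.SmoothAt I f x) (h : g =ᶠ[𝓝 x] f) :
    D.SmoothAt I g x := by
  refine ⟨hf.1.congr_of_eventuallyEq (h.mono fun y hy => by simp only [hy]), ?_⟩
  rw [h.self_of_nhds]
  exact hf.2.congr (h.mono fun y hy => by simp only [hy])

variable (D)

/-- The dimension of the total space. -/
def dim (_ : GaugeData.{u, v} 𝔤 𝔭 P (m := m) M) : ℕ := m + Module.finrank ℝ 𝔭

/-- Splitting of the model space of the total space. -/
def split : EuclideanSpace ℝ (Fin D.dim) ≃L[ℝ]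
    EuclideanSpace ℝ (Fin m) × EuclideanSpace ℝ (Fin (Module.finrank ℝ 𝔭)) :=
  ContinuousLinearEquiv.ofFinrankEq (by
    rw [finrank_euclideanSpace_fin, Module.finrank_prod, finrank_euclideanSpace_fin,
      finrank_euclideanSpace_fin, dim])

/-- Linear coordinates of `𝔭`. -/
def basisEquiv (_ : GaugeData.{u, v} 𝔤 𝔭 P (m := m) M) :
    𝔭 ≃ₗ[ℝ] EuclideanSpace ℝ (Fin (Module.finrank ℝ 𝔭)) :=
  LinearEquiv.ofFinrankEq _ _ (by simp)

/-- The inclusion of `𝔭`, in coordinates. -/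
def toMat : EuclideanSpace ℝ (Fin (Module.finrank ℝ 𝔭)) →ₗ[ℝ] Matrix N N ℝ :=
  𝔭.subtype ∘ₗ D.basisEquiv.symm.toLinearMap

/-- A projection to `𝔭`, in coordinates. -/
def ofMat : Matrix N N ℝ →ₗ[ℝ] EuclideanSpace ℝ (Fin (Module.finrank ℝ 𝔭)) :=
  D.basisEquiv.toLinearMap ∘ₗ Submodule.projectionOnto _ _ (Submodule.exists_isCompl 𝔭).choose_spec

lemma toMat_mem (e) : D.toMat e ∈ 𝔭 := (D.basisEquiv.symm e).2

lemma toMat_ofMat {A : Matrix N N ℝ} (hA : A ∈ 𝔭) : D.toMat (D.ofMat A) = A := by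
  have := Submodule.projectionOnto_apply_left (Submodule.exists_isCompl 𝔭).choose_spec ⟨A, hA⟩
  simp only [toMat, ofMat, LinearMap.comp_apply, LinearEquiv.coe_coe, LinearEquiv.symm_apply_apply,
    Submodule.subtype_apply]
  exact congrArg Subtype.val this

lemma ofMat_toMat (e) : D.ofMat (D.toMat e) = e := by
  have := Submodule.projectionOnto_apply_left (Submodule.exists_isCompl 𝔭).choose_spec (D.basisEquiv.symm e)
  simp only [toMat, ofMat, LinearMap.comp_apply, LinearEquiv.coe_coe, Submodule.subtype_apply]
  rw [this, LinearEquiv.apply_symm_apply]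

lemma toMat_smooth {f : Y → EuclideanSpace ℝ (Fin (Module.finrank ℝ 𝔭))} {x : Y}
    (hf : ContMDiffAt I 𝓘(ℝ, EuclideanSpace ℝ (Fin (Module.finrank ℝ 𝔭))) ∞ f x) :
    MSmoothAt I (fun y => D.toMat (f y)) x :=
  (LinearMap.toContinuousLinearMap
    ((entriesL N).toLinearMap ∘ₗ D.toMat)).contMDiff.contMDiffAt.comp x hf

lemma cay_smooth {A : Y → Matrix N N ℝ} {x : Y} (hA : MSmoothAt I A x)
    (h : IsUnit (A x + 1).det) : MSmoothAt I (fun y => cay (A y)) x :=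
  (hA.sub (MSmoothAt.const 1 x)).mul ((hA.add (MSmoothAt.const 1 x)).inv h)

/-- The coordinate in the fibre that takes the value `1` at `x₀`. -/
def fib (x₀ x : D.T) : P := (D.coord (D.proj x₀) x₀)⁻¹ * D.coord (D.proj x₀) x

/-- The charts of the total space. -/
def chart (x₀ : D.T) : PartialEquiv D.T (EuclideanSpace ℝ (Fin D.dim)) where
  -- The fibre coordinate is normalized to be 1 at `x₀`, so that the Cayley transform is defined
  -- there: 1 + 1 is invertible.
  toFun x := D.split.symm (extChartAt (𝓡 m) (D.proj x₀) (D.proj x),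
    D.ofMat (cay (D.fib x₀ x).1.val))
  invFun e := D.act (D.sec (D.proj x₀) ((extChartAt (𝓡 m) (D.proj x₀)).symm (D.split e).1))
    (D.coord (D.proj x₀) x₀ * invCayley P (D.toMat (D.split e).2))
  source := {x | D.proj x ∈ D.U (D.proj x₀) ∧ D.proj x ∈ (extChartAt (𝓡 m) (D.proj x₀)).source ∧
    IsUnit ((D.fib x₀ x).1.val + 1).det}
  target := {e | (D.split e).1 ∈ (extChartAt (𝓡 m) (D.proj x₀)).target ∧
    (extChartAt (𝓡 m) (D.proj x₀)).symm (D.split e).1 ∈ D.U (D.proj x₀) ∧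
    IsUnit (1 - D.toMat (D.split e).2).det}
  map_source' := by
    rintro x ⟨h1, h2, h3⟩
    have h4 : cay (D.fib x₀ x).1.val ∈ 𝔭 := D.pair.cayley_mem _ (D.fib x₀ x).2 h3
    simp only [Set.mem_ofPred_eq, ContinuousLinearEquiv.apply_symm_apply]
    refine ⟨(extChartAt (𝓡 m) _).map_source h2, ?_, ?_⟩
    · rwa [(extChartAt (𝓡 m) _).left_inv h2]
    · rw [D.toMat_ofMat h4]; exact isUnit_one_sub_cay h3
  map_target' := by
    rintro e ⟨h1, h2, h3⟩
    have h5 : D.proj (D.sec (D.proj x₀) ((extChartAt (𝓡 m) (D.proj x₀)).symm (D.split e).1)) =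
      (extChartAt (𝓡 m) (D.proj x₀)).symm (D.split e).1 := D.proj_sec _ _ h2
    simp only [Set.mem_ofPred_eq, D.proj_act, h5]
    refine ⟨h2, (extChartAt (𝓡 m) _).map_target h1, ?_⟩
    rw [fib, D.coord_act (by rwa [h5]), D.coord_sec h2, one_mul, inv_mul_cancel_left,
      D.pair.invCayley_val (D.toMat_mem _) h3]
    exact isUnit_inv_cay_add_one h3
  left_inv' := by
    rintro x ⟨h1, h2, h3⟩
    have h4 : cay (D.fib x₀ x).1.val ∈ 𝔭 := D.pair.cayley_mem _ (D.fib x₀ x).2 h3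
    simp only [ContinuousLinearEquiv.apply_symm_apply]
    rw [(extChartAt (𝓡 m) _).left_inv h2, D.toMat_ofMat h4]
    have h6 : invCayley P (cay (D.fib x₀ x).1.val) = D.fib x₀ x := by
      refine Subtype.ext (Units.ext ?_)
      rw [D.pair.invCayley_val h4 (isUnit_one_sub_cay h3), inv_cay_cay h3]
    rw [h6, fib, mul_inv_cancel_left, D.act_coord h1]
  right_inv' := by
    rintro e ⟨h1, h2, h3⟩
    have h5 : D.proj (D.sec (D.proj x₀) ((extChartAt (𝓡 m) (D.proj x₀)).symm (D.split e).1)) =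
      (extChartAt (𝓡 m) (D.proj x₀)).symm (D.split e).1 := D.proj_sec _ _ h2
    simp only [D.proj_act, h5]
    rw [fib, D.coord_act (by rwa [h5]), D.coord_sec h2, one_mul, inv_mul_cancel_left,
      D.pair.invCayley_val (D.toMat_mem _) h3, cay_inv_cay h3, D.ofMat_toMat,
      (extChartAt (𝓡 m) _).right_inv h1]
    exact D.split.symm_apply_apply e

lemma isUnit_one_add_one : IsUnit ((1 : P).1.val + 1).det := isUnit_two_det

lemma fib_self (x : D.T) : D.fib x x = 1 := inv_mul_cancel _

lemma mem_chart_source (x : D.T) : x ∈ (D.chart x).source := by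
  refine ⟨D.mem _, mem_extChartAt_source _, ?_⟩
  rw [D.fib_self]; exact isUnit_one_add_one

variable {D}

lemma SmoothAt.fib {f : Y → D.T} {x : Y} (hf : D.SmoothAt I f x) {x₀ : D.T}
    (hx : D.proj (f x) ∈ D.U (D.proj x₀)) : GSmoothAt I (fun y => D.fib x₀ (f y)) x :=
  (GSmoothAt.const _ x).mul (hf.coord hx)

lemma SmoothAt.eventually_mem {f : Y → D.T} {x : Y} (hf : D.SmoothAt I f x) {x₀ : D.T}
    (hx : f x ∈ (D.chart x₀).source) : ∀ᶠ y in 𝓝 x, f y ∈ (D.chart x₀).source := by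
  obtain ⟨h1, h2, h3⟩ := hx
  have hc := hf.1.continuousAt
  filter_upwards [hc ((D.isOpen _).mem_nhds h1), hc ((isOpen_extChartAt_source _).mem_nhds h2),
    MSmoothAt.eventually_isUnit_det (MSmoothAt.add (hf.fib h1) (MSmoothAt.const 1 x)) h3]
    with y h4 h5 h6
  exact ⟨h4, h5, h6⟩

/-- Applied to the inverse of another chart, which satisfies `SmoothAt` by `chart_symm_smoothAt`,
this yields smooth transition maps. -/
lemma SmoothAt.chart {f : Y → D.T} {x : Y} (hf : D.SmoothAt I f x) {x₀ : D.T}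
    (hx : f x ∈ (D.chart x₀).source) :
    ContMDiffAt I 𝓘(ℝ, EuclideanSpace ℝ (Fin D.dim)) ∞ (fun y => D.chart x₀ (f y)) x := by
  obtain ⟨h1, h2, h3⟩ := hx
  refine D.split.symm.contDiff.contMDiff.contMDiffAt.comp x ?_
  refine ContMDiffAt.prodMk_space ?_ ?_
  · refine ContMDiffAt.comp x (I' := 𝓡 m) ?_ hf.1
    exact contMDiffAt_extChartAt' (by rwa [← extChartAt_source (𝓡 m)])
  · exact (cay_smooth (hf.fib h1) h3).linear D.ofMat

variable (D)

lemma isOpen_chart_target (x₀ : D.T) : IsOpen (D.chart x₀).target := by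
  have h1 : IsOpen ((extChartAt (𝓡 m) (D.proj x₀)).target ∩
      (extChartAt (𝓡 m) (D.proj x₀)).symm ⁻¹' D.U (D.proj x₀)) :=
    (continuousOn_extChartAt_symm _).isOpen_inter_preimage (isOpen_extChartAt_target _) (D.isOpen _)
  have h2 : Continuous fun e : EuclideanSpace ℝ (Fin D.dim) =>
      (1 - D.toMat (D.split e).2).det := by
    refine continuous_iff_continuousAt.2 fun e => ?_
    refine ((MSmoothAt.const 1 e).sub (D.toMat_smooth (I := 𝓘(ℝ, EuclideanSpace ℝ (Fin D.dim)))
      ?_)).continuousAt_det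
    exact (contDiff_snd.comp D.split.contDiff).contMDiff.contMDiffAt
  have h3 : (D.chart x₀).target = (fun e => (D.split e).1) ⁻¹'
      ((extChartAt (𝓡 m) (D.proj x₀)).target ∩
      (extChartAt (𝓡 m) (D.proj x₀)).symm ⁻¹' D.U (D.proj x₀)) ∩
      {e | (1 - D.toMat (D.split e).2).det ≠ 0} := by
    ext e
    simp only [GaugeData.chart, Set.mem_ofPred_eq, Set.mem_inter_iff, Set.mem_preimage,
      isUnit_iff_ne_zero, and_assoc]
  rw [h3]
  exact (h1.preimage (continuous_fst.comp D.split.continuous)).inter (isOpen_ne.preimage h2)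

lemma chart_symm_smoothAt {x₀ : D.T} {e : EuclideanSpace ℝ (Fin D.dim)}
    (he : e ∈ (D.chart x₀).target) :
    D.SmoothAt 𝓘(ℝ, EuclideanSpace ℝ (Fin D.dim)) (D.chart x₀).symm e := by
  have hopen := D.isOpen_chart_target x₀
  have hp : ∀ e ∈ (D.chart x₀).target, D.proj ((D.chart x₀).symm e) =
      (extChartAt (𝓡 m) (D.proj x₀)).symm (D.split e).1 := fun e he => by
    change D.proj (D.act _ _) = _
    rw [D.proj_act, D.proj_sec _ _ he.2.1]
  have h1 : ContMDiffAt 𝓘(ℝ, EuclideanSpace ℝ (Fin D.dim)) 𝓘(ℝ, EuclideanSpace ℝ (Fin m)) ∞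
      (fun e => (D.split e).1) e :=
    (contDiff_fst.comp D.split.contDiff).contMDiff.contMDiffAt
  have h2 : ContMDiffAt 𝓘(ℝ, EuclideanSpace ℝ (Fin D.dim))
      𝓘(ℝ, EuclideanSpace ℝ (Fin (Module.finrank ℝ 𝔭))) ∞ (fun e => (D.split e).2) e :=
    (contDiff_snd.comp D.split.contDiff).contMDiff.contMDiffAt
  refine smoothAt_of_coord (b := D.proj x₀) (by rw [hp e he]; exact he.2.1) ?_ ?_
  · have h3 : ContMDiffAt 𝓘(ℝ, EuclideanSpace ℝ (Fin D.dim)) (𝓡 m) ∞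
        (fun e => (extChartAt (𝓡 m) (D.proj x₀)).symm (D.split e).1) e :=
      ContMDiffAt.comp e (I' := 𝓡 m) ((contMDiffOn_extChartAt_symm _).contMDiffAt
        ((isOpen_extChartAt_target _).mem_nhds he.1)) h1
    refine h3.congr_of_eventuallyEq ?_
    filter_upwards [hopen.mem_nhds he] with e' he'
    exact hp e' he'
  · have h4 : GSmoothAt 𝓘(ℝ, EuclideanSpace ℝ (Fin D.dim)) (fun e =>
        D.coord (D.proj x₀) x₀ * invCayley P (D.toMat (D.split e).2)) e :=
      (GSmoothAt.const _ e).mul (D.pair.invCayley_smooth (D.toMat_smooth h2)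
        (Filter.Eventually.of_forall fun e' => D.toMat_mem _) he.2.2)
    refine h4.congr ?_
    filter_upwards [hopen.mem_nhds he] with e' he'
    have h5 : D.proj (D.sec (D.proj x₀) ((extChartAt (𝓡 m) (D.proj x₀)).symm (D.split e').1)) =
      (extChartAt (𝓡 m) (D.proj x₀)).symm (D.split e').1 := D.proj_sec _ _ he'.2.1
    change D.coord _ (D.act _ _) = _
    rw [D.coord_act (by rw [h5]; exact he'.2.1), D.coord_sec he'.2.1, one_mul]

/-- The atlas of the total space. -/
def core : ChartedSpaceCore (EuclideanSpace ℝ (Fin D.dim)) D.T where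
  atlas := Set.range D.chart
  chartAt := D.chart
  mem_chart_source := D.mem_chart_source
  chart_mem_atlas x := ⟨x, rfl⟩
  open_source := by
    rintro _ _ ⟨x, rfl⟩ ⟨y, rfl⟩
    rw [isOpen_iff_mem_nhds]
    rintro e ⟨he, he'⟩
    filter_upwards [(D.chart_symm_smoothAt he).eventually_mem he',
      (D.isOpen_chart_target x).mem_nhds he] with e' h1 h2
    exact ⟨h2, h1⟩
  continuousOn_toFun := by
    rintro _ _ ⟨x, rfl⟩ ⟨y, rfl⟩
    rintro e ⟨he, he'⟩
    exact ((D.chart_symm_smoothAt he).chart he').continuousAt.continuousWithinAt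

/-- The total space, as a manifold. -/
def Total : Type v := D.T

instance : TopologicalSpace D.Total := D.core.toTopologicalSpace

instance : ChartedSpace (EuclideanSpace ℝ (Fin D.dim)) D.Total := D.core.toChartedSpace

instance : IsManifold (𝓡 D.dim) ∞ D.Total := by
  refine isManifold_of_contDiffOn (𝓡 D.dim) ∞ D.Total ?_
  intro e e' he he'
  obtain ⟨_, ⟨x, rfl⟩, he⟩ := Set.mem_iUnion₂.1 he
  obtain ⟨_, ⟨y, rfl⟩, he'⟩ := Set.mem_iUnion₂.1 he'
  obtain rfl := Set.mem_singleton_iff.1 he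
  obtain rfl := Set.mem_singleton_iff.1 he'
  rintro z ⟨⟨hz, hz'⟩, -⟩
  exact ((D.chart_symm_smoothAt hz).chart hz').contDiffAt.contDiffWithinAt

/-- One half of the agreement of `SmoothAt` with smoothness for the atlas: the projection and the
fibre coordinates are smooth on the manifold. -/
lemma smoothAt_id (x : D.Total) : D.SmoothAt (𝓡 D.dim) (fun y : D.Total => (y : D.T)) x := by
  have hx : D.chart x x ∈ (D.chart x).target := (D.chart x).map_source (D.mem_chart_source x)
  have h1 := D.chart_symm_smoothAt hx
  have h2 : ContMDiffAt (𝓡 D.dim) 𝓘(ℝ, EuclideanSpace ℝ (Fin D.dim)) ∞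
      (extChartAt (𝓡 D.dim) x) x := contMDiffAt_extChartAt
  have h3 : D.SmoothAt (𝓡 D.dim)
      (fun y : D.Total => (D.chart x).symm (extChartAt (𝓡 D.dim) x y)) x :=
    ⟨ContMDiffAt.comp (f := extChartAt (𝓡 D.dim) x) x h1.1 h2,
      GSmoothAt.comp (k := fun e => D.coord _ ((D.chart x).symm e)) h1.2 h2⟩
  refine h3.congr ?_
  filter_upwards [extChartAt_source_mem_nhds (I := 𝓡 D.dim) x] with y hy
  exact ((extChartAt (𝓡 D.dim) x).left_inv hy).symm

/-- The other half: a map into the total space is smooth once its base and fibre coordinates are. -/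
lemma contMDiffAt_of_smoothAt {f : Y → D.Total} {x : Y} (hf : D.SmoothAt I f x) :
    ContMDiffAt I (𝓡 D.dim) ∞ f x := by
  have hx := D.mem_chart_source (f x)
  have h1 := hf.chart hx
  rw [contMDiffAt_iff_target]
  refine ⟨?_, h1⟩
  have h2 : ContinuousAt (fun y => (extChartAt (𝓡 D.dim) (f x)).symm (D.chart (f x) (f y))) x := by
    refine ContinuousAt.comp (g := (extChartAt (𝓡 D.dim) (f x)).symm) ?_ h1.continuousAt
    exact continuousAt_extChartAt_symm (I := 𝓡 D.dim) (f x)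
  refine h2.congr ?_
  filter_upwards [hf.eventually_mem hx] with y hy
  exact (D.chart (f x)).left_inv hy

lemma proj_smooth : ContMDiff (𝓡 D.dim) (𝓡 m) ∞ (fun x : D.Total => D.proj x) :=
  fun x => (D.smoothAt_id x).1

lemma coord_smooth {b : M} {x : D.Total} (hb : D.proj x ∈ D.U b) :
    GSmoothAt (𝓡 D.dim) (fun y : D.Total => D.coord b y) x := (D.smoothAt_id x).coord hb

end GaugeData

end Gauge

/-! ### The Cartan connection determined by gauge data -/

section GaugeConnection

variable {N : Type} [Fintype N] [DecidableEq N]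
  {E : Type*} [NormedAddCommGroup E] [NormedSpace ℝ E] {H : Type*} [TopologicalSpace H]
  {I : ModelWithCorners ℝ E H} {Y : Type*} [TopologicalSpace Y] [ChartedSpace H Y]
  {F : Type*} [NormedAddCommGroup F] [NormedSpace ℝ F]

/-- The derivative, as a function on the tangent bundle, is the fibre component of the tangent map.
-/
lemma vderiv_smooth [IsManifold I ∞ Y] {f : Y → F} {V : Set Y} (hV : IsOpen V)
    (hf : ∀ y ∈ V, ContMDiffAt I 𝓘(ℝ, F) ∞ f y) (ξ : TangentBundle I Y) (hξ : ξ.1 ∈ V) :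
    ContMDiffAt I.tangent 𝓘(ℝ, F) ∞ (fun ξ : TangentBundle I Y => vderiv I f ξ.1 ξ.2) ξ := by
  have : IsManifold I 1 Y := IsManifold.of_le (n := ∞) (by simp)
  have h1 : ContMDiffOn I 𝓘(ℝ, F) ∞ f V := fun y hy => (hf y hy).contMDiffWithinAt
  have h2 := h1.contMDiffOn_tangentMapWithin (m := ∞) (by simp) hV.uniqueMDiffOn
  have hopen : IsOpen (Bundle.TotalSpace.proj ⁻¹' V : Set (TangentBundle I Y)) :=
    hV.preimage (FiberBundle.continuous_proj _ _)
  have h3 := (contMDiff_snd_tangentBundle_modelSpace F 𝓘(ℝ, F) (n := ∞)).contMDiffAt.comp ξ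
    (h2.contMDiffAt (hopen.mem_nhds hξ))
  refine h3.congr_of_eventuallyEq ?_
  filter_upwards [hopen.mem_nhds hξ] with η hη
  have h4 := tangentMapWithin_eq_tangentMap (hV.uniqueMDiffOn _ hη)
    ((hf _ hη).mdifferentiableAt (by simp))
  exact (congrArg (fun z : TangentBundle 𝓘(ℝ, F) F => (z.2 : F)) h4).symm

/-- The derivative of a matrix valued map, as a linear map. -/
def mderivL (I : ModelWithCorners ℝ E H) (A : Y → Matrix N N ℝ) (x : Y) :
    TangentSpace I x →ₗ[ℝ] Matrix N N ℝ :=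
  (entriesL N).symm.toLinearMap ∘ₗ
    (mfderiv I 𝓘(ℝ, N → N → ℝ) (fun y => entries (A y)) x).toLinearMap

namespace GaugeData

variable {𝔤 𝔭 : Submodule ℝ (Matrix N N ℝ)} {P : Subgroup (Matrix N N ℝ)ˣ} {m : ℕ}
  {M : Type u} [TopologicalSpace M] [ChartedSpace (EuclideanSpace ℝ (Fin m)) M]
  [IsManifold (𝓡 m) ∞ M] (D : GaugeData.{u, v} 𝔤 𝔭 P (m := m) M)

/-- The projection of the total space. -/
def projT (x : D.Total) : M := D.proj x

/-- The action on the total space. -/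
def actT (x : D.Total) (g : P) : D.Total := D.act x g

/-- The fibre coordinate with value `1` at `x`, on the total space. -/
def fibT (x y : D.Total) : P := D.fib x y

lemma fibT_self (x : D.Total) : D.fibT x x = 1 := D.fib_self x

/-- The coordinates in the fibres of the total space. -/
def coordT (b : M) (x : D.Total) : P := D.coord b x

lemma projT_smooth : ContMDiff (𝓡 D.dim) (𝓡 m) ∞ D.projT := D.proj_smooth

lemma coordT_smooth {b : M} {x : D.Total} (hb : D.projT x ∈ D.U b) :
    GSmoothAt (𝓡 D.dim) (D.coordT b) x := D.coord_smooth hb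

/-- The Cartan connection, expressed in the gauge `D.sec b`. -/
def connAux (b : M) (x : D.Total) : TangentSpace (𝓡 D.dim) x →ₗ[ℝ] Matrix N N ℝ :=
  (LinearMap.mulLeft ℝ ((D.coordT b x)⁻¹).1.val ∘ₗ LinearMap.mulRight ℝ (D.coordT b x).1.val) ∘ₗ
      D.form b (D.projT x) ∘ₗ (mfderiv (𝓡 D.dim) (𝓡 m) D.projT x).toLinearMap +
    LinearMap.mulLeft ℝ ((D.coordT b x)⁻¹).1.val ∘ₗ
      mderivL (𝓡 D.dim) (fun y => (D.coordT b y).1.val) x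

lemma connAux_apply (b : M) (x : D.Total) (ξ : TangentSpace (𝓡 D.dim) x) :
    D.connAux b x ξ = ((D.coordT b x)⁻¹).1.val *
        (D.form b (D.projT x) (mfderiv (𝓡 D.dim) (𝓡 m) D.projT x ξ) * (D.coordT b x).1.val) +
      ((D.coordT b x)⁻¹).1.val * gderiv (𝓡 D.dim) (D.coordT b) x ξ := rfl

/-- The Cartan connection. -/
def conn (x : D.Total) : TangentSpace (𝓡 D.dim) x →ₗ[ℝ] Matrix N N ℝ := D.connAux (D.projT x) x

/-- Substituting k_a = T k_b, with T the transition function, the derivative of T reproduces the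
inhomogeneous term k_b⁻¹(T⁻¹dT)k_b of `form_trans`. Hence the local formulas define one global form.
-/
lemma connAux_eq {a b : M} {x : D.Total} (ha : D.projT x ∈ D.U a) (hb : D.projT x ∈ D.U b)
    (ξ : TangentSpace (𝓡 D.dim) x) : D.connAux a x ξ = D.connAux b x ξ := by
  have hc := D.projT_smooth.continuous.continuousAt (x := x)
  have h1 : D.coordT a =ᶠ[𝓝 x] fun y => D.trans a b (D.projT y) * D.coordT b y := by
    filter_upwards [hc ((D.isOpen a).mem_nhds ha), hc ((D.isOpen b).mem_nhds hb)] with y h2 h3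
    exact D.coord_trans h2 h3
  have ht := D.trans_smooth a b _ ha hb
  have h2 : GSmoothAt (𝓡 D.dim) (fun y => D.trans a b (D.projT y)) x :=
    GSmoothAt.comp (I' := 𝓡 m) (g := D.projT) ht (D.projT_smooth x)
  have h3 := gderiv_congr h1 ξ
  rw [gderiv_mul h2 (D.coordT_smooth hb), gderiv_comp (I' := 𝓡 m) ht (D.projT_smooth x)] at h3
  rw [connAux_apply, connAux_apply, D.form_trans a b _ ha hb, h3, h1.self_of_nhds]
  simp only [_root_.mul_inv_rev, Subgroup.coe_mul, Units.val_mul, Matrix.mul_add, Matrix.add_mul,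
    Matrix.mul_assoc, inv_mul_val_assoc]
  abel

lemma conn_eq {b : M} {x : D.Total} (hb : D.projT x ∈ D.U b)
    (ξ : TangentSpace (𝓡 D.dim) x) : D.conn x ξ = D.connAux b x ξ :=
  D.connAux_eq (D.mem _) hb ξ

lemma conn_smooth : ContMDiff (𝓡 D.dim).tangent 𝓘(ℝ, N → N → ℝ) ∞
    (fun ξ : TangentBundle (𝓡 D.dim) D.Total => entries (D.conn ξ.1 ξ.2)) := by
  intro ξ
  set b := D.projT ξ.1 with hb
  have : IsManifold (𝓡 m) 1 M := IsManifold.of_le (n := ∞) (by simp)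
  have : IsManifold (𝓡 D.dim) 1 D.Total := IsManifold.of_le (n := ∞) (by simp)
  have hopen : IsOpen (D.projT ⁻¹' D.U b) := (D.isOpen b).preimage D.projT_smooth.continuous
  have hopen' : IsOpen (Bundle.TotalSpace.proj ⁻¹' (D.projT ⁻¹' D.U b) :
      Set (TangentBundle (𝓡 D.dim) D.Total)) := hopen.preimage (FiberBundle.continuous_proj _ _)
  have hξ : ξ.1 ∈ D.projT ⁻¹' D.U b := D.mem _
  have hk : GSmoothAt (𝓡 D.dim).tangent
      (fun η : TangentBundle (𝓡 D.dim) D.Total => D.coordT b η.1) ξ :=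
    GSmoothAt.comp (I' := 𝓡 D.dim) (D.coordT_smooth hξ) (Bundle.contMDiffAt_proj _)
  have hd : MSmoothAt (𝓡 D.dim).tangent
      (fun η : TangentBundle (𝓡 D.dim) D.Total => gderiv (𝓡 D.dim) (D.coordT b) η.1 η.2) ξ :=
    vderiv_smooth hopen (fun y hy => D.coordT_smooth hy) ξ hξ
  have hf : MSmoothAt (𝓡 D.dim).tangent
      (fun η : TangentBundle (𝓡 D.dim) D.Total => D.form b (D.projT η.1)
        (mfderiv (𝓡 D.dim) (𝓡 m) D.projT η.1 η.2)) ξ :=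
    ContMDiffAt.comp ξ (D.form_smooth b (tangentMap (𝓡 D.dim) (𝓡 m) D.projT ξ) (D.mem _))
      (D.projT_smooth.contMDiff_tangentMap (m := ∞) (by simp)).contMDiffAt
  have h1 := (MSmoothAt.mul (GSmoothAt.inv hk) (MSmoothAt.mul hf hk)).add
    (MSmoothAt.mul (GSmoothAt.inv hk) hd)
  refine MSmoothAt.congr h1 ?_
  filter_upwards [hopen'.mem_nhds hξ] with η hη
  exact D.conn_eq hη _

lemma form_point (b : M) {y y' : M} (h : y = y') {w w' : EuclideanSpace ℝ (Fin m)} (hw : w = w') :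
    D.form b y w = D.form b y' w' := by subst h hw; rfl

lemma actT_smoothAt_prod {F : Type*} [NormedAddCommGroup F] [NormedSpace ℝ F] {q : F → P}
    {x : D.Total} {y : F} (hq : GSmoothAt 𝓘(ℝ, F) q y) :
    ContMDiffAt ((𝓡 D.dim).prod 𝓘(ℝ, F)) (𝓡 D.dim) ∞
      (fun z : D.Total × F => D.actT z.1 (q z.2)) (x, y) := by
  refine D.contMDiffAt_of_smoothAt ?_
  have h1 : ContMDiffAt ((𝓡 D.dim).prod 𝓘(ℝ, F)) (𝓡 D.dim) ∞
    (Prod.fst : D.Total × F → D.Total) (x, y) := contMDiffAt_fst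
  have h2 : ContMDiffAt ((𝓡 D.dim).prod 𝓘(ℝ, F)) 𝓘(ℝ, F) ∞
    (Prod.snd : D.Total × F → F) (x, y) := contMDiffAt_snd
  have hc : ContinuousAt (fun z : D.Total × F => D.projT z.1) (x, y) :=
    D.projT_smooth.continuous.continuousAt.comp continuousAt_fst
  refine smoothAt_of_coord (b := D.projT x) 
    (by rw [show D.proj (D.actT (x, y).1 (q (x, y).2)) = D.projT x from D.proj_act x (q y)]
        exact D.mem _) ?_ ?_
  · have h3 : ContMDiffAt ((𝓡 D.dim).prod 𝓘(ℝ, F)) (𝓡 m) ∞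
        (fun z : D.Total × F => D.projT z.1) (x, y) :=
      ContMDiffAt.comp (x, y) (D.projT_smooth _) h1
    have h4 : (fun z : D.Total × F => D.proj (D.actT z.1 (q z.2))) = fun z => D.projT z.1 := by
      funext z; exact D.proj_act _ _
    rw [h4]; exact h3
  · have h5 : GSmoothAt ((𝓡 D.dim).prod 𝓘(ℝ, F))
        (fun z : D.Total × F => D.coordT (D.projT x) z.1 * q z.2) (x, y) :=
      (GSmoothAt.comp (I' := 𝓡 D.dim) (g := (Prod.fst : D.Total × F → D.Total))
        (D.coordT_smooth (D.mem _)) h1).mul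
        (GSmoothAt.comp (I' := 𝓘(ℝ, F)) (g := (Prod.snd : D.Total × F → F)) hq h2)
    refine h5.congr ?_
    filter_upwards [hc ((D.isOpen (D.projT x)).mem_nhds (D.mem _))] with z hz
    exact D.coord_act hz _

lemma actT_smooth (g : P) : ContMDiff (𝓡 D.dim) (𝓡 D.dim) ∞ (fun z => D.actT z g) := by
  intro x
  have h := D.actT_smoothAt_prod (F := ℝ) (q := fun _ => g) (x := x) (y := 0) (GSmoothAt.const g _)
  exact ContMDiffAt.comp (f := fun z : D.Total => (z, (0 : ℝ))) x h
    (contMDiffAt_id.prodMk contMDiffAt_const)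

lemma proj_conn_along {c : Y → D.Total} {x : Y} (hc : MDifferentiableAt I (𝓡 D.dim) c x)
    (ξ : TangentSpace I x) :
    (mfderiv (𝓡 D.dim) (𝓡 m) D.projT (c x) (mfderiv I (𝓡 D.dim) c x ξ) :
      EuclideanSpace ℝ (Fin m)) = mfderiv I (𝓡 m) (fun y => D.projT (c y)) x ξ :=
  (mfderiv_comp_apply x ((D.projT_smooth _).mdifferentiableAt (by simp)) hc ξ).symm

/-- Acting by `g` leaves the projection unchanged and multiplies the fibre coordinate on the right
by a constant. -/
lemma conn_equivariant (x : D.Total) (g : P) (ξ : TangentSpace (𝓡 D.dim) x) :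
    D.conn (D.actT x g) (mfderiv (𝓡 D.dim) (𝓡 D.dim) (fun z => D.actT z g) x ξ) =
      (g⁻¹).1.val * D.conn x ξ * g.1.val := by
  set b := D.projT x with hb
  have hpg : ∀ z : D.Total, D.projT (D.actT z g) = D.projT z := fun z => D.proj_act z g
  have hx : D.projT (D.actT x g) ∈ D.U b := by rw [hpg]; exact D.mem _
  have hs := D.actT_smooth g x
  have hp := D.proj_conn_along (c := fun z => D.actT z g) (hs.mdifferentiableAt (by simp)) ξ
  have hp' : (fun y => D.projT (D.actT y g)) = D.projT := funext hpg
  rw [hp'] at hp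
  have hk := (gderiv_comp (I' := 𝓡 D.dim) (g := fun z => D.actT z g) (D.coordT_smooth hx) hs ξ).symm
  have hnear : (fun z => D.coordT b (D.actT z g)) =ᶠ[𝓝 x] fun z => D.coordT b z * g := by
    filter_upwards [D.projT_smooth.continuous.continuousAt
      ((D.isOpen b).mem_nhds (D.mem (D.projT x)))] with z hz
    exact D.coord_act hz g
  rw [gderiv_congr hnear, gderiv_mul (D.coordT_smooth (D.mem _)) (GSmoothAt.const g x),
    gderiv_const, Matrix.mul_zero, add_zero] at hk
  have hc : D.coordT b (D.actT x g) = D.coordT b x * g := hnear.self_of_nhds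
  rw [D.conn_eq hx, D.conn_eq (b := b) (D.mem _), connAux_apply, connAux_apply, hk, hc,
    D.form_point b (hpg x) hp]
  simp only [_root_.mul_inv_rev, Subgroup.coe_mul, Units.val_mul, Matrix.mul_add, Matrix.add_mul,
    Matrix.mul_assoc]
  rfl

lemma conn_fundamental (x : D.Total) (γ : ℝ → P) (hγ : ∀ t, GSmoothAt 𝓘(ℝ, ℝ) γ t) (h0 : γ 0 = 1) :
    D.conn (D.actT x (γ 0)) (mfderiv 𝓘(ℝ, ℝ) (𝓡 D.dim) (fun t => D.actT x (γ t)) 0 (unitVec 0)) =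
      gderiv 𝓘(ℝ, ℝ) γ 0 (unitVec 0) := by
  set b := D.projT x with hb
  have hs : ContMDiffAt 𝓘(ℝ, ℝ) (𝓡 D.dim) ∞ (fun t => D.actT x (γ t)) 0 := by
    have h := D.actT_smoothAt_prod (F := ℝ) (q := γ) (x := x) (y := 0) (hγ 0)
    exact ContMDiffAt.comp (f := fun t : ℝ => (x, t)) 0 h
      (contMDiffAt_const.prodMk contMDiffAt_id)
  have hpg : ∀ t : ℝ, D.projT (D.actT x (γ t)) = D.projT x := fun z => D.proj_act _ _
  have hx : D.projT (D.actT x (γ 0)) ∈ D.U b := by rw [hpg]; exact D.mem _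
  have hp := D.proj_conn_along (c := fun t => D.actT x (γ t)) (hs.mdifferentiableAt (by simp))
    (unitVec 0)
  have hp' : (fun t => D.projT (D.actT x (γ t))) = fun _ => D.projT x := funext hpg
  rw [hp', mfderiv_const] at hp
  have hk := (gderiv_comp (I' := 𝓡 D.dim) (g := fun t => D.actT x (γ t)) (D.coordT_smooth hx) hs
    (unitVec 0)).symm
  have hnear : (fun t => D.coordT b (D.actT x (γ t))) = fun t => D.coordT b x * γ t := by
    funext t; exact D.coord_act (D.mem _) _
  rw [hnear, gderiv_mul (GSmoothAt.const _ _) (hγ 0), gderiv_const, Matrix.zero_mul,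
    zero_add] at hk
  have hc : D.coordT b (D.actT x (γ 0)) = D.coordT b x := by
    rw [congrFun hnear 0, h0, mul_one]
  have hform : D.form b (D.projT (D.actT x (γ 0)))
      (mfderiv (𝓡 D.dim) (𝓡 m) D.projT (D.actT x (γ 0))
        (mfderiv 𝓘(ℝ, ℝ) (𝓡 D.dim) (fun t => D.actT x (γ t)) 0 (unitVec 0))) = 0 := by
    refine (congrArg (D.form b (D.projT (D.actT x (γ 0)))) hp).trans ?_
    exact map_zero _
  rw [D.conn_eq hx, connAux_apply, hk, hform, hc]
  simp

/-- The gauge form and the inclusion of `𝔭` together identify the sum of the tangent space and `𝔭`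
with `𝔤`. With injectivity of the connection, this count gives its range. -/
lemma finrank_eq (b : M) : Module.finrank ℝ 𝔤 = D.dim := by
  let L : EuclideanSpace ℝ (Fin m) × 𝔭 →ₗ[ℝ] 𝔤 :=
    LinearMap.codRestrict 𝔤 (((D.form b b : EuclideanSpace ℝ (Fin m) →ₗ[ℝ] Matrix N N ℝ)).coprod
      𝔭.subtype) (fun z => 𝔤.add_mem (D.form_mem b b (D.mem b) _) (D.pair.le z.2.2))
  have hL : ∀ z, (L z : Matrix N N ℝ) = D.form b b z.1 + (z.2 : Matrix N N ℝ) := fun z => rfl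
  have hinj : Function.Injective L := by
    rw [injective_iff_map_eq_zero]
    rintro ⟨w, B⟩ h
    have h1 : D.form b b w + (B : Matrix N N ℝ) = 0 := congrArg Subtype.val h
    have h2 : D.form b b w ∈ 𝔭 := by
      rw [eq_neg_of_add_eq_zero_left h1]; exact 𝔭.neg_mem B.2
    have h3 : w = 0 := D.form_injective b b (D.mem b) w h2
    subst h3
    have h4 : D.form b b (0 : EuclideanSpace ℝ (Fin m)) = 0 := map_zero _
    rw [h4, zero_add] at h1
    exact Prod.ext rfl (Subtype.ext h1)
  have hsurj : Function.Surjective L := by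
    intro A
    obtain ⟨w, hw⟩ := D.form_surjective b b (D.mem b) A.1 A.2
    refine ⟨(w, ⟨_, 𝔭.neg_mem hw⟩), Subtype.ext ?_⟩
    rw [hL]
    simp
  rw [← (LinearEquiv.ofBijective L ⟨hinj, hsurj⟩).finrank_eq, Module.finrank_prod,
    finrank_euclideanSpace_fin, dim]

lemma log_deriv_mem (b : M) (x : D.Total) (hb : D.projT x ∈ D.U b)
    (ξ : TangentSpace (𝓡 D.dim) x) :
    ((D.coordT b x)⁻¹).1.val * gderiv (𝓡 D.dim) (D.coordT b) x ξ ∈ 𝔭 :=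
  D.pair.log_deriv_mem (D.coordT_smooth hb) ξ

lemma conn_mem (x : D.Total) (ξ : TangentSpace (𝓡 D.dim) x) : D.conn x ξ ∈ 𝔤 := by
  rw [D.conn_eq (D.mem _), connAux_apply]
  refine 𝔤.add_mem ?_ (D.pair.le (D.log_deriv_mem _ x (D.mem _) ξ))
  rw [← Matrix.mul_assoc]
  exact D.pair.conj_mem _ (D.coordT _ x).2 _ (D.form_mem _ _ (D.mem _) _)

/-- The chart at `x` is a function of the projection and of the fibre coordinate, so its derivative
annihilates `ξ`; but the derivative of a chart is invertible. -/
lemma vec_eq_zero {x : D.Total} {b : M} (hb : D.projT x ∈ D.U b) (ξ : TangentSpace (𝓡 D.dim) x)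
    (h1 : mfderiv (𝓡 D.dim) (𝓡 m) D.projT x ξ = 0)
    (h2 : gderiv (𝓡 D.dim) (D.coordT b) x ξ = 0) : ξ = 0 := by
  have : IsManifold (𝓡 D.dim) 1 D.Total := IsManifold.of_le (n := ∞) (by simp)
  have hinv := isInvertible_mfderiv_extChartAt (I := 𝓡 D.dim) (mem_extChartAt_source (I := 𝓡 D.dim) x)
  refine hinv.injective ?_
  rw [map_zero]
  set b₀ := D.projT x with hb₀
  have hfibs : GSmoothAt (𝓡 D.dim) (D.fibT x) x :=
    (D.smoothAt_id x).fib (D.mem _)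
  have hu : IsUnit ((D.fibT x x).1.val + 1).det := by
    rw [D.fibT_self]; exact isUnit_one_add_one
  -- the fibre coordinate has vanishing derivative
  have hfib : gderiv (𝓡 D.dim) (D.fibT x) x ξ = 0 := by
    have hc := D.projT_smooth.continuous.continuousAt (x := x)
    have ht := D.trans_smooth b₀ b b₀ (D.mem _) hb
    have h3 : (D.fibT x) =ᶠ[𝓝 x] fun y =>
        ((D.coordT b₀ x)⁻¹ * D.trans b₀ b (D.projT y)) * D.coordT b y := by
      filter_upwards [hc ((D.isOpen b).mem_nhds hb), hc ((D.isOpen b₀).mem_nhds (D.mem _))]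
        with y h4 h5
      rw [mul_assoc]
      exact congrArg (fun g => (D.coordT b₀ x)⁻¹ * g) (D.coord_trans h5 h4)
    have h6 : GSmoothAt (𝓡 D.dim) (fun y : D.Total => D.trans b₀ b (D.projT y)) x :=
      GSmoothAt.comp (I' := 𝓡 m) (g := D.projT) ht (D.projT_smooth x)
    rw [gderiv_congr h3, gderiv_mul ((GSmoothAt.const (D.coordT b₀ x)⁻¹ x).mul h6) (D.coordT_smooth hb), h2,
      gderiv_mul (GSmoothAt.const _ x) h6,
      gderiv_comp (I' := 𝓡 m) (g := D.projT) ht (D.projT_smooth x), h1]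
    have h7 : gderiv (𝓡 m) (D.trans b₀ b) (D.projT x) 0 = 0 :=
      map_zero (mderivL (𝓡 m) (fun y => (D.trans b₀ b y).1.val) _)
    rw [h7]
    simp
  have hc1 : ContMDiffAt (𝓡 D.dim) 𝓘(ℝ, EuclideanSpace ℝ (Fin m)) ∞
      (fun y : D.Total => extChartAt (𝓡 m) b₀ (D.projT y)) x :=
    ContMDiffAt.comp x (I' := 𝓡 m) contMDiffAt_extChartAt (D.projT_smooth x)
  have hc2 : ContMDiffAt (𝓡 D.dim) 𝓘(ℝ, EuclideanSpace ℝ (Fin (Module.finrank ℝ 𝔭))) ∞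
      (fun y : D.Total => D.ofMat (cay (D.fibT x y).1.val)) x :=
    MSmoothAt.linear (cay_smooth hfibs hu) D.ofMat
  have hd1 : vderiv (𝓡 D.dim) (fun y : D.Total => extChartAt (𝓡 m) b₀ (D.projT y)) x ξ = 0 := by
    rw [vderiv_comp (I' := 𝓡 m) (f := extChartAt (𝓡 m) b₀) (g := D.projT)
      (contMDiffAt_extChartAt (n := ∞) |>.mdifferentiableAt (by simp))
      ((D.projT_smooth x).mdifferentiableAt (by simp)), h1]
    exact map_zero _
  have hd2 : vderiv (𝓡 D.dim) (fun y : D.Total => D.ofMat (cay (D.fibT x y).1.val)) x ξ = 0 := by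
    rw [vderiv_linear (cay_smooth hfibs hu) D.ofMat]
    -- The Cayley transform is differentiated as a map on the space of matrices, so that the chain
    -- rule reduces the claim to a linear map applied to 0.
    have h8 : MSmoothAt 𝓘(ℝ, N → N → ℝ)
        (fun A : N → N → ℝ => cay (Matrix.of A)) (entries (D.fibT x x).1.val) :=
      cay_smooth (I := 𝓘(ℝ, N → N → ℝ)) (A := fun A : N → N → ℝ => Matrix.of A) contMDiffAt_id hu
    have h9 : mderiv (𝓡 D.dim) (fun y : D.Total => cay (D.fibT x y).1.val) x ξ =
        mderiv 𝓘(ℝ, N → N → ℝ) (fun A : N → N → ℝ => cay (Matrix.of A)) _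
          (mfderiv (𝓡 D.dim) 𝓘(ℝ, N → N → ℝ)
            (fun y : D.Total => entries (D.fibT x y).1.val) x ξ) :=
      mderiv_comp (I' := 𝓘(ℝ, N → N → ℝ)) (g := fun y : D.Total => entries (D.fibT x y).1.val)
        h8 hfibs ξ
    have h10 : mfderiv (𝓡 D.dim) 𝓘(ℝ, N → N → ℝ)
            (fun y : D.Total => entries (D.fibT x y).1.val) x ξ = 0 := hfib
    rw [h9, h10]
    have h11 : mderiv 𝓘(ℝ, N → N → ℝ) (fun A : N → N → ℝ => cay (Matrix.of A))
        (entries (D.fibT x x).1.val) 0 = 0 :=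
      map_zero (mderivL 𝓘(ℝ, N → N → ℝ) (fun A : N → N → ℝ => cay (Matrix.of A)) _)
    rw [h11, map_zero]
  have h12 : vderiv (𝓡 D.dim) (fun y : D.Total => D.split.symm
      (extChartAt (𝓡 m) b₀ (D.projT y), D.ofMat (cay (D.fibT x y).1.val))) x ξ = 0 := by
    have h13 := mfderiv_linear (D.split.symm : _ →L[ℝ] EuclideanSpace ℝ (Fin D.dim))
      ((hc1.prodMk_space hc2).mdifferentiableAt (by simp)) ξ
    refine h13.trans ?_
    have h14 : vderiv (𝓡 D.dim) (fun y : D.Total => (extChartAt (𝓡 m) b₀ (D.projT y),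
        D.ofMat (cay (D.fibT x y).1.val))) x ξ = 0 := by
      have hp := (hc1.prodMk_space hc2).mdifferentiableAt (by simp)
      have h15 := mfderiv_linear (ContinuousLinearMap.fst ℝ (EuclideanSpace ℝ (Fin m))
        (EuclideanSpace ℝ (Fin (Module.finrank ℝ 𝔭)))) hp ξ
      have h16 := mfderiv_linear (ContinuousLinearMap.snd ℝ (EuclideanSpace ℝ (Fin m))
        (EuclideanSpace ℝ (Fin (Module.finrank ℝ 𝔭)))) hp ξ
      exact Prod.ext (h15.symm.trans hd1) (h16.symm.trans hd2)
    rw [h14, map_zero]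
  exact h12

/-- If the connection vanishes on ξ, the gauge form of the projection of ξ equals -(dk)k⁻¹, with k
the fibre coordinate. This lies in `𝔭`, so the projection of ξ is 0, and then dk vanishes on ξ as
well. -/
lemma conn_injective (x : D.Total) : Function.Injective (D.conn x) := by
  rw [injective_iff_map_eq_zero]
  intro ξ h
  set b := D.projT x with hb
  set k := D.coordT b x with hk
  have hks : GSmoothAt (𝓡 D.dim) (D.coordT b) x := D.coordT_smooth (D.mem _)
  rw [D.conn_eq (b := b) (D.mem _), connAux_apply] at h
  have h1 : D.form b b (mfderiv (𝓡 D.dim) (𝓡 m) D.projT x ξ) * k.1.val +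
      gderiv (𝓡 D.dim) (D.coordT b) x ξ = 0 := by
    have := congrArg (fun A => k.1.val * A) h
    rw [← hk] at this
    simpa only [Matrix.mul_add, mul_inv_val_assoc, Matrix.mul_zero] using this
  have h2 : D.form b b (mfderiv (𝓡 D.dim) (𝓡 m) D.projT x ξ) =
      -(gderiv (𝓡 D.dim) (D.coordT b) x ξ * (k⁻¹).1.val) := by
    have := congrArg (fun A => A * (k⁻¹).1.val) h1
    simp only [Matrix.add_mul, Matrix.mul_assoc, mul_inv_val, Matrix.mul_one,
      Matrix.zero_mul] at this
    exact eq_neg_of_add_eq_zero_left this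
  have h3 : D.form b b (mfderiv (𝓡 D.dim) (𝓡 m) D.projT x ξ) ∈ 𝔭 := by
    -- The left logarithmic derivative of k⁻¹ is -(dk)k⁻¹.
    have h4 := D.pair.log_deriv_mem hks.inv ξ
    rw [gderiv_inv hks, inv_inv, Matrix.mul_neg, Matrix.mul_assoc, mul_inv_val_assoc] at h4
    rwa [h2]
  have h5 := D.form_injective b b (D.mem _) _ h3
  refine D.vec_eq_zero (b := b) (D.mem _) ξ h5 ?_
  rw [h5, map_zero, Matrix.zero_mul, zero_add] at h1
  exact h1

lemma conn_range (x : D.Total) : Set.range (D.conn x) = (𝔤 : Set (Matrix N N ℝ)) := by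
  have h1 : LinearMap.range (D.conn x) ≤ 𝔤 := by
    rintro _ ⟨ξ, rfl⟩; exact D.conn_mem x ξ
  have h2 : Module.finrank ℝ (LinearMap.range (D.conn x)) = Module.finrank ℝ 𝔤 := by
    rw [LinearMap.finrank_range_of_inj (D.conn_injective x), D.finrank_eq (D.projT x)]
    exact finrank_euclideanSpace_fin
  exact congrArg (fun S : Submodule ℝ (Matrix N N ℝ) => (S : Set (Matrix N N ℝ)))
    (Submodule.eq_of_le_of_finrank_eq h1 h2)

/-- A section, with values in the total space. -/
def secT (b y : M) : D.Total := D.sec b y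

lemma secT_smooth {b y : M} (hy : y ∈ D.U b) :
    ContMDiffAt (𝓡 m) (𝓡 D.dim) ∞ (D.secT b) y := by
  have hn := (D.isOpen b).mem_nhds hy
  have hp : ∀ z ∈ D.U b, D.proj (D.secT b z) = z := D.proj_sec b
  refine D.contMDiffAt_of_smoothAt (smoothAt_of_coord (b := b) (by rwa [hp y hy]) ?_ ?_)
  · refine contMDiffAt_id.congr_of_eventuallyEq ?_
    filter_upwards [hn] with z hz
    exact hp z hz
  · refine (GSmoothAt.const 1 y).congr ?_
    filter_upwards [hn] with z hz
    exact D.coord_sec hz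

/-- The Cartan geometry determined by gauge data. -/
def geometry : CartanGeometry.{u, v} 𝔤 P (m := m) M where
  Total := D.Total
  dim := D.dim
  proj := D.projT
  proj_smooth := D.projT_smooth
  act := D.actT
  act_one := D.act_one
  act_mul := D.act_mul
  act_free := D.act_free
  act_smooth F _ _ _ q x₀ y₀ hq :=
    D.actT_smoothAt_prod (q := q) (x := x₀) (y := y₀) hq.contMDiffAt
  proj_act := D.proj_act
  locallyTrivial b := ⟨D.U b, D.isOpen b, D.mem b, D.secT b, D.coordT b,
    fun y hy => (D.secT_smooth hy).contMDiffWithinAt,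
    fun x hx => ContMDiffAt.contMDiffWithinAt (D.coordT_smooth hx), D.proj_sec b,
    fun x hx => D.act_coord hx⟩
  conn := D.conn
  conn_smooth := D.conn_smooth
  conn_equivariant := D.conn_equivariant
  conn_fundamental x γ hγ h0 := by
    have hγ' : ∀ t, GSmoothAt 𝓘(ℝ, ℝ) γ t := fun t => hγ.contDiffAt.contMDiffAt
    refine (congrArg entries (D.conn_fundamental x γ hγ' h0)).trans ?_
    exact vderiv_unitVec (F := N → N → ℝ) (hγ.differentiable (by simp) 0).hasDerivAt
  conn_injective := D.conn_injective
  conn_range := D.conn_range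

lemma geometry_isSection (b : M) : D.geometry.IsSection (D.U b) (D.secT b) :=
  ⟨D.isOpen b, fun y hy => D.secT_smooth hy, D.proj_sec b⟩

lemma geometry_pull {b y : M} (hy : y ∈ D.U b) (ξ : TangentSpace (𝓡 m) y) :
    D.geometry.pull (𝓡 m) (D.secT b) y ξ = D.form b y ξ := by
  have hs := D.geometry_isSection b
  have hp : D.projT (D.secT b y) = y := D.proj_sec b y hy
  have hx : D.projT (D.secT b y) ∈ D.U b := by rwa [hp]
  have h1 : D.conn (D.secT b y) (mfderiv (𝓡 m) (𝓡 D.dim) (D.secT b) y ξ) = D.form b y ξ := by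
    rw [D.conn_eq hx, connAux_apply]
    have h2 : D.coordT b (D.secT b y) = 1 := D.coord_sec hy
    have h3 := (gderiv_comp (I' := 𝓡 D.dim) (D.coordT_smooth hx) (D.secT_smooth hy) ξ).symm
    have h4 : (fun z => D.coordT b (D.secT b z)) =ᶠ[𝓝 y] fun _ => 1 := by
      filter_upwards [(D.isOpen b).mem_nhds hy] with z hz
      exact D.coord_sec hz
    rw [gderiv_congr h4, gderiv_const] at h3
    have h5 : (mfderiv (𝓡 D.dim) (𝓡 m) D.projT (D.secT b y)
        (mfderiv (𝓡 m) (𝓡 D.dim) (D.secT b) y ξ) : EuclideanSpace ℝ (Fin m)) = ξ :=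
      hs.mfderiv_proj hy ξ
    rw [h2, h3, D.form_point b hp h5]
    simp
  exact h1

end GaugeData

end GaugeConnection

/-! ## Stabilizers in orthogonal groups -/

section Stabilizers

variable {N : Type} [Fintype N] [DecidableEq N]

/-- The Lie algebra of the stabilizer of `W` in `SO S`. -/
def lieStab (S : Matrix N N ℝ) (W : Submodule ℝ (N → ℝ)) : Submodule ℝ (Matrix N N ℝ) where
  carrier := {X | X ∈ skewAdjointMatricesSubmodule S ∧ ∀ w ∈ W, X *ᵥ w ∈ W}
  add_mem' := by
    rintro X Y ⟨h1, h2⟩ ⟨h3, h4⟩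
    exact ⟨add_mem h1 h3, fun w hw => by rw [Matrix.add_mulVec]; exact add_mem (h2 w hw) (h4 w hw)⟩
  zero_mem' := ⟨zero_mem _, fun w hw => by rw [Matrix.zero_mulVec]; exact zero_mem _⟩
  smul_mem' := by
    rintro r X ⟨h1, h2⟩
    exact ⟨Submodule.smul_mem _ r h1,
      fun w hw => by rw [Matrix.smul_mulVec]; exact W.smul_mem r (h2 w hw)⟩

lemma mem_skew_iff {S X : Matrix N N ℝ} :
    X ∈ skewAdjointMatricesSubmodule S ↔ Xᵀ * S + S * X = 0 := by
  rw [mem_skewAdjointMatricesSubmodule, Matrix.IsSkewAdjoint, Matrix.IsAdjointPair, Matrix.mul_neg,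
    eq_neg_iff_add_eq_zero]

/-- An injective endomorphism of the finite-dimensional space `W` is surjective. -/
lemma inv_mulVec_mem {A : Matrix N N ℝ} (hA : IsUnit A.det) {W : Submodule ℝ (N → ℝ)}
    (h : ∀ w ∈ W, A *ᵥ w ∈ W) : ∀ w ∈ W, A⁻¹ *ᵥ w ∈ W := by
  let L : W →ₗ[ℝ] W := (Matrix.mulVecLin A).restrict h
  have hinj : Function.Injective L := by
    intro w w' hw
    have h1 : A *ᵥ (w : N → ℝ) = A *ᵥ (w' : N → ℝ) := congrArg Subtype.val hw
    exact Subtype.ext (Matrix.mulVec_injective_of_isUnit ((Matrix.isUnit_iff_isUnit_det A).2 hA) h1)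
  intro w hw
  obtain ⟨w', hw'⟩ := LinearMap.surjective_of_injective hinj ⟨w, hw⟩
  have h2 : A *ᵥ (w' : N → ℝ) = w := congrArg Subtype.val hw'
  rw [← h2, Matrix.mulVec_mulVec, Matrix.nonsing_inv_mul _ hA, Matrix.one_mulVec]
  exact w'.2

lemma mem_stab_of_forall {g : (Matrix N N ℝ)ˣ} {W : Submodule ℝ (N → ℝ)}
    (h : ∀ w ∈ W, g.val *ᵥ w ∈ W) : g ∈ stab W := by
  intro w
  refine ⟨fun hw => ?_, h w⟩
  have := inv_mulVec_mem (unit_det g) h _ hw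
  rwa [Matrix.mulVec_mulVec, Matrix.nonsing_inv_mul _ (unit_det g), Matrix.one_mulVec] at this

lemma eq_zero_of_congr {A B : Matrix N N ℝ} (hA : IsUnit A.det) (h : Aᵀ * B * A = 0) : B = 0 := by
  have h1 : IsUnit Aᵀ.det := by rwa [Matrix.det_transpose]
  have h2 := congrArg (fun C => (Aᵀ)⁻¹ * C * A⁻¹) h
  simpa [Matrix.mul_assoc, Matrix.mul_nonsing_inv _ hA,
    Matrix.nonsing_inv_mul_cancel_left _ _ h1] using h2

lemma SO_mul_transpose {S : Matrix N N ℝ} {g : (Matrix N N ℝ)ˣ} (hg : g ∈ SO S) :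
    (g.val)ᵀ * S = S * (g⁻¹).val := by
  have h1 : (g.val)ᵀ * S * g.val = S := hg.1
  calc (g.val)ᵀ * S = (g.val)ᵀ * S * (g.val * (g⁻¹).val) := by
        rw [Units.mul_inv, Matrix.mul_one]
    _ = ((g.val)ᵀ * S * g.val) * (g⁻¹).val := by simp only [Matrix.mul_assoc]
    _ = _ := by rw [h1]

lemma skew_conj_mem {S : Matrix N N ℝ} {g : (Matrix N N ℝ)ˣ} (hg : g ∈ SO S) {X : Matrix N N ℝ}
    (hX : X ∈ skewAdjointMatricesSubmodule S) :
    (g⁻¹).val * X * g.val ∈ skewAdjointMatricesSubmodule S := by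
  rw [mem_skew_iff] at hX ⊢
  have h1 := SO_mul_transpose hg
  have h2 := SO_mul_transpose ((SO S).inv_mem hg)
  rw [inv_inv] at h2
  calc ((g⁻¹).val * X * g.val)ᵀ * S + S * ((g⁻¹).val * X * g.val)
      = (g.val)ᵀ * (Xᵀ * (((g⁻¹).val)ᵀ * S)) + (S * (g⁻¹).val) * X * g.val := by
        simp only [Matrix.transpose_mul, Matrix.mul_assoc]
    _ = (g.val)ᵀ * (Xᵀ * S + S * X) * g.val := by
        rw [h2, ← h1]; simp only [Matrix.mul_add, Matrix.add_mul, Matrix.mul_assoc]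
    _ = 0 := by rw [hX]; simp

/-- For X the Cayley transform of A, the form AᵀSA - S is congruent up to a factor to XᵀS + SX, so
orthogonality and skewness correspond. Both transforms are built from matrices preserving `W` and
inverses of such, so `W` stays invariant. -/
lemma isParabolicPair_lieStab {S : Matrix N N ℝ} (hS : IsUnit S.det) (W : Submodule ℝ (N → ℝ)) :
    IsParabolicPair (skewAdjointMatricesSubmodule S) (lieStab S W) (SO S ⊓ stab W) where
  cayley_mem := by
    rintro g ⟨⟨h1, -⟩, h2⟩ hu
    set A : Matrix N N ℝ := g.val
    have hX : (A - 1) * (A + 1)⁻¹ * (A + 1) = A - 1 := by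
      rw [Matrix.mul_assoc, Matrix.nonsing_inv_mul _ hu, Matrix.mul_one]
    set X := (A - 1) * (A + 1)⁻¹
    refine ⟨?_, ?_⟩
    · rw [mem_skew_iff]
      -- Congruence by A + 1 clears the denominators: XᵀS + SX becomes (A - 1)ᵀS(A + 1) + (A +
      -- 1)ᵀS(A - 1) = 2(AᵀSA - S).
      refine eq_zero_of_congr hu ?_
      have e1 : (A + 1)ᵀ * (Xᵀ * S + S * X) * (A + 1) =
          (X * (A + 1))ᵀ * S * (A + 1) + (A + 1)ᵀ * S * (X * (A + 1)) := by
        generalize A + 1 = B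
        simp only [Matrix.transpose_mul, Matrix.mul_add, Matrix.add_mul, Matrix.mul_assoc]
      rw [e1, hX]
      simp only [Matrix.transpose_add, Matrix.transpose_sub, Matrix.transpose_one, Matrix.mul_add,
        Matrix.add_mul, Matrix.mul_sub, Matrix.sub_mul, Matrix.one_mul, Matrix.mul_one]
      rw [h1]
      abel
    · intro w hw
      have h3 : ∀ w ∈ W, (A + 1) *ᵥ w ∈ W := fun w hw => by
        rw [Matrix.add_mulVec, Matrix.one_mulVec]; exact add_mem ((h2 w).2 hw) hw
      have h4 := inv_mulVec_mem hu h3 w hw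
      rw [← Matrix.mulVec_mulVec, Matrix.sub_mulVec, Matrix.one_mulVec]
      exact sub_mem ((h2 _).2 h4) h4
  inv_cayley_mem := by
    rintro X ⟨h1, h2⟩ hu
    rw [mem_skew_iff] at h1
    -- Skewness reads (1 + X)ᵀS = S(1 - X), and S is invertible; hence the orthogonal matrix
    -- obtained has determinant 1, not merely ±1.
    have hdet : (1 + X).det = (1 - X).det := by
      have e1 : (1 + X)ᵀ * S = S * (1 - X) := by
        rw [Matrix.transpose_add, Matrix.transpose_one, Matrix.add_mul, Matrix.mul_sub,
          Matrix.one_mul, Matrix.mul_one, eq_neg_of_add_eq_zero_left h1]; abel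
      have e2 := congrArg Matrix.det e1
      rw [Matrix.det_mul, Matrix.det_mul, Matrix.det_transpose, mul_comm] at e2
      exact hS.mul_left_cancel e2
    have hA : ((1 + X) * (1 - X)⁻¹) * (1 - X) = 1 + X := by
      rw [Matrix.mul_assoc, Matrix.nonsing_inv_mul _ hu, Matrix.mul_one]
    set A := (1 + X) * (1 - X)⁻¹ with hAdef
    have hAdet : A.det = 1 := by
      have e2 := congrArg Matrix.det hA
      rw [Matrix.det_mul, hdet] at e2
      exact hu.mul_right_cancel (by rw [e2, one_mul])
    have hAu : IsUnit A.det := by rw [hAdet]; exact isUnit_one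
    have hAW : ∀ w ∈ W, A *ᵥ w ∈ W := by
      intro w hw
      have h3 : ∀ w ∈ W, (1 - X) *ᵥ w ∈ W := fun w hw => by
        rw [Matrix.sub_mulVec, Matrix.one_mulVec]; exact sub_mem hw (h2 w hw)
      have h4 := inv_mulVec_mem hu h3 w hw
      rw [hAdef, ← Matrix.mulVec_mulVec, Matrix.add_mulVec, Matrix.one_mulVec]
      exact add_mem h4 (h2 _ h4)
    refine ⟨Matrix.nonsingInvUnit A hAu, ⟨⟨?_, hAdet⟩, mem_stab_of_forall hAW⟩, rfl⟩
    change Aᵀ * S * A = S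
    rw [← sub_eq_zero]
    refine eq_zero_of_congr hu ?_
    have e1 : (1 - X)ᵀ * (Aᵀ * S * A - S) * (1 - X) =
        (A * (1 - X))ᵀ * S * (A * (1 - X)) - (1 - X)ᵀ * S * (1 - X) := by
      generalize 1 - X = B
      simp only [Matrix.transpose_mul, Matrix.mul_sub, Matrix.sub_mul, Matrix.mul_assoc]
    rw [e1, hA]
    have e2 : (1 + X)ᵀ * S * (1 + X) - (1 - X)ᵀ * S * (1 - X) =
        (2 : ℝ) • (Xᵀ * S + S * X) := by
      simp only [Matrix.transpose_add, Matrix.transpose_sub, Matrix.transpose_one, Matrix.mul_add,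
        Matrix.add_mul, Matrix.mul_sub, Matrix.sub_mul, Matrix.one_mul, Matrix.mul_one, two_smul]
      abel
    rw [e2, h1, smul_zero]
  le := fun X hX => hX.1
  conj_mem := fun g hg X hX => skew_conj_mem hg.1 hX

end Stabilizers

/-! ## The algebra of `SO(n+1,n)` -/

section AlgebraG

variable {n : ℕ}

/-- The involution of the coordinates with `form n a b = 1` for `a = dual b`. -/
def dual : Idx n → Idx n
  | Sum.inl i => Sum.inr (Sum.inr i)
  | Sum.inr (Sum.inl u) => Sum.inr (Sum.inl u)
  | Sum.inr (Sum.inr i) => Sum.inl i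

@[simp] lemma dual_dual (a : Idx n) : dual (dual a) = a := by
  rcases a with i | u | i <;> rfl

lemma form_apply (a b : Idx n) : form n a b = if a = dual b then 1 else 0 := by
  rcases a with i | u | i <;> rcases b with j | w | j <;> simp [form, dual]

lemma mul_form_apply (A : Matrix (Idx n) (Idx n) ℝ) (a b : Idx n) :
    (A * form n) a b = A a (dual b) := by
  simp [Matrix.mul_apply, form_apply]

lemma form_mul_apply (A : Matrix (Idx n) (Idx n) ℝ) (a b : Idx n) :
    (form n * A) a b = A (dual a) b := by
  have : ∀ k, form n a k = if k = dual a then 1 else 0 := fun k => by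
    rw [form_apply]
    refine if_congr ⟨fun h => by rw [h, dual_dual], fun h => by rw [h, dual_dual]⟩ rfl rfl
  simp [Matrix.mul_apply, this]

lemma form_mul_form : form n * form n = 1 := by
  ext a b
  rw [mul_form_apply, form_apply, dual_dual, Matrix.one_apply]

lemma isUnit_det_form : IsUnit (form n).det :=
  isUnit_det_of_mul_eq_smul_one one_ne_zero (B := form n) (by rw [one_smul, form_mul_form])

lemma mem_lieG_iff {X : Matrix (Idx n) (Idx n) ℝ} :
    X ∈ lieG n ↔ ∀ a b, X (dual b) a = - X (dual a) b := by
  unfold lieG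
  rw [mem_skew_iff, ← Matrix.ext_iff]
  refine forall_congr' fun a => forall_congr' fun b => ?_
  rw [Matrix.add_apply, mul_form_apply, form_mul_apply, Matrix.transpose_apply,
    Matrix.zero_apply, eq_neg_iff_add_eq_zero]

/-- The Lie algebra of `P n`. -/
def lieP (n : ℕ) : Submodule ℝ (Matrix (Idx n) (Idx n) ℝ) := lieStab (form n) (plane n)

lemma parabolicPair (n : ℕ) : IsParabolicPair (lieG n) (lieP n) (P n) :=
  isParabolicPair_lieStab isUnit_det_form _

/-- The indices of the coordinates `x`. -/
abbrev ix (i : Fin n) : Idx n := Sum.inl i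

/-- The index of the coordinate `t`. -/
abbrev it : Idx n := Sum.inr (Sum.inl ())

/-- The indices of the coordinates `y`. -/
abbrev iy (i : Fin n) : Idx n := Sum.inr (Sum.inr i)

lemma single_mem_plane (j : Fin n) : (Pi.single (ix j) 1 : Idx n → ℝ) ∈ plane n := by
  intro b; simp

lemma mem_lieP_iff {X : Matrix (Idx n) (Idx n) ℝ} :
    X ∈ lieP n ↔ X ∈ lieG n ∧ ∀ b j, X (Sum.inr b) (ix j) = 0 := by
  refine and_congr_right fun _ => ⟨fun h b j => ?_, fun h w hw b => ?_⟩
  · have := h _ (single_mem_plane j) b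
    simpa using this
  · have hw' : ∀ b, w (Sum.inr b) = 0 := hw
    simp only [Matrix.mulVec, dotProduct, Fintype.sum_sum_type, h, zero_mul, Finset.sum_const_zero,
      hw', mul_zero, add_zero]

lemma stab_apply {g : (Matrix (Idx n) (Idx n) ℝ)ˣ} (hg : g ∈ stab (plane n)) (b : Unit ⊕ Fin n)
    (j : Fin n) : g.val (Sum.inr b) (ix j) = 0 := by
  have := (hg _).2 (single_mem_plane j) b
  simpa using this

lemma SO_apply {g : (Matrix (Idx n) (Idx n) ℝ)ˣ} (hg : g ∈ G n) (a b : Idx n) :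
    ∑ k, g.val (dual k) a * g.val k b = form n a b := by
  have h := congrFun (congrFun hg.1 a) b
  rw [Matrix.mul_apply] at h
  rw [← h]
  refine Finset.sum_congr rfl fun k _ => ?_
  rw [mul_form_apply, Matrix.transpose_apply]

lemma P_block_mul {g : (Matrix (Idx n) (Idx n) ℝ)ˣ} (hg : g ∈ P n) :
    (Matrix.of fun i j => g.val (ix i) (ix j))ᵀ * (Matrix.of fun i j => g.val (iy i) (iy j)) =
      (1 : Matrix (Fin n) (Fin n) ℝ) := by
  ext j k
  have h := SO_apply hg.1 (ix j) (iy k)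
  simp only [Fintype.sum_sum_type, dual, stab_apply hg.2, zero_mul, Finset.sum_const_zero, zero_add]
    at h
  simpa [Matrix.mul_apply, Matrix.one_apply, form, eq_comm] using h

/-- The image of the t-vector is orthogonal to the images of the x-vectors, which span the plane:
the invertible matrix aᵀ, with a the x-x block, annihilates the column of these entries. -/
lemma P_apply_yt {g : (Matrix (Idx n) (Idx n) ℝ)ˣ} (hg : g ∈ P n) (i : Fin n) :
    g.val (iy i) it = 0 := by
  have h1 : (Matrix.of fun i j => g.val (ix i) (ix j))ᵀ *ᵥ (fun i => g.val (iy i) it) = 0 := by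
    funext j
    have h := SO_apply hg.1 (ix j) it
    simp only [Fintype.sum_sum_type, dual, stab_apply hg.2, zero_mul, Finset.sum_const_zero,
      zero_add] at h
    simpa [Matrix.mulVec, dotProduct, form] using h
  have h2 := mul_eq_one_comm.1 (P_block_mul hg)
  have h3 := congrArg (fun w => (Matrix.of fun i j => g.val (iy i) (iy j)) *ᵥ w) h1
  simp only [Matrix.mulVec_mulVec, h2, Matrix.one_mulVec, Matrix.mulVec_zero] at h3
  exact congrFun h3 i

/-- The matrix is block triangular, and the determinants of its x-x and y-y blocks are inverse to
each other, so the t-t entry equals the total determinant 1. An entry -1 would prevent diag(g, 1)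
from preserving `planeHat`; this is where the special orthogonal group matters. -/
lemma P_apply_tt {g : (Matrix (Idx n) (Idx n) ℝ)ˣ} (hg : g ∈ P n) : g.val it it = 1 := by
  set A : Matrix (Idx n) (Idx n) ℝ := g.val with hA
  have h1 : A = Matrix.fromBlocks A.toBlocks₁₁ A.toBlocks₁₂ 0
      (Matrix.fromBlocks A.toBlocks₂₂.toBlocks₁₁ A.toBlocks₂₂.toBlocks₁₂ 0
        A.toBlocks₂₂.toBlocks₂₂) := by
    conv_lhs => rw [← Matrix.fromBlocks_toBlocks A, ← Matrix.fromBlocks_toBlocks A.toBlocks₂₂]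
    congr 1
    · ext b j; exact stab_apply hg.2 b j
    · congr 1
      ext i j; exact P_apply_yt hg i
  have h2 : A.det = 1 := hg.1.2
  have h3 := congrArg Matrix.det (P_block_mul hg)
  rw [Matrix.det_mul, Matrix.det_transpose, Matrix.det_one] at h3
  rw [h1, Matrix.det_fromBlocks_zero₂₁, Matrix.det_fromBlocks_zero₂₁,
    Matrix.det_unique A.toBlocks₂₂.toBlocks₁₁] at h2
  have h4 : A.toBlocks₁₁.det * A.toBlocks₂₂.toBlocks₂₂.det = 1 := h3
  have h5 : A.toBlocks₁₁.det * (A it it * A.toBlocks₂₂.toBlocks₂₂.det) = 1 := h2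
  calc A it it = A it it * 1 := (mul_one _).symm
    _ = A it it * (A.toBlocks₁₁.det * A.toBlocks₂₂.toBlocks₂₂.det) := by rw [h4]
    _ = A.toBlocks₁₁.det * (A it it * A.toBlocks₂₂.toBlocks₂₂.det) := by ring
    _ = 1 := h5

lemma mem_filt_iff {X : Matrix (Idx n) (Idx n) ℝ} :
    X ∈ filt n (-1) ↔ X ∈ lieG n ∧ ∀ i j, X (iy i) (ix j) = 0 := by
  refine and_congr_right fun _ => ⟨fun h i j => h _ _ (by simp [weight]), fun h a b hab => ?_⟩
  rcases a with i | u | i <;> rcases b with j | w | j <;> simp [weight] at hab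
  exact h i j

/-- The subspace `𝔤₍₋₁₎` of `𝔤`. -/
def filtNegOne (n : ℕ) : Submodule ℝ (Matrix (Idx n) (Idx n) ℝ) where
  carrier := filt n (-1)
  add_mem' := by
    intro X Y hX hY
    rw [mem_filt_iff] at *
    exact ⟨add_mem hX.1 hY.1, fun i j => by rw [Matrix.add_apply, hX.2, hY.2, add_zero]⟩
  zero_mem' := mem_filt_iff.2 ⟨zero_mem _, fun _ _ => rfl⟩
  smul_mem' := by
    intro r X hX
    rw [mem_filt_iff] at *
    exact ⟨Submodule.smul_mem _ r hX.1, fun i j => by rw [Matrix.smul_apply, hX.2, smul_zero]⟩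

lemma mem_filtNegOne {X : Matrix (Idx n) (Idx n) ℝ} :
    X ∈ filtNegOne n ↔ X ∈ lieG n ∧ ∀ i j, X (iy i) (ix j) = 0 := mem_filt_iff

lemma lieP_le_filtNegOne : lieP n ≤ filtNegOne n := fun X hX =>
  mem_filtNegOne.2 ⟨hX.1, fun i j => (mem_lieP_iff.1 hX).2 _ j⟩

/-- Invariance of 𝔤₍₋₁₎ under `P` is what makes the underlying distribution independent of the point
chosen in a fibre. -/
lemma filtNegOne_conj {g : (Matrix (Idx n) (Idx n) ℝ)ˣ} (hg : g ∈ P n)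
    {X : Matrix (Idx n) (Idx n) ℝ} (hX : X ∈ filtNegOne n) :
    (g⁻¹).val * X * g.val ∈ filtNegOne n := by
  rw [mem_filtNegOne] at hX ⊢
  refine ⟨skew_conj_mem hg.1 hX.1, fun i j => ?_⟩
  have hg' := (P n).inv_mem hg
  simp only [Matrix.mul_apply, Fintype.sum_sum_type, stab_apply hg.2, stab_apply hg'.2,
    P_apply_yt hg', hX.2, zero_mul, mul_zero, Finset.sum_const_zero, add_zero, Finset.univ_unique]

lemma lieG_yt {X : Matrix (Idx n) (Idx n) ℝ} (hX : X ∈ lieG n) (i : Fin n) :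
    X (iy i) it = -X it (ix i) := by
  have := mem_lieG_iff.1 hX it (ix i)
  simpa [dual] using this

/-- As the y-x blocks vanish, a product has a y-x entry only through the index t, and skewness
expresses y-t entries by t-x entries. The result is the matrix of the wedge product of the two
t-rows. -/
lemma commutator_apply {X Y : Matrix (Idx n) (Idx n) ℝ} (hX : X ∈ filtNegOne n)
    (hY : Y ∈ filtNegOne n) (i j : Fin n) : (X * Y - Y * X) (iy i) (ix j) =
      Y it (ix i) * X it (ix j) - X it (ix i) * Y it (ix j) := by
  rw [mem_filtNegOne] at hX hY
  simp only [Matrix.sub_apply, Matrix.mul_apply, Fintype.sum_sum_type, hX.2, hY.2, zero_mul,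
    mul_zero, Finset.sum_const_zero, add_zero, zero_add, Finset.univ_unique, Finset.sum_singleton]
  change X (iy i) it * Y it (ix j) - Y (iy i) it * X it (ix j) = _
  rw [lieG_yt hX.1, lieG_yt hY.1]
  ring

/-- The element of `𝔤` with prescribed components in `𝔤 / 𝔭`. -/
def negPart (β : Fin n → ℝ) (A : Matrix (Fin n) (Fin n) ℝ) : Matrix (Idx n) (Idx n) ℝ :=
  Matrix.of fun a b => match a, b with
    | Sum.inr (Sum.inl _), Sum.inl j => β j
    | Sum.inr (Sum.inr i), Sum.inr (Sum.inl _) => -β i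
    | Sum.inr (Sum.inr i), Sum.inl j => A i j
    | _, _ => 0

lemma negPart_mem (β : Fin n → ℝ) {A : Matrix (Fin n) (Fin n) ℝ} (hA : ∀ i j, A i j = -A j i) :
    negPart β A ∈ lieG n := by
  rw [mem_lieG_iff]
  intro a b
  rcases a with i | u | i <;> rcases b with j | w | j <;> simp [negPart, dual]
  exact hA j i

end AlgebraG

/-! ## The algebra of `SO(n+1,n+1)` -/

section AlgebraHat

variable {n : ℕ}

lemma formHat_mul_formHat : formHat n * formHat n = 1 := by
  rw [formHat, Matrix.fromBlocks_multiply, form_mul_form]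
  simp [Matrix.fromBlocks_one]

lemma isUnit_det_formHat : IsUnit (formHat n).det :=
  isUnit_det_of_mul_eq_smul_one one_ne_zero (B := formHat n) (by rw [one_smul, formHat_mul_formHat])

/-- The Lie algebra of `PHat n`. -/
def liePHat (n : ℕ) : Submodule ℝ (Matrix (IdxHat n) (IdxHat n) ℝ) :=
  lieStab (formHat n) (planeHat n)

lemma parabolicPairHat (n : ℕ) : IsParabolicPair (lieGHat n) (liePHat n) (PHat n) :=
  isParabolicPair_lieStab isUnit_det_formHat _

lemma sqLen_mulVec {g : (Matrix (IdxHat n) (IdxHat n) ℝ)ˣ} (hg : g ∈ GHat n) (w : IdxHat n → ℝ) :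
    sqLen (g.val *ᵥ w) = sqLen w := by
  have h : (g.val)ᵀ * formHat n * g.val = formHat n := hg.1
  unfold sqLen
  rw [Matrix.mulVec_mulVec, Matrix.dotProduct_mulVec, Matrix.vecMul_mulVec, ← Matrix.mul_assoc,
    ← Matrix.dotProduct_mulVec, h]

lemma sqLen_eq (w : IdxHat n → ℝ) : sqLen w =
    2 * ∑ i, w (Sum.inl (ix i)) * w (Sum.inl (iy i)) + w (Sum.inl it) ^ 2 - w (Sum.inr ()) ^ 2 := by
  simp [sqLen, formHat, form, dotProduct, Matrix.mulVec, Fintype.sum_sum_type]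
  rw [show ∑ i, w (Sum.inl (iy i)) * w (Sum.inl (ix i)) =
    ∑ i, w (Sum.inl (ix i)) * w (Sum.inl (iy i)) from Finset.sum_congr rfl fun i _ => mul_comm _ _]
  ring

lemma simMat_mul_inv (c : ℝˣ) : simMat n c * simMat n (c⁻¹ : ℝˣ) = 1 := (sim n c).val_inv

lemma simMat_inv_mul (c : ℝˣ) : simMat n (c⁻¹ : ℝˣ) * simMat n c = 1 := (sim n c).inv_val

lemma vec_apply (c : ℝˣ) : vec n c = Sum.elim (fun a => if a = it then (1 - c : ℝ) / 2 else 0)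
    (fun _ => (1 + c : ℝ) / 2) := by
  funext a
  rcases a with (i | u | i) | u <;> simp [vec, simMat]

lemma sqLen_vec (c : ℝˣ) : sqLen (vec n c) = -c := by
  rw [sqLen_eq, vec_apply]
  simp
  ring

/-- On the plane y = 0 and t - r = 0, and these are the only coordinates that the map rescales. -/
lemma simMat_mulVec_of_mem (c : ℝ) {w : IdxHat n → ℝ} (hw : w ∈ planeHat n) :
    simMat n c *ᵥ w = w := by
  obtain ⟨h1, h2⟩ := hw
  funext a
  rcases a with (i | u | i) | u <;>
    simp [simMat, Matrix.mulVec, dotProduct, Fintype.sum_sum_type, Matrix.diagonal_apply, h1, h2]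
  all_goals ring

lemma simMat_mulVec_mem_iff (c : ℝˣ) {w : IdxHat n → ℝ} :
    simMat n c *ᵥ w ∈ planeHat n ↔ w ∈ planeHat n := by
  refine ⟨fun h => ?_, fun h => by rwa [simMat_mulVec_of_mem _ h]⟩
  have := simMat_mulVec_of_mem (c⁻¹ : ℝˣ) h
  rw [Matrix.mulVec_mulVec, simMat_inv_mul, Matrix.one_mulVec] at this
  rwa [this]

lemma simMat_conj_SO (c : ℝˣ) {A : Matrix (IdxHat n) (IdxHat n) ℝ}
    (hA : Aᵀ * formHat n * A = formHat n) :
    (simMat n c * A * simMat n (c⁻¹ : ℝˣ))ᵀ * formHat n *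
      (simMat n c * A * simMat n (c⁻¹ : ℝˣ)) = formHat n := by
  calc _ = (simMat n (c⁻¹ : ℝˣ))ᵀ * (Aᵀ * ((simMat n c)ᵀ * formHat n * simMat n c) * A) *
        simMat n (c⁻¹ : ℝˣ) := by simp only [Matrix.transpose_mul, Matrix.mul_assoc]
    _ = (c : ℝ) • ((simMat n (c⁻¹ : ℝˣ))ᵀ * formHat n * simMat n (c⁻¹ : ℝˣ)) := by
        rw [simMat_form]; simp only [Matrix.mul_smul, Matrix.smul_mul, hA]
    _ = _ := by rw [simMat_form, smul_smul, Units.mul_inv, one_smul]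

lemma simMat_conj_skew (c : ℝˣ) {X : Matrix (IdxHat n) (IdxHat n) ℝ} (hX : X ∈ lieGHat n) :
    simMat n c * X * simMat n (c⁻¹ : ℝˣ) ∈ lieGHat n := by
  unfold lieGHat at *
  rw [mem_skew_iff] at *
  have hu : IsUnit (simMat n c).det := isUnit_det_of_mul_eq_smul_one one_ne_zero
    (B := simMat n (c⁻¹ : ℝˣ)) (by rw [one_smul, simMat_mul_inv])
  refine eq_zero_of_congr hu ?_
  have h1 : simMat n c * X * simMat n (c⁻¹ : ℝˣ) * simMat n c = simMat n c * X := by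
    rw [Matrix.mul_assoc _ _ (simMat n c), simMat_inv_mul, Matrix.mul_one]
  calc _ = (simMat n c * X * simMat n (c⁻¹ : ℝˣ) * simMat n c)ᵀ * formHat n * simMat n c +
        (simMat n c)ᵀ * formHat n * (simMat n c * X * simMat n (c⁻¹ : ℝˣ) * simMat n c) := by
        generalize simMat n c * X * simMat n (c⁻¹ : ℝˣ) = Y
        simp only [Matrix.transpose_mul, Matrix.mul_add, Matrix.add_mul, Matrix.mul_assoc]
    _ = Xᵀ * ((simMat n c)ᵀ * formHat n * simMat n c) +
        ((simMat n c)ᵀ * formHat n * simMat n c) * X := by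
        rw [h1]; simp only [Matrix.transpose_mul, Matrix.mul_assoc]
    _ = 0 := by rw [simMat_form, Matrix.mul_smul, Matrix.smul_mul, ← smul_add, hX, smul_zero]

lemma simMat_conj_liePHat (c : ℝˣ) {X : Matrix (IdxHat n) (IdxHat n) ℝ} (hX : X ∈ liePHat n) :
    simMat n c * X * simMat n (c⁻¹ : ℝˣ) ∈ liePHat n := by
  refine ⟨simMat_conj_skew c hX.1, fun w hw => ?_⟩
  rw [← Matrix.mulVec_mulVec, simMat_mulVec_of_mem _ hw, ← Matrix.mulVec_mulVec,
    simMat_mulVec_mem_iff]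
  exact hX.2 w hw

/-- The inverse of `dincl` and of `incl`, on the matrices in their images. -/
def restr (c : ℝˣ) (Y : Matrix (IdxHat n) (IdxHat n) ℝ) : Matrix (Idx n) (Idx n) ℝ :=
  (simMat n (c⁻¹ : ℝˣ) * Y * simMat n c).toBlocks₁₁

lemma simMat_conj_conj (c : ℝˣ) (A : Matrix (IdxHat n) (IdxHat n) ℝ) :
    simMat n (c⁻¹ : ℝˣ) * (simMat n c * A * simMat n (c⁻¹ : ℝˣ)) * simMat n c = A := by
  calc _ = (simMat n (c⁻¹ : ℝˣ) * simMat n c) * A * (simMat n (c⁻¹ : ℝˣ) * simMat n c) := by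
        simp only [Matrix.mul_assoc]
    _ = A := by rw [simMat_inv_mul, Matrix.one_mul, Matrix.mul_one]

lemma simMat_conj_conj' (c : ℝˣ) (A : Matrix (IdxHat n) (IdxHat n) ℝ) :
    simMat n c * (simMat n (c⁻¹ : ℝˣ) * A * simMat n c) * simMat n (c⁻¹ : ℝˣ) = A := by
  simpa using simMat_conj_conj c⁻¹ A

lemma inclGL_val (c : ℝˣ) (g : (Matrix (Idx n) (Idx n) ℝ)ˣ) : (inclGL n c g).val =
    simMat n c * Matrix.fromBlocks g.val 0 0 1 * simMat n (c⁻¹ : ℝˣ) := rfl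

lemma restr_inclGL (c : ℝˣ) (g : (Matrix (Idx n) (Idx n) ℝ)ˣ) :
    restr c (inclGL n c g).val = g.val := by
  rw [restr, inclGL_val, simMat_conj_conj, Matrix.toBlocks_fromBlocks₁₁]

lemma restr_dincl (c : ℝˣ) (X : Matrix (Idx n) (Idx n) ℝ) : restr c (dincl n c X) = X := by
  rw [restr, dincl, simMat_conj_conj, Matrix.toBlocks_fromBlocks₁₁]

lemma inclGL_injective (c : ℝˣ) : Function.Injective (inclGL n c) := fun g h hgh =>
  Units.ext (by rw [← restr_inclGL c g, ← restr_inclGL c h, hgh])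

lemma dincl_conj (c : ℝˣ) (g : (Matrix (Idx n) (Idx n) ℝ)ˣ) (X : Matrix (Idx n) (Idx n) ℝ) :
    dincl n c ((g⁻¹).val * X * g.val) =
      ((inclGL n c g)⁻¹).val * dincl n c X * (inclGL n c g).val := by
  rw [← map_inv, inclGL_val, inclGL_val, dincl, dincl]
  have h : ∀ A B : Matrix (IdxHat n) (IdxHat n) ℝ, simMat n c * A * simMat n (c⁻¹ : ℝˣ) *
      (simMat n c * B * simMat n (c⁻¹ : ℝˣ)) = simMat n c * (A * B) * simMat n (c⁻¹ : ℝˣ) := by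
    intro A B
    calc _ = simMat n c * A * (simMat n (c⁻¹ : ℝˣ) * simMat n c) * B * simMat n (c⁻¹ : ℝˣ) := by
          simp only [Matrix.mul_assoc]
      _ = _ := by rw [simMat_inv_mul, Matrix.mul_one]; simp only [Matrix.mul_assoc]
  rw [h, h]
  simp [Matrix.fromBlocks_multiply]

lemma inclGL_vec (c : ℝˣ) (g : (Matrix (Idx n) (Idx n) ℝ)ˣ) :
    (inclGL n c g).val *ᵥ vec n c = vec n c := by
  rw [inclGL_val, vec, Matrix.mulVec_mulVec, Matrix.mul_assoc, Matrix.mul_assoc, simMat_inv_mul,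
    Matrix.mul_one, ← Matrix.mulVec_mulVec]
  congr 1
  funext a
  rcases a with a | a <;> simp

lemma dincl_vec (c : ℝˣ) (X : Matrix (Idx n) (Idx n) ℝ) : dincl n c X *ᵥ vec n c = 0 := by
  rw [dincl, vec, Matrix.mulVec_mulVec, Matrix.mul_assoc, Matrix.mul_assoc, simMat_inv_mul,
    Matrix.mul_one, ← Matrix.mulVec_mulVec]
  have : Matrix.fromBlocks X 0 0 (0 : Matrix Unit Unit ℝ) *ᵥ Pi.single (Sum.inr ()) 1 = 0 := by
    funext a
    rcases a with a | a <;> simp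
  rw [this, Matrix.mulVec_zero]

lemma dincl_mem (c : ℝˣ) {X : Matrix (Idx n) (Idx n) ℝ} (hX : X ∈ lieG n) :
    dincl n c X ∈ lieGHat n := by
  refine simMat_conj_skew c ?_
  unfold lieG at hX
  unfold lieGHat
  rw [mem_skew_iff] at *
  rw [formHat, Matrix.fromBlocks_transpose, Matrix.fromBlocks_multiply, Matrix.fromBlocks_multiply,
    Matrix.fromBlocks_add]
  simp [hX]

lemma formHat_mulVec_single :
    formHat n *ᵥ Pi.single (Sum.inr ()) 1 = -Pi.single (Sum.inr ()) 1 := by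
  funext a
  rcases a with a | a <;> simp [formHat]

/-- A matrix fixing the last coordinate vector up to a factor is a block matrix if it is orthogonal
or skew. -/
lemma eq_fromBlocks_of_mulVec {A : Matrix (IdxHat n) (IdxHat n) ℝ} {r : ℝ}
    (h1 : A *ᵥ Pi.single (Sum.inr ()) 1 = r • Pi.single (Sum.inr ()) 1)
    (h2 : Aᵀ *ᵥ Pi.single (Sum.inr ()) 1 = r • Pi.single (Sum.inr ()) 1) :
    A = Matrix.fromBlocks A.toBlocks₁₁ 0 0 (Matrix.diagonal fun _ => r) := by
  ext a b
  rcases a with a | a <;> rcases b with b | b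
  · rfl
  · simpa using congrFun h1 (Sum.inl a)
  · simpa using congrFun h2 (Sum.inl b)
  · simpa using congrFun h1 (Sum.inr a)

/-- Conjugation by `simMat n c` reduces to the last coordinate vector. An orthogonal matrix fixing
it also preserves its orthogonal complement, so it is diag(B, 1). -/
lemma exists_inclGL_eq (c : ℝˣ) {g : (Matrix (IdxHat n) (IdxHat n) ℝ)ˣ} (hg : g ∈ GHat n)
    (hv : g.val *ᵥ vec n c = vec n c) : ∃ k ∈ G n, inclGL n c k = g := by
  set A := simMat n (c⁻¹ : ℝˣ) * g.val * simMat n c with hA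
  have hgA : simMat n c * A * simMat n (c⁻¹ : ℝˣ) = g.val := simMat_conj_conj' c _
  have hAS : Aᵀ * formHat n * A = formHat n := by
    have := simMat_conj_SO c⁻¹ (A := g.val) hg.1
    rwa [inv_inv] at this
  have hA1 : A *ᵥ Pi.single (Sum.inr ()) 1 = Pi.single (Sum.inr ()) 1 := by
    have h := congrArg (fun w => simMat n (c⁻¹ : ℝˣ) *ᵥ w) hv
    simp only [vec, Matrix.mulVec_mulVec, simMat_inv_mul, Matrix.one_mulVec] at h
    rwa [hA, Matrix.mul_assoc]
  -- Apply AᵀŜA = Ŝ, with Ŝ the metric, to the last coordinate vector, which A fixes and which is an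
  -- eigenvector of Ŝ.
  have hA2 : Aᵀ *ᵥ Pi.single (Sum.inr ()) 1 = Pi.single (Sum.inr ()) 1 := by
    have h := congrArg (fun B => B *ᵥ Pi.single (Sum.inr ()) (1 : ℝ)) hAS
    simp only [← Matrix.mulVec_mulVec, hA1, formHat_mulVec_single, Matrix.mulVec_neg, neg_inj] at h
    exact h
  have hdet : A.det = 1 := by
    have h1 := congrArg Matrix.det (simMat_inv_mul (n := n) c)
    rw [Matrix.det_mul, Matrix.det_one] at h1
    have h2 : g.val.det = 1 := hg.2
    rw [hA, Matrix.det_mul, Matrix.det_mul, h2, mul_one, h1]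
  have hB := eq_fromBlocks_of_mulVec (r := 1) (by rw [one_smul]; exact hA1) (by rw [one_smul]; exact hA2)
  rw [Matrix.diagonal_one] at hB
  set B := A.toBlocks₁₁
  have hBdet : B.det = 1 := by
    rw [hB, Matrix.det_fromBlocks_zero₂₁, Matrix.det_one, mul_one] at hdet
    exact hdet
  refine ⟨Matrix.nonsingInvUnit B (by rw [hBdet]; exact isUnit_one), ⟨?_, hBdet⟩, Units.ext ?_⟩
  · change Bᵀ * form n * B = form n
    rw [hB, formHat, Matrix.fromBlocks_transpose, Matrix.fromBlocks_multiply,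
      Matrix.fromBlocks_multiply] at hAS
    have := (Matrix.fromBlocks_inj.1 hAS).1
    simpa using this
  · rw [inclGL_val, ← hgA, hB]
    rfl

lemma exists_dincl_eq (c : ℝˣ) {Y : Matrix (IdxHat n) (IdxHat n) ℝ} (hY : Y ∈ lieGHat n)
    (hv : Y *ᵥ vec n c = 0) : ∃ X ∈ lieG n, dincl n c X = Y := by
  set A := simMat n (c⁻¹ : ℝˣ) * Y * simMat n c with hA
  have hYA : simMat n c * A * simMat n (c⁻¹ : ℝˣ) = Y := simMat_conj_conj' c _
  have hAS : Aᵀ * formHat n + formHat n * A = 0 := by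
    have := simMat_conj_skew c⁻¹ hY
    unfold lieGHat at this
    rwa [mem_skew_iff, inv_inv] at this
  have hA1 : A *ᵥ Pi.single (Sum.inr ()) 1 = 0 := by
    have h := congrArg (fun w => simMat n (c⁻¹ : ℝˣ) *ᵥ w) hv
    simp only [vec, Matrix.mulVec_mulVec, Matrix.mulVec_zero] at h
    rwa [hA, Matrix.mul_assoc]
  have hA2 : Aᵀ *ᵥ Pi.single (Sum.inr ()) 1 = 0 := by
    have h := congrArg (fun B => B *ᵥ Pi.single (Sum.inr ()) (1 : ℝ)) hAS
    simp only [Matrix.add_mulVec, ← Matrix.mulVec_mulVec, hA1, formHat_mulVec_single,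
      Matrix.mulVec_neg, Matrix.mulVec_zero, add_zero, Matrix.zero_mulVec, neg_eq_zero] at h
    exact h
  have hB := eq_fromBlocks_of_mulVec (r := 0) (by rw [zero_smul]; exact hA1) (by rw [zero_smul]; exact hA2)
  rw [Matrix.diagonal_zero] at hB
  refine ⟨A.toBlocks₁₁, ?_, by rw [dincl, ← hB, hYA]⟩
  rw [hB, formHat, Matrix.fromBlocks_transpose, Matrix.fromBlocks_multiply,
    Matrix.fromBlocks_multiply, Matrix.fromBlocks_add, ← Matrix.fromBlocks_zero] at hAS
  unfold lieG
  rw [mem_skew_iff]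
  simpa using (Matrix.fromBlocks_inj.1 hAS).1

/-- Since `simMat` is the identity on `planeHat`, the question concerns diag(g, 1). If this
preserves the plane, its action on the vectors (x, 0, 0; 0), whose r-component stays 0, shows g ∈
`P`. Conversely (x, t, 0; t) is mapped into the plane because the y-t entries of g vanish and its
t-t entry is 1. -/
lemma inclGL_mem_iff (c : ℝˣ) {g : (Matrix (Idx n) (Idx n) ℝ)ˣ} (hg : g ∈ G n) :
    inclGL n c g ∈ PHat n ↔ g ∈ P n := by
  have key : ∀ w ∈ planeHat n, ((inclGL n c g).val *ᵥ w ∈ planeHat n ↔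
      Matrix.fromBlocks g.val 0 0 (1 : Matrix Unit Unit ℝ) *ᵥ w ∈ planeHat n) := by
    intro w hw
    rw [inclGL_val, ← Matrix.mulVec_mulVec, simMat_mulVec_of_mem _ hw, ← Matrix.mulVec_mulVec,
      simMat_mulVec_mem_iff]
  constructor
  · intro h
    refine ⟨hg, mem_stab_of_forall fun w hw b => ?_⟩
    have hw' : ∀ b, w (Sum.inr b) = 0 := hw
    have h0 : (Sum.elim w 0 : IdxHat n → ℝ) ∈ planeHat n :=
      ⟨fun i => hw' _, hw' _⟩
    obtain ⟨h1, h2⟩ := (key _ h0).1 ((h.2 _).2 h0)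
    simp only [Matrix.fromBlocks_mulVec] at h1 h2
    rcases b with u | i
    · simpa using h2
    · simpa using h1 i
  · intro h
    refine ⟨inclGL_mem n c g hg, mem_stab_of_forall fun w hw => (key w hw).2 ?_⟩
    obtain ⟨h1, h2⟩ := hw
    have hs := stab_apply h.2
    constructor
    · intro i
      simp [Matrix.mulVec, dotProduct, Fintype.sum_sum_type, hs, h1, P_apply_yt h]
    · simp [Matrix.mulVec, dotProduct, Fintype.sum_sum_type, hs, h1, P_apply_tt h, h2]

/-- The infinitesimal version of `inclGL_mem_iff`; now skewness makes the t-t entry 0. -/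
lemma dincl_mem_iff (c : ℝˣ) {X : Matrix (Idx n) (Idx n) ℝ} (hX : X ∈ lieG n) :
    dincl n c X ∈ liePHat n ↔ X ∈ lieP n := by
  have key : ∀ w ∈ planeHat n, (dincl n c X *ᵥ w ∈ planeHat n ↔
      Matrix.fromBlocks X 0 0 (0 : Matrix Unit Unit ℝ) *ᵥ w ∈ planeHat n) := by
    intro w hw
    rw [dincl, ← Matrix.mulVec_mulVec, simMat_mulVec_of_mem _ hw, ← Matrix.mulVec_mulVec,
      simMat_mulVec_mem_iff]
  constructor
  · intro h
    refine ⟨hX, fun w hw b => ?_⟩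
    have hw' : ∀ b, w (Sum.inr b) = 0 := hw
    have h0 : (Sum.elim w 0 : IdxHat n → ℝ) ∈ planeHat n :=
      ⟨fun i => hw' _, hw' _⟩
    obtain ⟨h1, h2⟩ := (key _ h0).1 (h.2 _ h0)
    simp only [Matrix.fromBlocks_mulVec] at h1 h2
    rcases b with u | i
    · simpa using h2
    · simpa using h1 i
  · intro h
    refine ⟨dincl_mem c hX, fun w hw => (key w hw).2 ?_⟩
    obtain ⟨h1, h2⟩ := hw
    have hs := (mem_lieP_iff.1 h).2
    have hyt : ∀ i, X (iy i) it = 0 := fun i => by rw [lieG_yt hX, hs, neg_zero]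
    have htt : X it it = 0 := by
      have := mem_lieG_iff.1 hX it it
      simp only [dual] at this
      linarith
    constructor
    · intro i
      simp [Matrix.mulVec, dotProduct, Fintype.sum_sum_type, hs, h1, hyt]
    · simp [Matrix.mulVec, dotProduct, Fintype.sum_sum_type, hs, h1, htt]

lemma dincl_sub (c : ℝˣ) (X Y : Matrix (Idx n) (Idx n) ℝ) :
    dincl n c (X - Y) = dincl n c X - dincl n c Y := by
  rw [dincl, dincl, dincl, ← Matrix.sub_mul, ← Matrix.mul_sub]
  congr 2
  ext a b
  rcases a with a | a <;> rcases b with b | b <;> simp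

/-- Modulo `planeHat` a vector is determined by its coordinates y and t - r. A skew matrix is
therefore determined modulo `liePHat` by how it maps the plane to these coordinates, and skewness
leaves only an alternating y-x block and a row, which a matrix from `lieG` can match. -/
lemma exists_sub_fromBlocks_mem {Y : Matrix (IdxHat n) (IdxHat n) ℝ} (hY : Y ∈ lieGHat n) :
    ∃ X ∈ lieG n, Y - Matrix.fromBlocks X 0 0 0 ∈ liePHat n := by
  have hY' := hY
  unfold lieGHat at hY'
  rw [mem_skew_iff] at hY'
  have e : ∀ a b, (Yᵀ * formHat n + formHat n * Y) a b = 0 := fun a b => by rw [hY']; rfl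
  have e1 : ∀ i j, Y (Sum.inl (iy i)) (Sum.inl (ix j)) = -Y (Sum.inl (iy j)) (Sum.inl (ix i)) := by
    intro i j
    have := e (Sum.inl (ix i)) (Sum.inl (ix j))
    simp [formHat, form, Matrix.mul_apply] at this
    linarith
  have e2 : ∀ i, Y (Sum.inl (iy i)) (Sum.inl it) = -Y (Sum.inl it) (Sum.inl (ix i)) := by
    intro i
    have := e (Sum.inl (ix i)) (Sum.inl it)
    simp [formHat, form, Matrix.mul_apply] at this
    linarith
  have e3 : ∀ i, Y (Sum.inl (iy i)) (Sum.inr ()) = Y (Sum.inr ()) (Sum.inl (ix i)) := by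
    intro i
    have := e (Sum.inl (ix i)) (Sum.inr ())
    simp [formHat, form, Matrix.mul_apply] at this
    linarith
  have e4 : Y (Sum.inl it) (Sum.inl it) = 0 := by
    have := e (Sum.inl it) (Sum.inl it)
    simp [formHat, form, Matrix.mul_apply] at this
    linarith
  have e5 : Y (Sum.inr ()) (Sum.inr ()) = 0 := by
    have := e (Sum.inr ()) (Sum.inr ())
    simp [formHat, form, Matrix.mul_apply] at this
    linarith
  have e6 : Y (Sum.inl it) (Sum.inr ()) = Y (Sum.inr ()) (Sum.inl it) := by
    have := e (Sum.inl it) (Sum.inr ())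
    simp [formHat, form, Matrix.mul_apply] at this
    linarith
  -- The r-row of diag(X, 0) vanishes, so its t-row has to account for the whole t - r component.
  have hX := negPart_mem (fun i => Y (Sum.inl it) (Sum.inl (ix i)) - Y (Sum.inr ()) (Sum.inl (ix i)))
    (A := Matrix.of fun i j => Y (Sum.inl (iy i)) (Sum.inl (ix j))) e1
  refine ⟨_, hX, sub_mem hY ?_, fun w hw => ?_⟩
  · have := dincl_mem 1 hX
    rwa [dincl, inv_one, Units.val_one, simMat_one, Matrix.one_mul, Matrix.mul_one] at this
  · obtain ⟨h1, h2⟩ := hw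
    rw [Matrix.sub_mulVec]
    constructor
    · intro i
      simp [Matrix.mulVec, dotProduct, Fintype.sum_sum_type, h1, h2, negPart, e2, e3]
      ring
    · simp [Matrix.mulVec, dotProduct, Fintype.sum_sum_type, h1, h2, negPart, e4, e5, e6, sub_mul]
      ring

lemma exists_sub_dincl_mem (c : ℝˣ) {Y : Matrix (IdxHat n) (IdxHat n) ℝ} (hY : Y ∈ lieGHat n) :
    ∃ X ∈ lieG n, Y - dincl n c X ∈ liePHat n := by
  have hA : simMat n (c⁻¹ : ℝˣ) * Y * simMat n c ∈ lieGHat n := by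
    simpa using simMat_conj_skew c⁻¹ hY
  obtain ⟨X, hX, h⟩ := exists_sub_fromBlocks_mem hA
  refine ⟨X, hX, ?_⟩
  have h2 := simMat_conj_liePHat c h
  rwa [Matrix.mul_sub, Matrix.sub_mul, simMat_conj_conj'] at h2

/-! ## Transitivity of `PHat` on vectors of given square length -/

/-- Matrices preserving the decomposition of `ℝ^(n+1,n+1)` into two isotropic planes. -/
abbrev diagBlocks (a d : Matrix (Fin n ⊕ Unit) (Fin n ⊕ Unit) ℝ) :
    Matrix ((Fin n ⊕ Unit) ⊕ (Fin n ⊕ Unit)) ((Fin n ⊕ Unit) ⊕ (Fin n ⊕ Unit)) ℝ :=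
  Matrix.fromBlocks a 0 0 d

/-- The metric `2 p·q`. -/
abbrev formBlocks (n : ℕ) :
    Matrix ((Fin n ⊕ Unit) ⊕ (Fin n ⊕ Unit)) ((Fin n ⊕ Unit) ⊕ (Fin n ⊕ Unit)) ℝ :=
  Matrix.fromBlocks 0 1 1 0

/-- The coordinates `p = (x, t + r)` and `q = (y, (t - r) / 2)`, in which `planeHat` is `q = 0` and
the metric is `2 p·q`. -/
def toAdapted (n : ℕ) : Matrix ((Fin n ⊕ Unit) ⊕ (Fin n ⊕ Unit)) (IdxHat n) ℝ :=
  Matrix.of fun a b => match a, b with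
    | Sum.inl (Sum.inl i), Sum.inl (Sum.inl j) => if i = j then 1 else 0
    | Sum.inl (Sum.inr _), Sum.inl (Sum.inr (Sum.inl _)) => 1
    | Sum.inl (Sum.inr _), Sum.inr _ => 1
    | Sum.inr (Sum.inl i), Sum.inl (Sum.inr (Sum.inr j)) => if i = j then 1 else 0
    | Sum.inr (Sum.inr _), Sum.inl (Sum.inr (Sum.inl _)) => 1 / 2
    | Sum.inr (Sum.inr _), Sum.inr _ => -1 / 2
    | _, _ => 0

/-- The inverse of `toAdapted`. -/
def ofAdapted (n : ℕ) : Matrix (IdxHat n) ((Fin n ⊕ Unit) ⊕ (Fin n ⊕ Unit)) ℝ :=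
  Matrix.of fun b a => match a, b with
    | Sum.inl (Sum.inl i), Sum.inl (Sum.inl j) => if i = j then 1 else 0
    | Sum.inl (Sum.inr _), Sum.inl (Sum.inr (Sum.inl _)) => 1 / 2
    | Sum.inl (Sum.inr _), Sum.inr _ => 1 / 2
    | Sum.inr (Sum.inl i), Sum.inl (Sum.inr (Sum.inr j)) => if i = j then 1 else 0
    | Sum.inr (Sum.inr _), Sum.inl (Sum.inr (Sum.inl _)) => 1
    | Sum.inr (Sum.inr _), Sum.inr _ => -1
    | _, _ => 0

lemma toAdapted_mul_ofAdapted : toAdapted n * ofAdapted n = 1 := by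
  ext a b
  rcases a with (i | u) | (i | u) <;> rcases b with (j | w) | (j | w) <;>
    simp [toAdapted, ofAdapted, Matrix.mul_apply, Matrix.one_apply, eq_comm]
  all_goals norm_num

lemma ofAdapted_mul_toAdapted : ofAdapted n * toAdapted n = 1 := by
  ext a b
  rcases a with (i | u | i) | u <;> rcases b with (j | w | j) | w <;>
    simp [toAdapted, ofAdapted, Matrix.mul_apply, Matrix.one_apply, eq_comm]
  all_goals norm_num

lemma formHat_eq_adapted : formHat n =
    (toAdapted n)ᵀ * formBlocks n * toAdapted n := by
  rw [Matrix.mul_assoc]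
  ext a b
  rcases a with (i | u | i) | u <;> rcases b with (j | w | j) | w <;>
    simp [toAdapted, formHat, form, Matrix.mul_apply, Matrix.fromBlocks, Matrix.one_apply]
  all_goals norm_num [eq_comm]

lemma mem_planeHat_iff (w : IdxHat n → ℝ) :
    w ∈ planeHat n ↔ ∀ i, (toAdapted n *ᵥ w) (Sum.inr i) = 0 := by
  have h1 : ∀ i, (toAdapted n *ᵥ w) (Sum.inr (Sum.inl i)) = w (Sum.inl (iy i)) := fun i => by
    simp [toAdapted, Matrix.mulVec, dotProduct]
  have h2 : (toAdapted n *ᵥ w) (Sum.inr (Sum.inr ())) =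
      (w (Sum.inl it) - w (Sum.inr ())) / 2 := by
    simp [toAdapted, Matrix.mulVec, dotProduct]
    ring
  constructor
  · rintro ⟨h3, h4⟩ (i | u)
    · rw [h1]; exact h3 i
    · rw [h2, h4, sub_self, zero_div]
  · intro h
    refine ⟨fun i => by rw [← h1]; exact h _, ?_⟩
    have := h2.symm.trans (h _)
    linarith

/-- The value of `levi`. -/
def leviMat (a : Matrix (Fin n ⊕ Unit) (Fin n ⊕ Unit) ℝ) : Matrix (IdxHat n) (IdxHat n) ℝ :=
  ofAdapted n * diagBlocks a (a⁻¹)ᵀ * toAdapted n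

lemma leviMat_det {a : Matrix (Fin n ⊕ Unit) (Fin n ⊕ Unit) ℝ} (ha : IsUnit a.det) :
    (leviMat a).det = 1 := by
  rw [leviMat, Matrix.det_conj_of_mul_eq_one ofAdapted_mul_toAdapted toAdapted_mul_ofAdapted,
    Matrix.det_fromBlocks_zero₂₁, Matrix.det_transpose, ← Matrix.det_mul, Matrix.mul_nonsing_inv _ ha,
    Matrix.det_one]

lemma toAdapted_mul_leviMat (a : Matrix (Fin n ⊕ Unit) (Fin n ⊕ Unit) ℝ) :
    toAdapted n * leviMat a = diagBlocks a (a⁻¹)ᵀ * toAdapted n := by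
  rw [leviMat, ← Matrix.mul_assoc, ← Matrix.mul_assoc, toAdapted_mul_ofAdapted, Matrix.one_mul]

/-- The element of `PHat` acting by `a` on `planeHat`. -/
def levi {a : Matrix (Fin n ⊕ Unit) (Fin n ⊕ Unit) ℝ} (ha : IsUnit a.det) : PHat n :=
  ⟨Matrix.nonsingInvUnit (leviMat a) (by rw [leviMat_det ha]; exact isUnit_one), by
    refine ⟨⟨?_, leviMat_det ha⟩, mem_stab_of_forall fun w hw => ?_⟩
    · change (leviMat a)ᵀ * formHat n * leviMat a = formHat n
      have h1 : (toAdapted n * leviMat a)ᵀ * formBlocks n * (toAdapted n * leviMat a) =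
          formHat n := by
        rw [toAdapted_mul_leviMat, formHat_eq_adapted, Matrix.transpose_mul]
        have h2 : (diagBlocks a (a⁻¹)ᵀ)ᵀ * formBlocks n *
            diagBlocks a (a⁻¹)ᵀ = formBlocks n := by
          have h3 : aᵀ * (a⁻¹)ᵀ = 1 := by
            rw [← Matrix.transpose_mul, Matrix.nonsing_inv_mul _ ha, Matrix.transpose_one]
          simp [Matrix.fromBlocks_transpose, Matrix.fromBlocks_multiply, h3,
            Matrix.nonsing_inv_mul _ ha]
        calc _ = (toAdapted n)ᵀ * ((diagBlocks a (a⁻¹)ᵀ)ᵀ * formBlocks n *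
            diagBlocks a (a⁻¹)ᵀ) * toAdapted n := by simp only [Matrix.mul_assoc]
          _ = _ := by rw [h2]
      refine Eq.trans ?_ h1
      rw [formHat_eq_adapted]
      simp only [Matrix.transpose_mul, Matrix.mul_assoc]
    · rw [mem_planeHat_iff] at hw ⊢
      intro i
      change (toAdapted n *ᵥ (leviMat a *ᵥ w)) _ = 0
      rw [Matrix.mulVec_mulVec, toAdapted_mul_leviMat, ← Matrix.mulVec_mulVec,
        Matrix.fromBlocks_mulVec]
      have : (toAdapted n *ᵥ w) ∘ Sum.inr = 0 := funext hw
      simp [this]⟩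

lemma levi_val {a : Matrix (Fin n ⊕ Unit) (Fin n ⊕ Unit) ℝ} (ha : IsUnit a.det) :
    (levi ha).1.val = leviMat a := rfl

lemma leviMat_smooth {E : Type*} [NormedAddCommGroup E] [NormedSpace ℝ E]
    {a : E → Matrix (Fin n ⊕ Unit) (Fin n ⊕ Unit) ℝ} {v : E} (h : MSmoothAt 𝓘(ℝ, E) a v)
    (ha : IsUnit (a v).det) : MSmoothAt 𝓘(ℝ, E) (fun v => leviMat (a v)) v := by
  let L₁ : Matrix (Fin n ⊕ Unit) (Fin n ⊕ Unit) ℝ →ₗ[ℝ] Matrix (IdxHat n) (IdxHat n) ℝ :=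
    { toFun := fun a => ofAdapted n * diagBlocks a 0 * toAdapted n
      map_add' := fun a b => by
        rw [← Matrix.add_mul, ← Matrix.mul_add, Matrix.fromBlocks_add]; simp
      map_smul' := fun r a => by
        rw [RingHom.id_apply, ← Matrix.smul_mul, ← Matrix.mul_smul, Matrix.fromBlocks_smul]; simp }
  let L₂ : Matrix (Fin n ⊕ Unit) (Fin n ⊕ Unit) ℝ →ₗ[ℝ] Matrix (IdxHat n) (IdxHat n) ℝ :=
    { toFun := fun a => ofAdapted n * diagBlocks 0 aᵀ * toAdapted n
      map_add' := fun a b => by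
        rw [← Matrix.add_mul, ← Matrix.mul_add, Matrix.fromBlocks_add]; simp
      map_smul' := fun r a => by
        rw [RingHom.id_apply, ← Matrix.smul_mul, ← Matrix.mul_smul, Matrix.fromBlocks_smul]; simp }
  refine ((h.mlinear L₁).add ((h.inv ha).mlinear L₂)).congr (Filter.Eventually.of_forall fun w => ?_)
  change _ = ofAdapted n * diagBlocks (a w) 0 * toAdapted n +
    ofAdapted n * diagBlocks 0 ((a w)⁻¹)ᵀ * toAdapted n
  rw [← Matrix.add_mul, ← Matrix.mul_add, Matrix.fromBlocks_add]
  change ofAdapted n * diagBlocks (a w) ((a w)⁻¹)ᵀ * toAdapted n = _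
  simp

/-- The matrix of the element of `PHat` moving `vec n c` to `v`. -/
def moverMat (c : ℝˣ) (v : IdxHat n → ℝ) : Matrix (Fin n ⊕ Unit) (Fin n ⊕ Unit) ℝ :=
  -- In the coordinates p, q the vector `vec n c` is p = (0, 1), q = (0, -c/2). The second factor
  -- fixes (0, 1), and the first sends it to the p-coordinates of `v`. The factor 2/c is chosen so
  -- that the transpose of the second factor cancels the y-part against -c/2.
  Matrix.fromBlocks 1 (Matrix.of fun i _ => v (Sum.inl (ix i))) 0
    (Matrix.of fun _ _ => v (Sum.inl it) + v (Sum.inr ())) *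
  Matrix.fromBlocks 1 0 (Matrix.of fun _ i => 2 / c * v (Sum.inl (iy i))) 1

lemma moverMat_det (c : ℝˣ) (v : IdxHat n → ℝ) :
    (moverMat c v).det = v (Sum.inl it) + v (Sum.inr ()) := by
  rw [moverMat, Matrix.det_mul, Matrix.det_fromBlocks_zero₂₁, Matrix.det_fromBlocks_zero₁₂]
  simp

lemma moverMat_smooth (c : ℝˣ) (v : IdxHat n → ℝ) :
    MSmoothAt 𝓘(ℝ, IdxHat n → ℝ) (moverMat (n := n) c) v := by
  have hcoord : ∀ a, ContMDiffAt 𝓘(ℝ, IdxHat n → ℝ) 𝓘(ℝ, ℝ) ∞ (fun v : IdxHat n → ℝ => v a) v :=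
    fun a => (contDiff_apply ℝ ℝ a).contDiffAt.contMDiffAt
  refine MSmoothAt.mul ?_ ?_
  · rw [mSmoothAt_iff]
    rintro (i | i) (j | j)
    · exact contMDiffAt_const
    · exact hcoord _
    · exact contMDiffAt_const
    · exact (hcoord _).add (hcoord _)
  · rw [mSmoothAt_iff]
    rintro (i | i) (j | j)
    · exact contMDiffAt_const
    · exact contMDiffAt_const
    · exact contMDiffAt_const.mul (hcoord _)
    · exact contMDiffAt_const

/-- An element a of GL(n+1) acts on p by a and on q by the inverse transpose, so it suffices that a
maps the p-part of `vec n c` to that of `v`, and that aᵀ maps the q-part of `v` to that of `vec n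
c`. -/
lemma leviMat_moverMat_mulVec (c : ℝˣ) {v : IdxHat n → ℝ} (hv : sqLen v = -c)
    (h : v (Sum.inl it) + v (Sum.inr ()) ≠ 0) : leviMat (moverMat c v) *ᵥ vec n c = v := by
  have hc : (c : ℝ) ≠ 0 := c.ne_zero
  have hu : IsUnit (moverMat c v).det := by rw [moverMat_det]; exact isUnit_iff_ne_zero.2 h
  rw [sqLen_eq] at hv
  suffices hs : diagBlocks (moverMat c v) ((moverMat c v)⁻¹)ᵀ *ᵥ (toAdapted n *ᵥ vec n c) =
      toAdapted n *ᵥ v by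
    rw [leviMat, Matrix.mul_assoc, ← Matrix.mulVec_mulVec, ← Matrix.mulVec_mulVec, hs,
      Matrix.mulVec_mulVec, ofAdapted_mul_toAdapted, Matrix.one_mulVec]
  have hp : ∀ w : IdxHat n → ℝ, (toAdapted n *ᵥ w) ∘ Sum.inl =
      Sum.elim (fun i => w (Sum.inl (ix i))) (fun _ => w (Sum.inl it) + w (Sum.inr ())) := by
    intro w
    funext i
    rcases i with i | u <;> simp [toAdapted, Matrix.mulVec, dotProduct]
  have hq : ∀ w : IdxHat n → ℝ, (toAdapted n *ᵥ w) ∘ Sum.inr =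
      Sum.elim (fun i => w (Sum.inl (iy i))) (fun _ => (w (Sum.inl it) - w (Sum.inr ())) / 2) := by
    intro w
    funext i
    rcases i with i | u <;> simp [toAdapted, Matrix.mulVec, dotProduct]
    ring
  have hpq : (moverMat c v)ᵀ *ᵥ ((toAdapted n *ᵥ v) ∘ Sum.inr) =
      (toAdapted n *ᵥ vec n c) ∘ Sum.inr := by
    rw [hq, hq, vec_apply, moverMat, Matrix.transpose_mul, ← Matrix.mulVec_mulVec,
      Matrix.fromBlocks_transpose, Matrix.fromBlocks_transpose, Matrix.fromBlocks_mulVec,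
      Matrix.fromBlocks_mulVec]
    -- This is p·q for the vector `v`, half its square length.
    have e : ∑ i, v (Sum.inl (ix i)) * v (Sum.inl (iy i)) +
        (v (Sum.inl it) + v (Sum.inr ())) * ((v (Sum.inl it) - v (Sum.inr ())) / 2) = -c / 2 := by
      linarith
    funext i
    rcases i with i | u
    · simp [Matrix.mulVec, dotProduct, e]
      field_simp
      ring
    · simp [Matrix.mulVec, dotProduct, e]
      ring
  rw [Matrix.fromBlocks_mulVec, Matrix.zero_mulVec, Matrix.zero_mulVec, add_zero, zero_add, ← hpq,
    Matrix.mulVec_mulVec, ← Matrix.transpose_mul, Matrix.mul_nonsing_inv _ hu,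
    Matrix.transpose_one, Matrix.one_mulVec]
  have h3 : moverMat c v *ᵥ ((toAdapted n *ᵥ vec n c) ∘ Sum.inl) =
      (toAdapted n *ᵥ v) ∘ Sum.inl := by
    rw [hp, hp, vec_apply, moverMat, ← Matrix.mulVec_mulVec, Matrix.fromBlocks_mulVec,
      Matrix.fromBlocks_mulVec]
    funext i
    rcases i with i | u <;> simp [Matrix.mulVec, dotProduct] <;> ring
  rw [h3]
  funext i
  rcases i with i | i <;> rfl

/-- If t + r = 0 and the square length is nonzero, some coordinate of x is nonzero, and a shear in
GL(n+1) adds it to t + r. -/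
lemma exists_levi_mulVec (v : IdxHat n → ℝ) (hv : sqLen v ≠ 0) :
    ∃ g : PHat n, (g.1.val *ᵥ v) (Sum.inl it) + (g.1.val *ᵥ v) (Sum.inr ()) ≠ 0 := by
  by_cases h : v (Sum.inl it) + v (Sum.inr ()) = 0
  · have hx : ∃ i, v (Sum.inl (ix i)) ≠ 0 := by
      by_contra! hx
      apply hv
      rw [sqLen_eq]
      simp only [hx, zero_mul, Finset.sum_const_zero, mul_zero, zero_add]
      linear_combination h * (v (Sum.inl it) - v (Sum.inr ()))
    obtain ⟨i, hi⟩ := hx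
    set a : Matrix (Fin n ⊕ Unit) (Fin n ⊕ Unit) ℝ :=
      Matrix.fromBlocks 1 0 (Matrix.of fun _ j => if j = i then 1 else 0) 1 with ha
    have hdet : IsUnit a.det := by
      rw [ha, Matrix.det_fromBlocks_zero₁₂]
      simp
    refine ⟨levi hdet, ?_⟩
    have h1 : ∀ w : IdxHat n → ℝ, w (Sum.inl it) + w (Sum.inr ()) =
        (toAdapted n *ᵥ w) (Sum.inl (Sum.inr ())) := fun w => by
      simp [toAdapted, Matrix.mulVec, dotProduct]
    have h2 : v (Sum.inl (ix i)) = (toAdapted n *ᵥ v) (Sum.inl (Sum.inl i)) := by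
      simp [toAdapted, Matrix.mulVec, dotProduct]
    rw [h1, levi_val, Matrix.mulVec_mulVec, toAdapted_mul_leviMat, ← Matrix.mulVec_mulVec,
      Matrix.fromBlocks_mulVec]
    have h3 : (a *ᵥ ((toAdapted n *ᵥ v) ∘ Sum.inl)) (Sum.inr ()) =
        v (Sum.inl (ix i)) + (v (Sum.inl it) + v (Sum.inr ())) := by
      rw [ha, Matrix.fromBlocks_mulVec, h1, h2]
      simp [Matrix.mulVec, dotProduct]
    simp only [Sum.elim_inl, Matrix.zero_mulVec, add_zero]
    rw [h3, h, add_zero]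
    exact hi
  · exact ⟨1, by simpa using h⟩

/-- `PHat` moves `vec n c` to any vector of the same square length, by an element depending smoothly
on this vector. -/
lemma exists_mover (c : ℝˣ) (v₀ : IdxHat n → ℝ) (hv₀ : sqLen v₀ = -c) :
    ∃ (U : Set (IdxHat n → ℝ)) (h : (IdxHat n → ℝ) → PHat n), IsOpen U ∧ v₀ ∈ U ∧
      (∀ v ∈ U, GSmoothAt 𝓘(ℝ, IdxHat n → ℝ) h v) ∧
      ∀ v ∈ U, sqLen v = -c → (h v).1.val *ᵥ vec n c = v := by
  classical
  -- The explicit mover needs t + r ≠ 0. A fixed translation by `g` achieves this at `v₀`, hence on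
  -- a neighbourhood, and is undone by g⁻¹.
  obtain ⟨g, hg⟩ := exists_levi_mulVec v₀ (by rw [hv₀]; exact neg_ne_zero.2 c.ne_zero)
  let ℓ : (IdxHat n → ℝ) → ℝ := fun v => (g.1.val *ᵥ v) (Sum.inl it) + (g.1.val *ᵥ v) (Sum.inr ())
  have hℓ : Continuous ℓ := by
    refine Continuous.add ?_ ?_
    · exact (continuous_apply _).comp (Continuous.matrix_mulVec continuous_const continuous_id)
    · exact (continuous_apply _).comp (Continuous.matrix_mulVec continuous_const continuous_id)
  have hU : IsOpen {v | ℓ v ≠ 0} := isOpen_ne_fun hℓ continuous_const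
  have hu : ∀ v, ℓ v ≠ 0 → IsUnit (moverMat c (g.1.val *ᵥ v)).det := fun v hv => by
    rw [moverMat_det]; exact isUnit_iff_ne_zero.2 hv
  refine ⟨{v | ℓ v ≠ 0}, fun v => if hv : ℓ v ≠ 0 then g⁻¹ * levi (hu v hv) else 1, hU, hg, ?_, ?_⟩
  · intro v hv
    have h1 : MSmoothAt 𝓘(ℝ, IdxHat n → ℝ) (fun v => moverMat (n := n) c (g.1.val *ᵥ v)) v := by
      refine (moverMat_smooth c _).comp (g := fun v => g.1.val *ᵥ v) ?_
      exact (ContinuousLinearMap.contDiff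
        (LinearMap.toContinuousLinearMap (Matrix.mulVecLin g.1.val))).contDiffAt.contMDiffAt
    have h2 := leviMat_smooth h1 (hu v hv)
    refine ((MSmoothAt.const (g⁻¹).1.val v).mul h2).congr ?_
    filter_upwards [hU.mem_nhds hv] with w hw
    have hw' : ℓ w ≠ 0 := hw
    rw [dif_pos hw']
    rfl
  · intro v hv hvc
    have hv' : ℓ v ≠ 0 := hv
    have h3 : sqLen (g.1.val *ᵥ v) = -c := by rw [sqLen_mulVec g.2.1, hvc]
    simp only [dif_pos hv']
    change ((g⁻¹).1.val * leviMat _) *ᵥ vec n c = v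
    rw [← Matrix.mulVec_mulVec, leviMat_moverMat_mulVec c h3 hv, Matrix.mulVec_mulVec]
    have : (g⁻¹).1.val * g.1.val = 1 := g.1.inv_mul
    rw [this, Matrix.one_mulVec]

end AlgebraHat

/-! ## The homogeneous spaces -/

section Homogeneous

variable {n : ℕ}

lemma GSmoothAt.continuousAt {N : Type} [Fintype N] [DecidableEq N]
    {P : Subgroup (Matrix N N ℝ)ˣ} {E H X : Type*} [NormedAddCommGroup E] [NormedSpace ℝ E]
    [TopologicalSpace H] {I : ModelWithCorners ℝ E H} [TopologicalSpace X] [ChartedSpace H X]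
    {k : X → P} {x : X} (hk : GSmoothAt I k x) : ContinuousAt k x := by
  have h1 : ContinuousAt (fun y => (k y).1.val) x :=
    ContMDiffAt.continuousAt (I' := 𝓘(ℝ, N → N → ℝ)) (f := fun y => entries (k y).1.val) hk
  have h2 : ContinuousAt (fun y => ((k y)⁻¹).1.val) x :=
    ContMDiffAt.continuousAt (I' := 𝓘(ℝ, N → N → ℝ)) (f := fun y => entries ((k y)⁻¹).1.val) hk.inv
  unfold ContinuousAt
  rw [Topology.IsInducing.subtypeVal.tendsto_nhds_iff,
    Units.isInducing_embedProduct.tendsto_nhds_iff]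
  exact h1.tendsto.prodMk_nhds ((MulOpposite.continuous_op.tendsto _).comp h2.tendsto)

lemma continuous_inclGL (c : ℝˣ) : Continuous (inclGL n c) := by
  have h1 : Continuous (fun A : Matrix (Idx n) (Idx n) ℝ => blockHom n A) :=
    Continuous.matrix_fromBlocks continuous_id continuous_const continuous_const continuous_const
  have h2 : Continuous (Units.map (blockHom n)) := Continuous.units_map _ h1
  exact (continuous_const.mul h2).mul continuous_const

lemma continuous_restr (c : ℝˣ) : Continuous (restr (n := n) c) :=
  Continuous.matrix_submatrix ((continuous_const.mul continuous_id).mul continuous_const) _ _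

/-- The map `restr` is a continuous left inverse on matrices; applied to an element and to its
inverse it recovers the topology of the group of units. -/
lemma isInducing_inclGL (c : ℝˣ) : Topology.IsInducing (inclGL n c) := by
  refine Topology.IsInducing.of_comp (continuous_inclGL c)
    (g := fun k => (restr c k.val, MulOpposite.op (restr c (k⁻¹).val))) ?_ ?_
  · exact ((continuous_restr c).comp Units.continuous_val).prodMk
      (MulOpposite.continuous_op.comp ((continuous_restr c).comp Units.continuous_coe_inv))
  · convert Units.isInducing_embedProduct (M := Matrix (Idx n) (Idx n) ℝ) using 1
    funext k
    refine Prod.ext (restr_inclGL c k) (congrArg MulOpposite.op ?_)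
    rw [← map_inv, restr_inclGL]

lemma isInducing_incl (c : ℝˣ) : Topology.IsInducing (incl n c) :=
  Topology.IsInducing.of_comp_iff Topology.IsInducing.subtypeVal |>.1
    ((isInducing_inclGL c).comp Topology.IsInducing.subtypeVal)

lemma incl_injective (c : ℝˣ) : Function.Injective (incl n c) := fun g h hgh =>
  Subtype.ext (inclGL_injective c (congrArg Subtype.val hgh))

lemma range_incl (c : ℝˣ) :
    Set.range (incl n c) = {g : GHat n | g.1.val *ᵥ vec n c = vec n c} := by
  ext g
  constructor
  · rintro ⟨k, rfl⟩
    exact inclGL_vec c k.1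
  · intro h
    obtain ⟨k, hk, hkg⟩ := exists_inclGL_eq c g.2 h
    exact ⟨⟨k, hk⟩, Subtype.ext hkg⟩

lemma comap_incl (c : ℝˣ) :
    ((PHat n).subgroupOf (GHat n)).comap (incl n c) = (P n).subgroupOf (G n) := by
  ext g
  exact inclGL_mem_iff c g.2

/-- For k near the image of g, the vector k⁻¹v_c is near v_c, so a mover h ∈ `PHat` takes v_c to it.
Then kh fixes v_c and lies in the image of `G`, in the same coset as k. -/
lemma exists_local_section (c : ℝˣ) (g : G n) : ∃ σ : GHat n → G n,
    Filter.Tendsto σ (𝓝 (incl n c g)) (𝓝 g) ∧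
    ∀ᶠ k in 𝓝 (incl n c g), (incl n c (σ k))⁻¹ * k ∈ (PHat n).subgroupOf (GHat n) := by
  classical
  have hvec : ∀ k : G n, ((incl n c k)⁻¹).1.val *ᵥ vec n c = vec n c := fun k => by
    rw [← map_inv]; exact inclGL_vec c _
  obtain ⟨U, h, hU, hvU, hs, hh⟩ := exists_mover (n := n) c (vec n c) (sqLen_vec c)
  let w : GHat n → IdxHat n → ℝ := fun k => (k⁻¹).1.val *ᵥ vec n c
  have hw : Continuous w := by
    refine Continuous.matrix_mulVec ?_ continuous_const
    exact Units.continuous_coe_inv.comp continuous_subtype_val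
  have hw0 : w (incl n c g) = vec n c := hvec g
  have hwU : ∀ᶠ k in 𝓝 (incl n c g), w k ∈ U :=
    hw.continuousAt.eventually (hU.mem_nhds (by rw [hw0]; exact hvU))
  -- The last factor, which also fixes v_c and lies in `PHat`, normalizes `q` to fix the point `incl
  -- n c g`.
  let q : GHat n → GHat n := fun k =>
    k * (⟨(h (w k)).1, (h (w k)).2.1⟩ * ⟨(h (vec n c)).1, (h (vec n c)).2.1⟩⁻¹)
  have hq0 : q (incl n c g) = incl n c g := by
    simp only [q, hw0, mul_inv_cancel, mul_one]
  have hqc : ContinuousAt q (incl n c g) := by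
    refine continuousAt_id.mul (ContinuousAt.mul ?_ continuousAt_const)
    have h1 : ContinuousAt (fun k => h (w k)) (incl n c g) :=
      ContinuousAt.comp (f := w) (by rw [hw0]; exact (hs _ hvU).continuousAt) hw.continuousAt
    exact (continuous_subtype_val.continuousAt.comp h1).codRestrict _
  have hqv : ∀ k, w k ∈ U → ∃ a, incl n c a = q k := by
    intro k hk
    have h1 : (h (w k)).1.val *ᵥ vec n c = w k := by
      refine hh _ hk ?_
      rw [sqLen_mulVec (k⁻¹).2, sqLen_vec]
    have h2 : ((h (vec n c)).1⁻¹).val *ᵥ vec n c = vec n c := by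
      have h4 := congrArg (fun v => ((h (vec n c)).1⁻¹).val *ᵥ v) (hh _ hvU (sqLen_vec c))
      simp only [Matrix.mulVec_mulVec, Units.inv_mul, Matrix.one_mulVec] at h4
      exact h4.symm
    have h3 : q k ∈ Set.range (incl n c) := by
      rw [range_incl]
      change (k.1.val * ((h (w k)).1.val * ((h (vec n c)).1⁻¹).val)) *ᵥ vec n c = vec n c
      rw [← Matrix.mulVec_mulVec, ← Matrix.mulVec_mulVec, h2, h1]
      change k.1.val *ᵥ ((k.1⁻¹).val *ᵥ vec n c) = vec n c
      rw [Matrix.mulVec_mulVec, Units.mul_inv, Matrix.one_mulVec]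
    exact h3
  let σ : GHat n → G n := fun k => if hk : ∃ a, incl n c a = q k then hk.choose else 1
  have hσ : ∀ᶠ k in 𝓝 (incl n c g), incl n c (σ k) = q k := by
    filter_upwards [hwU] with k hk
    have := hqv k hk
    simp only [σ, dif_pos this]
    exact this.choose_spec
  refine ⟨σ, ?_, ?_⟩
  · rw [(isInducing_incl c).tendsto_nhds_iff]
    have h1 : Filter.Tendsto q (𝓝 (incl n c g)) (𝓝 (incl n c g)) := by
      have := hqc.tendsto
      rwa [hq0] at this
    exact h1.congr' (hσ.mono fun k hk => hk.symm)
  · filter_upwards [hσ] with k hk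
    rw [hk]
    simp only [q]
    rw [_root_.mul_inv_rev, inv_mul_cancel_right]
    exact ((PHat n).inv_mem ((PHat n).mul_mem (h (w k)).2 ((PHat n).inv_mem (h (vec n c)).2)))

/-- Injectivity is the equality of `P` with the preimage of `PHat`; openness comes from the local
section into `G`. -/
lemma exists_isOpenEmbedding (c : ℝˣ) :
    ∃ f : G n ⧸ (P n).subgroupOf (G n) → GHat n ⧸ (PHat n).subgroupOf (GHat n),
      (∀ g : G n, f (QuotientGroup.mk g) = QuotientGroup.mk (incl n c g)) ∧
      Topology.IsOpenEmbedding f := by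
  have hmk : ∀ a b : G n, (QuotientGroup.mk a : G n ⧸ (P n).subgroupOf (G n)) = QuotientGroup.mk b ↔
      (QuotientGroup.mk (incl n c a) : GHat n ⧸ (PHat n).subgroupOf (GHat n)) =
        QuotientGroup.mk (incl n c b) := by
    intro a b
    rw [QuotientGroup.eq, QuotientGroup.eq, ← map_inv, ← map_mul, ← comap_incl c]
    rfl
  let f : G n ⧸ (P n).subgroupOf (G n) → GHat n ⧸ (PHat n).subgroupOf (GHat n) :=
    Quotient.lift (fun g : G n => QuotientGroup.mk (incl n c g))
      fun a b hab => (hmk a b).1 (Quotient.sound hab)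
  have hf : ∀ g : G n, f (QuotientGroup.mk g) = QuotientGroup.mk (incl n c g) := fun g => rfl
  have hcont : Continuous f :=
    continuous_quot_lift _ (QuotientGroup.continuous_mk.comp (isInducing_incl c).continuous)
  refine ⟨f, hf, Topology.IsOpenEmbedding.of_continuous_injective_isOpenMap hcont ?_ ?_⟩
  · intro x y hxy
    induction x using QuotientGroup.induction_on with | H a => ?_
    induction y using QuotientGroup.induction_on with | H b => ?_
    exact (hmk a b).2 hxy
  · rw [isOpenMap_iff_nhds_le]
    intro x
    induction x using QuotientGroup.induction_on with | H g => ?_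
    obtain ⟨σ, hσ, hσ'⟩ := exists_local_section c g
    rw [hf, QuotientGroup.nhds_eq, QuotientGroup.nhds_eq, Filter.map_map]
    -- Near `incl n c g` the quotient map of `GHat` factors through the local section and `f`.
    calc Filter.map QuotientGroup.mk (𝓝 (incl n c g))
        = Filter.map (fun k => f (QuotientGroup.mk (σ k))) (𝓝 (incl n c g)) := by
          refine Filter.map_congr (hσ'.mono fun k hk => ?_)
          exact ((QuotientGroup.eq).2 hk).symm
      _ = Filter.map (f ∘ QuotientGroup.mk) (Filter.map σ (𝓝 (incl n c g))) := by
          rw [Filter.map_map]; rfl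
      _ ≤ _ := Filter.map_mono hσ

end Homogeneous

/-! ## Exterior derivatives of one-forms on vector spaces -/

section ExteriorDerivative

variable {E E' F : Type*} [NormedAddCommGroup E] [NormedSpace ℝ E] [NormedAddCommGroup E']
  [NormedSpace ℝ E'] [NormedAddCommGroup F] [NormedSpace ℝ F]

/-- The exterior derivative of a one-form. -/
def dForm (Ω : E → E →L[ℝ] F) (e v w : E) : F := fderiv ℝ Ω e v w - fderiv ℝ Ω e w v

/-- The Cartan formula: the terms containing derivatives of the fields combine to the bracket, the
others to the exterior derivative. -/
lemma apply_lieBracket {Ω : E → E →L[ℝ] F} {e : E} (hΩ : DifferentiableAt ℝ Ω e) {V W : E → E}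
    (hV : DifferentiableAt ℝ V e) (hW : DifferentiableAt ℝ W e) :
    Ω e (VectorField.lieBracket ℝ V W e) = fderiv ℝ (fun y => Ω y (W y)) e (V e) -
      fderiv ℝ (fun y => Ω y (V y)) e (W e) - dForm Ω e (V e) (W e) := by
  rw [fderiv_clm_apply hΩ hW, fderiv_clm_apply hΩ hV, VectorField.lieBracket, dForm, map_sub]
  simp only [_root_.add_apply, ContinuousLinearMap.comp_apply,
    ContinuousLinearMap.flip_apply]
  abel

lemma dForm_congr {Ω Θ : E → E →L[ℝ] F} {e : E} (h : Ω =ᶠ[𝓝 e] Θ) (v w : E) :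
    dForm Ω e v w = dForm Θ e v w := by
  rw [dForm, dForm, h.fderiv_eq]

/-- The second derivative of `S` is symmetric and drops out of the antisymmetrization. -/
lemma dForm_comp {Ω : E' → E' →L[ℝ] F} {S : E → E'} {e : E}
    (hΩ : DifferentiableAt ℝ Ω (S e)) (hS : ContDiffAt ℝ ∞ S e) (v w : E) :
    dForm (fun y => (Ω (S y)).comp (fderiv ℝ S y)) e v w =
      dForm Ω (S e) (fderiv ℝ S e v) (fderiv ℝ S e w) := by
  have hS1 : DifferentiableAt ℝ S e := hS.differentiableAt (by simp)
  have hS2 : DifferentiableAt ℝ (fderiv ℝ S) e :=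
    (hS.fderiv_right (m := 1) (by rw [one_add_one_eq_two]; exact ENat.LEInfty.out)).differentiableAt (by simp)
  have hsymm : fderiv ℝ (fderiv ℝ S) e v w = fderiv ℝ (fderiv ℝ S) e w v :=
    (hS.isSymmSndFDerivAt (by simp; exact ENat.LEInfty.out)).eq v w
  have h1 : DifferentiableAt ℝ (fun y => Ω (S y)) e := hΩ.comp e hS1
  have h2 : fderiv ℝ (fun y => Ω (S y)) e = (fderiv ℝ Ω (S e)).comp (fderiv ℝ S e) :=
    fderiv_comp e hΩ hS1
  rw [dForm, dForm, fderiv_clm_comp h1 hS2, h2]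
  simp [hsymm]

lemma eventually_bijective [FiniteDimensional ℝ E] [FiniteDimensional ℝ E'] {B : E → E →L[ℝ] E'}
    {e : E} (hB : ContinuousAt B e) (h : Function.Bijective (B e)) :
    ∀ᶠ y in 𝓝 e, Function.Bijective (B y) := by
  let eq : E ≃L[ℝ] E' := (LinearEquiv.ofBijective (B e).toLinearMap h).toContinuousLinearEquiv
  have h1 : (eq : E →L[ℝ] E') = B e := by ext; rfl
  have h2 := ContinuousLinearEquiv.nhds eq
  rw [h1] at h2
  filter_upwards [hB.eventually h2] with y hy
  obtain ⟨eq', h'⟩ := hy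
  rw [← h']
  exact eq'.bijective

lemma contDiffAt_inverse_apply [FiniteDimensional ℝ E] [FiniteDimensional ℝ E'] {B : E → E →L[ℝ] E'}
    {e : E} (hB : ContDiffAt ℝ ∞ B e) (h : Function.Bijective (B e)) (w : E') :
    ContDiffAt ℝ ∞ (fun y => (B y).inverse w) e := by
  let eq : E ≃L[ℝ] E' := (LinearEquiv.ofBijective (B e).toLinearMap h).toContinuousLinearEquiv
  have h1 : (eq : E →L[ℝ] E') = B e := by ext; rfl
  have : CompleteSpace E := FiniteDimensional.complete ℝ E
  have h2 := contDiffAt_map_inverse (𝕜 := ℝ) (n := ∞) eq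
  rw [h1] at h2
  exact (h2.comp e hB).clm_apply contDiffAt_const

lemma apply_inverse_apply [FiniteDimensional ℝ E] [FiniteDimensional ℝ E'] {B : E →L[ℝ] E'}
    (h : Function.Bijective B) (w : E') : B (B.inverse w) = w := by
  let eq : E ≃L[ℝ] E' := (LinearEquiv.ofBijective B.toLinearMap h).toContinuousLinearEquiv
  have h1 : (eq : E →L[ℝ] E') = B := by ext; rfl
  rw [← h1, ContinuousLinearMap.inverse_equiv]
  exact eq.apply_symm_apply w

end ExteriorDerivative

/-! ## Lie brackets in charts -/

section Charts

variable {d : ℕ} {X : Type*} [TopologicalSpace X] [ChartedSpace (EuclideanSpace ℝ (Fin d)) X]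
  [IsManifold (𝓡 d) ∞ X]

/-- The inverse of a chart. -/
abbrev chartInv (x : X) : EuclideanSpace ℝ (Fin d) → X := (extChartAt (𝓡 d) x).symm

lemma chartInv_self (x : X) : chartInv x (extChartAt (𝓡 d) x x) = x := extChartAt_to_inv x

lemma isOpen_target (x : X) : IsOpen (extChartAt (𝓡 d) x).target := isOpen_extChartAt_target x

lemma chartInv_smoothAt {x : X} {e : EuclideanSpace ℝ (Fin d)}
    (he : e ∈ (extChartAt (𝓡 d) x).target) :
    ContMDiffAt 𝓘(ℝ, EuclideanSpace ℝ (Fin d)) (𝓡 d) ∞ (chartInv x) e :=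
  (contMDiffOn_extChartAt_symm x).contMDiffAt ((isOpen_target x).mem_nhds he)

lemma mfderiv_chartInv_invertible {x : X} {e : EuclideanSpace ℝ (Fin d)}
    (he : e ∈ (extChartAt (𝓡 d) x).target) :
    (mfderiv 𝓘(ℝ, EuclideanSpace ℝ (Fin d)) (𝓡 d) (chartInv x) e).IsInvertible := by
  have : IsManifold (𝓡 d) 1 X := IsManifold.of_le (n := ∞) (by simp)
  have h := isInvertible_mfderivWithin_extChartAt_symm (I := 𝓡 d) he
  simpa only [modelWithCornersSelf_coe, Set.range_id, mfderivWithin_univ] using h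

/-- A vector field in a chart. -/
def fieldInChart (x : X) (V : (y : X) → TangentSpace (𝓡 d) y) (e : EuclideanSpace ℝ (Fin d)) :
    EuclideanSpace ℝ (Fin d) :=
  (mfderiv 𝓘(ℝ, EuclideanSpace ℝ (Fin d)) (𝓡 d) (chartInv x) e).inverse (V (chartInv x e))

lemma mfderiv_fieldInChart {x : X} {e : EuclideanSpace ℝ (Fin d)}
    (he : e ∈ (extChartAt (𝓡 d) x).target) (V : (y : X) → TangentSpace (𝓡 d) y) :
    mfderiv 𝓘(ℝ, EuclideanSpace ℝ (Fin d)) (𝓡 d) (chartInv x) e (fieldInChart x V e) =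
      V (chartInv x e) := by
  obtain ⟨eq, heq⟩ := mfderiv_chartInv_invertible he
  unfold fieldInChart
  rw [← heq, ContinuousLinearMap.inverse_equiv]
  exact eq.apply_symm_apply _

lemma mpullbackWithin_chartInv (x : X) (V : (y : X) → TangentSpace (𝓡 d) y) :
    VectorField.mpullbackWithin 𝓘(ℝ, EuclideanSpace ℝ (Fin d)) (𝓡 d) (chartInv x) V Set.univ =
      fieldInChart x V := by
  funext e
  simp only [VectorField.mpullbackWithin_apply, mfderivWithin_univ]
  rfl

/-- The bracket at the centre of a chart, written with the inverse of the chart, so that forms can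
be pulled back along it. -/
lemma mlieBracket_eq (x : X) (V W : (y : X) → TangentSpace (𝓡 d) y) :
    (VectorField.mlieBracket (𝓡 d) V W x : EuclideanSpace ℝ (Fin d)) =
      mfderiv 𝓘(ℝ, EuclideanSpace ℝ (Fin d)) (𝓡 d) (chartInv x) (extChartAt (𝓡 d) x x)
        (VectorField.lieBracket ℝ (E := EuclideanSpace ℝ (Fin d)) (fieldInChart x V)
          (fieldInChart x W) (extChartAt (𝓡 d) x x)) := by
  rw [← VectorField.mlieBracketWithin_univ, VectorField.mlieBracketWithin_apply]
  have hx := mem_extChartAt_source (I := 𝓡 d) x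
  have h2 : ((mfderiv (𝓡 d) 𝓘(ℝ, EuclideanSpace ℝ (Fin d)) (extChartAt (𝓡 d) x) x).inverse :
        EuclideanSpace ℝ (Fin d) →L[ℝ] EuclideanSpace ℝ (Fin d)) =
      mfderiv 𝓘(ℝ, EuclideanSpace ℝ (Fin d)) (𝓡 d) (chartInv x) (extChartAt (𝓡 d) x x) := by
    have h3 := mfderiv_extChartAt_comp_mfderivWithin_extChartAt_symm' (I := 𝓡 d) hx
    have h4 := mfderivWithin_extChartAt_symm_comp_mfderiv_extChartAt' (I := 𝓡 d) hx
    simp only [modelWithCornersSelf_coe, Set.range_id, mfderivWithin_univ] at h3 h4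
    exact ContinuousLinearMap.inverse_eq (M := EuclideanSpace ℝ (Fin d))
      (M₂ := EuclideanSpace ℝ (Fin d)) h3 h4
  simp only [modelWithCornersSelf_coe, Set.range_id, Set.preimage_univ, Set.inter_univ]
  rw [mpullbackWithin_chartInv, mpullbackWithin_chartInv]
  refine (congrArg (fun L : EuclideanSpace ℝ (Fin d) →L[ℝ] EuclideanSpace ℝ (Fin d) => L _) h2).trans ?_
  refine congrArg (mfderiv 𝓘(ℝ, EuclideanSpace ℝ (Fin d)) (𝓡 d) (chartInv x)
    (extChartAt (𝓡 d) x x)) ?_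
  exact congrFun (VectorField.lieBracketWithin_univ (𝕜 := ℝ) (E := EuclideanSpace ℝ (Fin d))) _

lemma fieldInChart_differentiableAt (x : X) {V : (y : X) → TangentSpace (𝓡 d) y}
    (hV : MDifferentiableAt (𝓡 d) (𝓡 d).tangent
      (fun y => (⟨y, V y⟩ : TangentBundle (𝓡 d) X)) x) :
    DifferentiableAt ℝ (fieldInChart x V) (extChartAt (𝓡 d) x x) := by
  have : IsManifold (𝓡 d) 2 X := IsManifold.of_le (n := ∞) ENat.LEInfty.out
  have h := (mdifferentiableWithinAt_univ.2 hV).differentiableWithinAt_mpullbackWithin_vectorField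
  simp only [modelWithCornersSelf_coe, Set.range_id, Set.preimage_univ, Set.inter_univ] at h
  rw [mpullbackWithin_chartInv] at h
  exact differentiableWithinAt_univ.1 h

end Charts

/-! ## Cartan connections in charts -/

namespace CartanGeometry

variable {N : Type} [Fintype N] [DecidableEq N] {𝔤 : Submodule ℝ (Matrix N N ℝ)}
  {P : Subgroup (Matrix N N ℝ)ˣ} {m : ℕ} {M : Type u} [TopologicalSpace M]
  [ChartedSpace (EuclideanSpace ℝ (Fin m)) M] (C : CartanGeometry.{u, v} 𝔤 P (m := m) M)
  {E : Type*} [NormedAddCommGroup E] [NormedSpace ℝ E] [FiniteDimensional ℝ E]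
  {E' : Type*} [NormedAddCommGroup E'] [NormedSpace ℝ E'] [FiniteDimensional ℝ E']

/-- The pullback of the Cartan connection to a vector space. -/
def pullL (g : E → C.Total) (e : E) : E →L[ℝ] (N → N → ℝ) :=
  LinearMap.toContinuousLinearMap ((entriesL N).toLinearMap ∘ₗ C.conn (g e) ∘ₗ
    (mfderiv 𝓘(ℝ, E) (𝓡 C.dim) g e).toLinearMap)

lemma pullL_congr {f g : E → C.Total} {e : E} (h : f =ᶠ[𝓝 e] g) : C.pullL f e = C.pullL g e := by
  ext1 v
  exact congrArg entries (C.pull_congr (I := 𝓘(ℝ, E)) h v)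

lemma pullL_comp {g : E → C.Total} {S : E' → E} {e : E'}
    (hg : MDifferentiableAt 𝓘(ℝ, E) (𝓡 C.dim) g (S e)) (hS : DifferentiableAt ℝ S e) :
    C.pullL (fun y => g (S y)) e = (C.pullL g (S e)).comp (fderiv ℝ S e) := by
  ext1 v
  rw [← mfderiv_eq_fderiv]
  exact congrArg entries (C.pull_comp hg hS.mdifferentiableAt v)

lemma pullL_smooth {g : E → C.Total} {O : Set E} (hO : IsOpen O)
    (hg : ∀ e ∈ O, ContMDiffAt 𝓘(ℝ, E) (𝓡 C.dim) ∞ g e) : ContDiffOn ℝ ∞ (C.pullL g) O := by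
  rw [contDiffOn_clm_apply]
  intro v e he
  refine ContDiffAt.contDiffWithinAt ?_
  rw [← contMDiffAt_iff_contDiffAt]
  have : IsManifold (𝓡 C.dim) 1 C.Total := IsManifold.of_le (n := ∞) (by simp)
  have h1 : ContMDiffOn 𝓘(ℝ, E) (𝓡 C.dim) ∞ g O := fun y hy => (hg y hy).contMDiffWithinAt
  have h2 := h1.contMDiffOn_tangentMapWithin (m := ∞) (by simp) hO.uniqueMDiffOn
  have hopen : IsOpen (Bundle.TotalSpace.proj ⁻¹' O : Set (TangentBundle 𝓘(ℝ, E) E)) :=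
    hO.preimage (FiberBundle.continuous_proj _ _)
  have h4 : ContMDiffAt 𝓘(ℝ, E) 𝓘(ℝ, E).tangent ∞
      (fun y => (⟨y, v⟩ : TangentBundle 𝓘(ℝ, E) E)) e :=
    contMDiffAt_vectorSpace_iff_contDiffAt.2 contDiffAt_const
  have h3 := (C.conn_smooth.contMDiffAt.comp (⟨e, v⟩ : TangentBundle 𝓘(ℝ, E) E)
    (h2.contMDiffAt (hopen.mem_nhds he))).comp e h4
  refine h3.congr_of_eventuallyEq ?_
  filter_upwards [hO.mem_nhds he] with y hy
  simp only [Function.comp_apply]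
  rw [tangentMapWithin_eq_tangentMap (hO.uniqueMDiffOn _ hy)
    ((hg _ hy).mdifferentiableAt (by simp))]
  rfl

lemma pull_eq_of_eq {f : M → C.Total} {a b : M} (h : a = b) (w : EuclideanSpace ℝ (Fin m)) :
    C.pull (𝓡 m) f a w = C.pull (𝓡 m) f b w := by subst h; rfl

variable [IsManifold (𝓡 m) ∞ M]

lemma pull_mlieBracket {s : M → C.Total} {b : M} (hs : MDifferentiableAt (𝓡 m) (𝓡 C.dim) s b)
    (X Y : (y : M) → TangentSpace (𝓡 m) y) :
    entries (C.pull (𝓡 m) s b (VectorField.mlieBracket (𝓡 m) X Y b)) =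
      C.pullL (fun e => s (chartInv b e)) (extChartAt (𝓡 m) b b)
        (VectorField.lieBracket ℝ (E := EuclideanSpace ℝ (Fin m)) (fieldInChart b X)
          (fieldInChart b Y) (extChartAt (𝓡 m) b b)) := by
  have hσ := (chartInv_smoothAt (mem_extChartAt_target (I := 𝓡 m) b)).mdifferentiableAt (by simp)
  have hs' : MDifferentiableAt (𝓡 m) (𝓡 C.dim) s (chartInv b (extChartAt (𝓡 m) b b)) := by
    rwa [chartInv_self]
  exact congrArg entries ((C.pull_comp hs' hσ _).trans ((C.pull_eq_of_eq (chartInv_self b) _).trans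
    (congrArg (C.pull (𝓡 m) s b) (mlieBracket_eq b X Y).symm))).symm

lemma pullL_fieldInChart {s : M → C.Total} {b : M} {e : EuclideanSpace ℝ (Fin m)}
    (he : e ∈ (extChartAt (𝓡 m) b).target)
    (hs : MDifferentiableAt (𝓡 m) (𝓡 C.dim) s (chartInv b e))
    (X : (y : M) → TangentSpace (𝓡 m) y) :
    C.pullL (fun e => s (chartInv b e)) e (fieldInChart b X e) =
      entries (C.pull (𝓡 m) s (chartInv b e) (X (chartInv b e))) := by
  exact congrArg entries ((C.pull_comp hs ((chartInv_smoothAt he).mdifferentiableAt (by simp)) _).trans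
    (congrArg (C.pull (𝓡 m) s (chartInv b e)) (mfderiv_fieldInChart he X)))

/-- The Cartan connection in a chart of the total space. -/
def connInChart (x : C.Total) (e : EuclideanSpace ℝ (Fin C.dim)) :
    EuclideanSpace ℝ (Fin C.dim) →L[ℝ] (N → N → ℝ) := C.pullL (chartInv x) e

lemma connInChart_smoothAt {x : C.Total} {e : EuclideanSpace ℝ (Fin C.dim)}
    (he : e ∈ (extChartAt (𝓡 C.dim) x).target) : ContDiffAt ℝ ∞ (C.connInChart x) e :=
  (C.pullL_smooth (isOpen_target x) fun e he => chartInv_smoothAt he).contDiffAt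
    ((isOpen_target x).mem_nhds he)

lemma connInChart_injective {x : C.Total} {e : EuclideanSpace ℝ (Fin C.dim)}
    (he : e ∈ (extChartAt (𝓡 C.dim) x).target) : Function.Injective (C.connInChart x e) := by
  intro v w hvw
  have h1 : C.conn _ _ = C.conn _ _ := hvw
  have h2 := C.conn_injective _ h1
  obtain ⟨eq, heq⟩ := mfderiv_chartInv_invertible he
  rw [← heq] at h2
  exact eq.injective h2

lemma connInChart_fieldInChart {x : C.Total} {e : EuclideanSpace ℝ (Fin C.dim)}
    (he : e ∈ (extChartAt (𝓡 C.dim) x).target) (V : (y : C.Total) → TangentSpace (𝓡 C.dim) y) :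
    C.connInChart x e (fieldInChart x V e) = entries (C.conn (chartInv x e) (V (chartInv x e))) := by
  have := mfderiv_fieldInChart he V
  exact congrArg (fun w => entries (C.conn (chartInv x e) w)) this

lemma conn_mlieBracket (x : C.Total) (V W : (y : C.Total) → TangentSpace (𝓡 C.dim) y) :
    entries (C.conn x (VectorField.mlieBracket (𝓡 C.dim) V W x)) =
      C.connInChart x (extChartAt (𝓡 C.dim) x x)
        (VectorField.lieBracket ℝ (E := EuclideanSpace ℝ (Fin C.dim)) (fieldInChart x V)
          (fieldInChart x W) (extChartAt (𝓡 C.dim) x x)) :=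
  congrArg entries ((congrArg (C.conn x) (mlieBracket_eq x V W)).trans
    (C.conn_eq_of_eq (chartInv_self x).symm _))

/-- The structure equation for vector fields on which the Cartan connection is constant. -/
lemma conn_mlieBracket_const (x : C.Total) {a b : Matrix N N ℝ}
    {V W : (y : C.Total) → TangentSpace (𝓡 C.dim) y} (hV : ∀ y, C.conn y (V y) = a)
    (hW : ∀ y, C.conn y (W y) = b) :
    entries (C.conn x (VectorField.mlieBracket (𝓡 C.dim) V W x)) =
      -dForm (C.connInChart x) (extChartAt (𝓡 C.dim) x x)
        (fieldInChart x V (extChartAt (𝓡 C.dim) x x))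
        (fieldInChart x W (extChartAt (𝓡 C.dim) x x)) := by
  set e₀ := extChartAt (𝓡 C.dim) x x
  have he₀ : e₀ ∈ (extChartAt (𝓡 C.dim) x).target := mem_extChartAt_target x
  have hΩ := C.connInChart_smoothAt he₀
  have hev : ∀ᶠ e in 𝓝 e₀, e ∈ (extChartAt (𝓡 C.dim) x).target := (isOpen_target x).mem_nhds he₀
  -- The connection takes values in a larger space of matrices. Composed with a left inverse at the
  -- centre it becomes a square operator, invertible nearby; solving with it shows that fields with
  -- constant connection value are automatically smooth.
  obtain ⟨T, hT⟩ := LinearMap.exists_leftInverse_of_injective (C.connInChart x e₀).toLinearMap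
    (LinearMap.ker_eq_bot.2 (C.connInChart_injective he₀))
  let T' : (N → N → ℝ) →L[ℝ] EuclideanSpace ℝ (Fin C.dim) := LinearMap.toContinuousLinearMap T
  have hB : ContDiffAt ℝ ∞ (fun e => T'.comp (C.connInChart x e)) e₀ :=
    contDiffAt_const.clm_comp hΩ
  have hB0 : Function.Bijective (T'.comp (C.connInChart x e₀)) := by
    have : T'.comp (C.connInChart x e₀) = ContinuousLinearMap.id ℝ _ := by
      ext1 v
      exact LinearMap.congr_fun hT v
    rw [this]
    exact Function.bijective_id
  have key : ∀ (V : (y : C.Total) → TangentSpace (𝓡 C.dim) y) (a : Matrix N N ℝ),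
      (∀ y, C.conn y (V y) = a) → (∀ᶠ e in 𝓝 e₀, C.connInChart x e (fieldInChart x V e) = entries a) ∧
        DifferentiableAt ℝ (fieldInChart x V) e₀ := by
    intro V a hV
    have h1 : ∀ᶠ e in 𝓝 e₀, C.connInChart x e (fieldInChart x V e) = entries a := by
      filter_upwards [hev] with e he
      rw [C.connInChart_fieldInChart he, hV]
    refine ⟨h1, ?_⟩
    have h2 := contDiffAt_inverse_apply hB hB0 (T' (entries a))
    refine (h2.congr_of_eventuallyEq ?_).differentiableAt (by simp)
    filter_upwards [h1, eventually_bijective hB.continuousAt hB0] with e h3 h4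
    refine h4.1 ?_
    rw [apply_inverse_apply h4, ContinuousLinearMap.comp_apply, h3]
  obtain ⟨hV1, hV2⟩ := key V a hV
  obtain ⟨hW1, hW2⟩ := key W b hW
  rw [C.conn_mlieBracket, apply_lieBracket (hΩ.differentiableAt (by simp)) hV2 hW2,
    Filter.EventuallyEq.fderiv_eq (f := fun _ => entries b) hW1,
    Filter.EventuallyEq.fderiv_eq (f := fun _ => entries a) hV1]
  simp

end CartanGeometry

/-! ## Brackets of sections of the distribution -/

section Brackets

variable {n m : ℕ} {M : Type u} [TopologicalSpace M] [ChartedSpace (EuclideanSpace ℝ (Fin m)) M]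
  [IsManifold (𝓡 m) ∞ M] {C : FreeGeometry.{u, v} n m M}

/-- For fields with constant values a and b the structure equation gives dω = -ω([V, W]); regularity
for k = l = -1 replaces this by -[a, b] modulo 𝔤₍₋₁₎, that is, in the y-x entries. -/
lemma IsRegular.dForm_apply (hC : IsRegular C) (x : C.Total) {v w : EuclideanSpace ℝ (Fin C.dim)}
    {a b : Matrix (Idx n) (Idx n) ℝ} (ha : a ∈ filtNegOne n) (hb : b ∈ filtNegOne n)
    (hv : C.connInChart x (extChartAt (𝓡 C.dim) x x) v = entries a)
    (hw : C.connInChart x (extChartAt (𝓡 C.dim) x x) w = entries b) (i j : Fin n) :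
    dForm (C.connInChart x) (extChartAt (𝓡 C.dim) x x) v w (iy i) (ix j) =
      -(a * b - b * a) (iy i) (ix j) := by
  have hex : ∀ a ∈ filtNegOne n, ∀ y, ∃ ξ, C.conn y ξ = a := by
    intro a ha y
    have : a ∈ Set.range (C.conn y) := by rw [C.conn_range]; exact ha.1
    exact this
  -- A pointwise choice suffices: the field is determined by its constant value, and its smoothness
  -- is part of `conn_mlieBracket_const`.
  choose V hV using hex a ha
  choose W hW using hex b hb
  have he := mem_extChartAt_target (I := 𝓡 C.dim) x
  have h1 : fieldInChart x V (extChartAt (𝓡 C.dim) x x) = v := C.connInChart_injective he <| by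
    rw [C.connInChart_fieldInChart he, hV, hv]
  have h2 : fieldInChart x W (extChartAt (𝓡 C.dim) x x) = w := C.connInChart_injective he <| by
    rw [C.connInChart_fieldInChart he, hW, hw]
  have h3 := C.conn_mlieBracket_const x hV hW
  rw [h1, h2] at h3
  have h4 := hC (-1) (-1) a ha b hb V W hV hW x
  norm_num at h4
  have h5 := (mem_filt_iff.1 h4).2 i j
  have h6 : C.conn x (VectorField.mlieBracket (𝓡 C.dim) V W x) (iy i) (ix j) =
      -dForm (C.connInChart x) (extChartAt (𝓡 C.dim) x x) v w (iy i) (ix j) :=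
    congrFun (congrFun h3 (iy i)) (ix j)
  rw [Matrix.sub_apply] at h5
  linarith

lemma fderiv_entry {E : Type*} [NormedAddCommGroup E] [NormedSpace ℝ E] {N : Type} [Fintype N]
    {f : E → N → N → ℝ} {e : E} (hf : DifferentiableAt ℝ f e) {i j : N}
    (h : ∀ᶠ y in 𝓝 e, f y i j = 0) (v : E) : fderiv ℝ f e v i j = 0 := by
  let L : (N → N → ℝ) →L[ℝ] ℝ :=
    (ContinuousLinearMap.proj j : (N → ℝ) →L[ℝ] ℝ).comp (ContinuousLinearMap.proj i)
  have h1 : fderiv ℝ (fun y => L (f y)) e = L.comp (fderiv ℝ f e) :=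
    (L.hasFDerivAt.comp e hf.hasFDerivAt).fderiv
  have h2 : fderiv ℝ (fun y => L (f y)) e = 0 := by
    have h3 : (fun y => L (f y)) =ᶠ[𝓝 e] fun _ => (0 : ℝ) := h
    rw [h3.fderiv_eq]
    simp
  exact congrArg (fun T : E →L[ℝ] ℝ => T v) (h1.symm.trans h2)

/-- Apply the Cartan formula to the gauge form Θ = s*ω. The y-x entries of Θ(X) and Θ(Y) vanish near
`b`, so only -dΘ(X, Y) remains; this is the pullback of -dω, which regularity computes. -/
lemma IsRegular.pull_mlieBracket_apply (hC : IsRegular C) {U : Set M} {s : M → C.Total}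
    (hs : C.IsSection U s) {b : M} (hb : b ∈ U) {X Y : (y : M) → TangentSpace (𝓡 m) y}
    (hX : MDifferentiableAt (𝓡 m) (𝓡 m).tangent (fun y => (⟨y, X y⟩ : TangentBundle (𝓡 m) M)) b)
    (hY : MDifferentiableAt (𝓡 m) (𝓡 m).tangent (fun y => (⟨y, Y y⟩ : TangentBundle (𝓡 m) M)) b)
    (hX' : ∀ᶠ y in 𝓝 b, C.pull (𝓡 m) s y (X y) ∈ filtNegOne n)
    (hY' : ∀ᶠ y in 𝓝 b, C.pull (𝓡 m) s y (Y y) ∈ filtNegOne n) (i j : Fin n) :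
    C.pull (𝓡 m) s b (VectorField.mlieBracket (𝓡 m) X Y b) (iy i) (ix j) =
      (C.pull (𝓡 m) s b (X b) * C.pull (𝓡 m) s b (Y b) -
        C.pull (𝓡 m) s b (Y b) * C.pull (𝓡 m) s b (X b)) (iy i) (ix j) := by
  set e₀ := extChartAt (𝓡 m) b b with he₀def
  have he₀ : e₀ ∈ (extChartAt (𝓡 m) b).target := mem_extChartAt_target b
  have hself : chartInv b e₀ = b := chartInv_self b
  have hcont : ContinuousAt (chartInv b) e₀ := (chartInv_smoothAt he₀).continuousAt
  have hto : Filter.Tendsto (chartInv b) (𝓝 e₀) (𝓝 b) := by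
    have := hcont.tendsto
    rwa [hself] at this
  have hev : ∀ᶠ e in 𝓝 e₀, e ∈ (extChartAt (𝓡 m) b).target := (isOpen_target b).mem_nhds he₀
  have hevU : ∀ᶠ e in 𝓝 e₀, chartInv b e ∈ U := hto.eventually (hs.isOpen.mem_nhds hb)
  set g : EuclideanSpace ℝ (Fin m) → C.Total := fun e => s (chartInv b e) with hg
  have hgs : ∀ e ∈ (extChartAt (𝓡 m) b).target, chartInv b e ∈ U →
      ContMDiffAt 𝓘(ℝ, EuclideanSpace ℝ (Fin m)) (𝓡 C.dim) ∞ g e := fun e h1 h2 =>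
    (hs.smooth _ h2).comp e (chartInv_smoothAt h1)
  have hg0 : g e₀ = s b := congrArg s hself
  have hgs0 := hgs e₀ he₀ (by rw [hself]; exact hb)
  set χ := extChartAt (𝓡 C.dim) (s b) with hχ
  -- The section, read in charts of the base and of the total space; the gauge form in the chart is
  -- the pullback of the connection form along `S`.
  set S : EuclideanSpace ℝ (Fin m) → EuclideanSpace ℝ (Fin C.dim) := fun e => χ (g e) with hS
  have hS0 : S e₀ = χ (s b) := congrArg χ hg0
  have hSs : ContDiffAt ℝ ∞ S e₀ := by
    rw [← contMDiffAt_iff_contDiffAt]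
    refine ContMDiffAt.comp e₀ ?_ hgs0
    rw [hg0]
    exact contMDiffAt_extChartAt
  have hgS : ∀ᶠ e in 𝓝 e₀, g e = chartInv (s b) (S e) := by
    have : ∀ᶠ z in 𝓝 (g e₀), z ∈ χ.source := by
      rw [hg0]; exact extChartAt_source_mem_nhds (s b)
    filter_upwards [hgs0.continuousAt.eventually this] with e he
    exact (χ.left_inv he).symm
  have hΩ : ContDiffAt ℝ ∞ (C.connInChart (s b)) (S e₀) := by
    rw [hS0]; exact C.connInChart_smoothAt (mem_extChartAt_target _)
  have hΘ : C.pullL g =ᶠ[𝓝 e₀] fun e => (C.connInChart (s b) (S e)).comp (fderiv ℝ S e) := by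
    have h1 : ∀ᶠ e in 𝓝 e₀, S e ∈ χ.target := by
      refine hSs.continuousAt.eventually ?_
      rw [hS0]
      exact (isOpen_target (s b)).mem_nhds (mem_extChartAt_target _)
    have h2 : ∀ᶠ e in 𝓝 e₀, DifferentiableAt ℝ S e := by
      have h3 : ContDiffAt ℝ 1 S e₀ := hSs.of_le (by simp)
      exact (h3.eventually (by simp)).mono fun e he => he.differentiableAt (by simp)
    filter_upwards [hgS.eventually_nhds, h1, h2] with e h3 h4 h5
    rw [C.pullL_congr (g := fun e => chartInv (s b) (S e)) h3]
    exact C.pullL_comp ((chartInv_smoothAt h4).mdifferentiableAt (by simp)) h5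
  have hΘd : DifferentiableAt ℝ (C.pullL g) e₀ := by
    refine ((hΩ.comp e₀ hSs).clm_comp (hSs.fderiv_right (m := ∞) (by simp))).congr_of_eventuallyEq hΘ
      |>.differentiableAt (by simp)
  have hfield : ∀ V : (y : M) → TangentSpace (𝓡 m) y, ∀ᶠ e in 𝓝 e₀,
      C.pullL g e (fieldInChart b V e) =
        entries (C.pull (𝓡 m) s (chartInv b e) (V (chartInv b e))) := by
    intro V
    filter_upwards [hev, hevU] with e h1 h2
    exact C.pullL_fieldInChart h1 ((hs.smooth _ h2).mdifferentiableAt (by simp)) V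
  have hpoint : ∀ V : (y : M) → TangentSpace (𝓡 m) y, C.pullL g e₀ (fieldInChart b V e₀) =
      entries (C.pull (𝓡 m) s b (V b)) := by
    intro V
    have h1 := (hfield V).self_of_nhds
    rw [h1]
    have : ∀ c, c = b → entries (C.pull (𝓡 m) s c (V c)) = entries (C.pull (𝓡 m) s b (V b)) := by
      rintro c rfl; rfl
    exact this _ hself
  have hzero : ∀ V : (y : M) → TangentSpace (𝓡 m) y,
      (∀ᶠ y in 𝓝 b, C.pull (𝓡 m) s y (V y) ∈ filtNegOne n) →
      ∀ᶠ e in 𝓝 e₀, C.pullL g e (fieldInChart b V e) (iy i) (ix j) = 0 := by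
    intro V hV
    filter_upwards [hfield V, hto.eventually hV] with e h1 h2
    rw [h1]
    exact (mem_filtNegOne.1 h2).2 i j
  have hXd := fieldInChart_differentiableAt b hX
  have hYd := fieldInChart_differentiableAt b hY
  have h1 := congrFun (congrFun (C.pull_mlieBracket
    ((hs.smooth b hb).mdifferentiableAt (by simp)) X Y) (iy i)) (ix j)
  rw [apply_lieBracket hΘd hXd hYd] at h1
  -- The two function terms of the Cartan formula contribute nothing to the y-x entries.
  have h2 := fderiv_entry (hΘd.clm_apply hXd) (hzero X hX') (fieldInChart b Y e₀)
  have h3 := fderiv_entry (hΘd.clm_apply hYd) (hzero Y hY') (fieldInChart b X e₀)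
  have hval : ∀ v, C.connInChart (s b) (χ (s b)) (fderiv ℝ S e₀ v) = C.pullL g e₀ v := by
    intro v
    rw [hΘ.self_of_nhds, ← hS0]
    rfl
  have h4 := hC.dForm_apply (s b) hX'.self_of_nhds hY'.self_of_nhds
    ((hval _).trans (hpoint X)) ((hval _).trans (hpoint Y)) i j
  have h5 := dForm_comp (hΩ.differentiableAt (by simp)) hSs (fieldInChart b X e₀) (fieldInChart b Y e₀)
  rw [← dForm_congr hΘ, hS0] at h5
  refine Eq.trans h1 ?_
  rw [h5]
  simp only [Pi.sub_apply]
  rw [h2, h3, h4]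
  ring

end Brackets

/-! ## The underlying distribution -/

section Distribution

variable {n m : ℕ} {M : Type u} [TopologicalSpace M] [ChartedSpace (EuclideanSpace ℝ (Fin m)) M]

/-- `pull` as a linear map. -/
def CartanGeometry.pullM {N : Type} [Fintype N] [DecidableEq N] {𝔤 : Submodule ℝ (Matrix N N ℝ)}
    {P : Subgroup (Matrix N N ℝ)ˣ} (C : CartanGeometry.{u, v} 𝔤 P (m := m) M) (s : M → C.Total)
    (b : M) : TangentSpace (𝓡 m) b →ₗ[ℝ] Matrix N N ℝ :=
  C.conn (s b) ∘ₗ (mfderiv (𝓡 m) (𝓡 C.dim) s b).toLinearMap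

variable {C : FreeGeometry.{u, v} n m M}

lemma tangentBundle_ext {a b : M} (h : a = b) (w : EuclideanSpace ℝ (Fin m)) :
    (⟨a, w⟩ : TangentBundle (𝓡 m) M) = ⟨b, w⟩ := by subst h; rfl

variable [IsManifold (𝓡 m) ∞ M]

/-- By `conn_eq`, the connection on ξ is the gauge form of the projection of ξ, conjugated by an
element of `P`, plus an element of `lieP`. Both operations respect 𝔤₍₋₁₎. -/
lemma mem_distribution_iff {U : Set M} {s : M → C.Total} (hs : C.IsSection U s) {b : M}
    (hb : b ∈ U) {X : TangentSpace (𝓡 m) b} :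
    X ∈ distribution C b ↔ C.pull (𝓡 m) s b X ∈ filtNegOne n := by
  constructor
  · have : distribution C b ≤ (filtNegOne n).comap (C.pullM s b) := by
      refine Submodule.span_le.2 ?_
      rintro X ⟨⟨x, ξ⟩, h1, h2⟩
      have h1' : C.conn x ξ ∈ filtNegOne n := h1
      cases h2
      change C.pull (𝓡 m) s (C.proj x) (mfderiv (𝓡 C.dim) (𝓡 m) C.proj x ξ) ∈ filtNegOne n
      rw [hs.conn_eq hb] at h1'
      set k := C.coord s x
      have h3 := lieP_le_filtNegOne
        ((parabolicPair n).toIsCayleyPair.log_deriv_mem (hs.coord_smooth hb) ξ)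
      have h4 := (add_mem_cancel_right h3).1 h1'
      have h5 := filtNegOne_conj ((k⁻¹).2) h4
      simpa [Matrix.mul_assoc] using h5
    exact fun h => this h
  · intro h
    refine Submodule.subset_span ⟨⟨s b, mfderiv (𝓡 m) (𝓡 C.dim) s b X⟩, h, ?_⟩
    exact (congrArg (Bundle.TotalSpace.mk _) (hs.mfderiv_proj hb X)).trans
      (tangentBundle_ext (hs.proj_eq b hb) X)

/-- The components of the gauge form of a section which are coordinates on the distribution. -/
def tCoord (s : M → C.Total) (b : M) (j : Fin n) : TangentSpace (𝓡 m) b →ₗ[ℝ] ℝ :=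
  Matrix.entryLinearMap ℝ ℝ it (ix j) ∘ₗ C.pullM s b

lemma tCoord_apply (s : M → C.Total) (b : M) (j : Fin n) (X : TangentSpace (𝓡 m) b) :
    tCoord s b j X = C.pull (𝓡 m) s b X it (ix j) := rfl

/-- In 𝔤₍₋₁₎ the t-x entries are the only obstruction to lying in `lieP`, on which the gauge form
has no nonzero preimage. -/
lemma eq_zero_of_tCoord {U : Set M} {s : M → C.Total} (hs : C.IsSection U s) {b : M}
    (hb : b ∈ U) {X : TangentSpace (𝓡 m) b} (hX : X ∈ distribution C b)
    (h : ∀ j, tCoord s b j X = 0) : X = 0 := by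
  rw [mem_distribution_iff hs hb, mem_filtNegOne] at hX
  refine hs.eq_zero_of_pull_mem (parabolicPair n).toIsCayleyPair hb (mem_lieP_iff.2 ⟨hX.1, ?_⟩)
  rintro (u | i) j
  · exact h j
  · exact hX.2 i j

/-- The element of `𝔤₍₋₁₎` with a given component. -/
def gradedBasis (n : ℕ) (i : Fin n) : Matrix (Idx n) (Idx n) ℝ := negPart (Pi.single i 1) 0

lemma gradedBasis_mem (i : Fin n) : gradedBasis n i ∈ filtNegOne n :=
  mem_filtNegOne.2 ⟨negPart_mem _ (fun i j => by simp), fun i j => rfl⟩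

/-- A frame of the distribution, with respect to a section. -/
def IsFrame (s : M → C.Total) (b : M) (X : Fin n → TangentSpace (𝓡 m) b) : Prop :=
  ∀ i, C.pull (𝓡 m) s b (X i) - gradedBasis n i ∈ lieP n

lemma IsFrame.mem {U : Set M} {s : M → C.Total} (hs : C.IsSection U s) {b : M} (hb : b ∈ U)
    {X : Fin n → TangentSpace (𝓡 m) b} (hX : IsFrame s b X) (i : Fin n) :
    X i ∈ distribution C b := by
  rw [mem_distribution_iff hs hb]
  have := add_mem (lieP_le_filtNegOne (hX i)) (gradedBasis_mem i)
  rwa [sub_add_cancel] at this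

lemma IsFrame.tCoord {s : M → C.Total} {b : M} {X : Fin n → TangentSpace (𝓡 m) b}
    (hX : IsFrame s b X) (i j : Fin n) : tCoord s b j (X i) = if i = j then 1 else 0 := by
  have h := (mem_lieP_iff.1 (hX i)).2 (Sum.inl ()) j
  rw [Matrix.sub_apply, sub_eq_zero] at h
  rw [tCoord_apply]
  refine h.trans ?_
  simp [gradedBasis, negPart, Pi.single_apply, eq_comm]

lemma IsFrame.sum_smul {U : Set M} {s : M → C.Total} (hs : C.IsSection U s) {b : M} (hb : b ∈ U)
    {X : Fin n → TangentSpace (𝓡 m) b} (hX : IsFrame s b X) {Y : TangentSpace (𝓡 m) b}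
    (hY : Y ∈ distribution C b) : ∑ i, FreeDist.tCoord s b i Y • X i = Y := by
  rw [eq_comm, ← sub_eq_zero]
  refine eq_zero_of_tCoord hs hb (sub_mem hY (sum_mem fun i _ =>
    Submodule.smul_mem _ _ (hX.mem hs hb i))) fun j => ?_
  rw [map_sub, map_sum]
  simp [hX.tCoord]

lemma IsFrame.linearIndependent {s : M → C.Total} {b : M} {X : Fin n → TangentSpace (𝓡 m) b}
    (hX : IsFrame s b X) : LinearIndependent ℝ X := by
  rw [Fintype.linearIndependent_iff]
  intro c hc i
  have := congrArg (FreeDist.tCoord s b i) hc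
  rw [map_sum, map_zero] at this
  simpa [hX.tCoord] using this

lemma IsFrame.span_eq {U : Set M} {s : M → C.Total} (hs : C.IsSection U s) {b : M} (hb : b ∈ U)
    {X : Fin n → TangentSpace (𝓡 m) b} (hX : IsFrame s b X) :
    Submodule.span ℝ (Set.range X) = distribution C b := by
  refine le_antisymm (Submodule.span_le.2 ?_) fun Y hY => ?_
  · rintro _ ⟨i, rfl⟩
    exact hX.mem hs hb i
  · rw [← hX.sum_smul hs hb hY]
    exact sum_mem fun i _ => Submodule.smul_mem _ _ (Submodule.subset_span ⟨i, rfl⟩)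

/-- Existence of smooth frames. -/
lemma exists_smooth_frame {U : Set M} {s : M → C.Total} (hs : C.IsSection U s) {b : M}
    (hb : b ∈ U) : ∃ V ⊆ U, IsOpen V ∧ b ∈ V ∧ ∃ X : Fin n → (y : M) → TangentSpace (𝓡 m) y,
      (∀ i, IsSmoothField (X i) V) ∧ ∀ y ∈ V, IsFrame s y fun i => X i y := by
  set e₀ := extChartAt (𝓡 m) b b with he₀def
  have he₀ : e₀ ∈ (extChartAt (𝓡 m) b).target := mem_extChartAt_target b
  have hself : chartInv b e₀ = b := chartInv_self b
  set g : EuclideanSpace ℝ (Fin m) → C.Total := fun e => s (chartInv b e) with hg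
  let O : Set (EuclideanSpace ℝ (Fin m)) := (extChartAt (𝓡 m) b).target ∩ chartInv b ⁻¹' U
  have hO : IsOpen O := (contMDiffOn_extChartAt_symm (I := 𝓡 m) (n := ∞) b).continuousOn.isOpen_inter_preimage
    (isOpen_target b) hs.isOpen
  have hgs : ∀ e ∈ O, ContMDiffAt 𝓘(ℝ, EuclideanSpace ℝ (Fin m)) (𝓡 C.dim) ∞ g e := fun e he =>
    (hs.smooth _ he.2).comp e (chartInv_smoothAt he.1)
  have hΘ := C.pullL_smooth hO hgs
  have hΘ' : ∀ e ∈ O, ∀ v : EuclideanSpace ℝ (Fin m), C.pullL g e v = entries (C.pull (𝓡 m) s (chartInv b e)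
      (mfderiv 𝓘(ℝ, EuclideanSpace ℝ (Fin m)) (𝓡 m) (chartInv b) e v)) := fun e he v =>
    congrArg entries (C.pull_comp ((hs.smooth _ he.2).mdifferentiableAt (by simp))
      ((chartInv_smoothAt he.1).mdifferentiableAt (by simp)) v)
  have he₀O : e₀ ∈ O := ⟨he₀, by change chartInv b e₀ ∈ U; rw [hself]; exact hb⟩
  have hker : ∀ e ∈ O, ∀ v : EuclideanSpace ℝ (Fin m), (entriesL _).symm (C.pullL g e v) ∈ lieP n → v = 0 := by
    intro e he v hv
    rw [hΘ' e he] at hv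
    have h1 := hs.eq_zero_of_pull_mem (parabolicPair n).toIsCayleyPair he.2 hv
    obtain ⟨eq, heq⟩ := mfderiv_chartInv_invertible he.1
    rw [← heq] at h1
    exact eq.injective (h1.trans eq.map_zero.symm)
  let Q : (Idx n → Idx n → ℝ) →ₗ[ℝ] (Matrix (Idx n) (Idx n) ℝ ⧸ lieP n) :=
    (lieP n).mkQ ∘ₗ (entriesL _).symm.toLinearMap
  -- Modulo `lieP` the gauge form is injective at the centre. Its left inverse gives a linear map
  -- `T'` independent of the point, against which the gauge form becomes a square operator, the
  -- identity at the centre.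
  obtain ⟨T, hT⟩ := LinearMap.exists_leftInverse_of_injective (Q ∘ₗ (C.pullL g e₀).toLinearMap) (by
    refine LinearMap.ker_eq_bot'.2 fun v hv => hker e₀ he₀O v ?_
    exact (Submodule.Quotient.mk_eq_zero _).1 hv)
  let T' : (Idx n → Idx n → ℝ) →L[ℝ] EuclideanSpace ℝ (Fin m) :=
    LinearMap.toContinuousLinearMap (T ∘ₗ Q)
  -- On `lieG` the map `T'` detects the class modulo `lieP`, because the gauge form at the centre
  -- maps onto lieG/lieP.
  have hT'ker : ∀ A ∈ lieG n, T' (entries A) = 0 → A ∈ lieP n := by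
    intro A hA hTA
    obtain ⟨ξ, hξ⟩ := hs.exists_pull_sub_mem (parabolicPair n).toIsCayleyPair hb hA
    have hex : ∃ v : EuclideanSpace ℝ (Fin m), (entriesL _).symm (C.pullL g e₀ v) - A ∈ lieP n := by
      obtain ⟨v, hv⟩ : ∃ v : EuclideanSpace ℝ (Fin m), (mfderiv 𝓘(ℝ, EuclideanSpace ℝ (Fin m)) (𝓡 m)
          (chartInv b) e₀ v : EuclideanSpace ℝ (Fin m)) = ξ := by
        obtain ⟨eq, heq⟩ := mfderiv_chartInv_invertible he₀
        rw [← heq]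
        exact eq.surjective ξ
      refine ⟨v, ?_⟩
      rw [hΘ' e₀ he₀O]
      have h3 : C.pull (𝓡 m) s (chartInv b e₀) (mfderiv 𝓘(ℝ, EuclideanSpace ℝ (Fin m)) (𝓡 m)
          (chartInv b) e₀ v) = C.pull (𝓡 m) s b ξ :=
        (congrArg (C.pull (𝓡 m) s (chartInv b e₀)) hv).trans (C.pull_eq_of_eq hself ξ)
      exact h3 ▸ hξ
    obtain ⟨v, hv⟩ := hex
    have h1 : Q (C.pullL g e₀ v) = Q (entries A) := (Submodule.Quotient.eq _).2 hv
    have h2 : T' (C.pullL g e₀ v) = v := LinearMap.congr_fun hT v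
    have h3 : T' (C.pullL g e₀ v) = T' (entries A) := congrArg T h1
    rw [← h3, h2] at hTA
    subst hTA
    rw [map_zero] at h1
    exact (Submodule.Quotient.mk_eq_zero _).1 ((map_zero Q).symm.trans h1).symm
  set B : EuclideanSpace ℝ (Fin m) → EuclideanSpace ℝ (Fin m) →L[ℝ] EuclideanSpace ℝ (Fin m) :=
    fun e => T'.comp (C.pullL g e) with hBdef
  have hB : ContDiffOn ℝ ∞ B O := contDiffOn_const.clm_comp hΘ
  have hB0 : Function.Bijective (B e₀) := by
    have : B e₀ = ContinuousLinearMap.id ℝ _ := by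
      ext1 v
      exact LinearMap.congr_fun hT v
    rw [this]
    exact Function.bijective_id
  have hBat : ∀ e ∈ O, ContDiffAt ℝ ∞ B e := fun e he => hB.contDiffAt (hO.mem_nhds he)
  obtain ⟨O', hO'sub, hO'open, he₀O'⟩ := mem_nhds_iff.1
    ((eventually_bijective (hBat e₀ he₀O).continuousAt hB0).and (hO.mem_nhds he₀O))
  -- The frame solves the linear equation that its gauge form has the prescribed class modulo
  -- `lieP`; solutions depend smoothly on the point.
  set V : Fin n → EuclideanSpace ℝ (Fin m) → EuclideanSpace ℝ (Fin m) := fun i e =>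
    (B e).inverse (T' (entries (gradedBasis n i))) with hV
  have hVs : ∀ i, ∀ e ∈ O', ContDiffAt ℝ ∞ (V i) e := fun i e he =>
    contDiffAt_inverse_apply (hBat e (hO'sub he).2) (hO'sub he).1 _
  have hVframe : ∀ i, ∀ e ∈ O', (entriesL _).symm (C.pullL g e (V i e)) - gradedBasis n i ∈ lieP n := by
    intro i e he
    have h1 : T' (C.pullL g e (V i e)) = T' (entries (gradedBasis n i)) :=
      apply_inverse_apply (hO'sub he).1 _
    refine hT'ker _ (sub_mem ?_ (mem_filtNegOne.1 (gradedBasis_mem i)).1) ?_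
    · rw [hΘ' e (hO'sub he).2]
      exact C.pull_mem _ _
    · have h2 : T' (C.pullL g e (V i e) - entries (gradedBasis n i)) = 0 := by
        rw [map_sub, h1, sub_self]
      exact h2
  let Vs : Set M := (extChartAt (𝓡 m) b).source ∩ extChartAt (𝓡 m) b ⁻¹' O'
  have hVs_open : IsOpen Vs := (continuousOn_extChartAt b).isOpen_inter_preimage
    (isOpen_extChartAt_source b) hO'open
  have hinv : ∀ y ∈ Vs, chartInv b (extChartAt (𝓡 m) b y) = y := fun y hy =>
    (extChartAt (𝓡 m) b).left_inv hy.1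
  refine ⟨Vs, fun y hy => ?_, hVs_open, ⟨mem_extChartAt_source b, he₀O'⟩,
    fun i y => (mfderiv 𝓘(ℝ, EuclideanSpace ℝ (Fin m)) (𝓡 m) (chartInv b) (extChartAt (𝓡 m) b y)
      (V i (extChartAt (𝓡 m) b y)) : EuclideanSpace ℝ (Fin m)), ?_, ?_⟩
  · have h1 : chartInv b (extChartAt (𝓡 m) b y) ∈ U := (hO'sub hy.2).2.2
    rwa [hinv y hy] at h1
  · intro i y hy
    refine ContMDiffAt.contMDiffWithinAt ?_
    have : IsManifold (𝓡 m) 1 M := IsManifold.of_le (n := ∞) (by simp)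
    have h1 := (contMDiffOn_extChartAt_symm (I := 𝓡 m) (n := ∞) b).contMDiffOn_tangentMapWithin
      (m := ∞) (by simp) (isOpen_target b).uniqueMDiffOn
    have hopen : IsOpen (Bundle.TotalSpace.proj ⁻¹' (extChartAt (𝓡 m) b).target :
        Set (TangentBundle 𝓘(ℝ, EuclideanSpace ℝ (Fin m)) (EuclideanSpace ℝ (Fin m)))) :=
      (isOpen_target b).preimage (FiberBundle.continuous_proj _ _)
    have h2 : ContMDiffAt (𝓡 m) 𝓘(ℝ, EuclideanSpace ℝ (Fin m)) ∞ (extChartAt (𝓡 m) b) y :=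
      contMDiffAt_extChartAt' (by rw [← extChartAt_source (I := 𝓡 m)]; exact hy.1)
    have h3 : ContMDiffAt 𝓘(ℝ, EuclideanSpace ℝ (Fin m)) 𝓘(ℝ, EuclideanSpace ℝ (Fin m)).tangent ∞
        (fun e => (⟨e, V i e⟩ : TangentBundle 𝓘(ℝ, EuclideanSpace ℝ (Fin m)) (EuclideanSpace ℝ (Fin m))))
        (extChartAt (𝓡 m) b y) :=
      contMDiffAt_vectorSpace_iff_contDiffAt.2 (hVs i _ hy.2)
    have hyt : extChartAt (𝓡 m) b y ∈ (extChartAt (𝓡 m) b).target :=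
      (extChartAt (𝓡 m) b).map_source hy.1
    have h4 := ((h1.contMDiffAt (x := ⟨extChartAt (𝓡 m) b y, V i (extChartAt (𝓡 m) b y)⟩)
      (hopen.mem_nhds hyt)).comp _ h3).comp y h2
    refine h4.congr_of_eventuallyEq ?_
    filter_upwards [hVs_open.mem_nhds hy] with z hz
    have hzt : extChartAt (𝓡 m) b z ∈ (extChartAt (𝓡 m) b).target :=
      (extChartAt (𝓡 m) b).map_source hz.1
    simp only [Function.comp_apply]
    rw [tangentMapWithin_eq_tangentMap ((isOpen_target b).uniqueMDiffOn _ hzt)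
      ((chartInv_smoothAt hzt).mdifferentiableAt (by simp))]
    exact (tangentBundle_ext (hinv z hz) _).symm
  · intro y hy i
    have h1 := hVframe i _ hy.2
    rw [hΘ' _ (hO'sub hy.2).2] at h1
    have h2 := C.pull_eq_of_eq (f := s) (hinv y hy) (mfderiv 𝓘(ℝ, EuclideanSpace ℝ (Fin m)) (𝓡 m) (chartInv b)
      (extChartAt (𝓡 m) b y) (V i (extChartAt (𝓡 m) b y)))
    exact h2 ▸ h1

lemma isSmoothDistribution (C : FreeGeometry.{u, v} n m M) :
    IsSmoothDistribution n (distribution C) := by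
  intro b
  obtain ⟨x, rfl⟩ := C.exists_proj_eq b
  obtain ⟨U, s, hb, hs, -⟩ := C.exists_section x
  obtain ⟨V, hVU, hV, hbV, X, hX, hf⟩ := exists_smooth_frame hs hb
  exact ⟨V, hV, hbV, X, hX, fun y hy =>
    ⟨(hf y hy).linearIndependent, (hf y hy).span_eq hs (hVU hy)⟩⟩

/-! ## Freeness -/

/-- The wedge product of two vectors, as a bilinear map. -/
def wedge (V : Type*) [AddCommGroup V] [Module ℝ V] : V →ₗ[ℝ] V →ₗ[ℝ] ⋀[ℝ]^2 V :=
  have hswap : ∀ u v : V, exteriorPower.ιMulti ℝ 2 ![u, v] = -exteriorPower.ιMulti ℝ 2 ![v, u] :=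
    fun u v => by
      rw [← AlternatingMap.map_swap _ _ (show (0 : Fin 2) ≠ 1 by decide)]
      congr 1
      funext i
      fin_cases i <;> rfl
  LinearMap.mk₂ ℝ (fun u v => exteriorPower.ιMulti ℝ 2 ![u, v])
    (fun u u' v => AlternatingMap.map_vecCons_add _ ![v] u u')
    (fun r u v => AlternatingMap.map_vecCons_smul _ ![v] r u)
    (fun u v v' => by
      rw [hswap, hswap u v, hswap u v', ← neg_add]
      exact congrArg Neg.neg (AlternatingMap.map_vecCons_add _ ![u] v v'))
    (fun r u v => by
      rw [hswap, hswap u v, smul_neg]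
      exact congrArg Neg.neg (AlternatingMap.map_vecCons_smul _ ![u] r v))

lemma wedge_apply {V : Type*} [AddCommGroup V] [Module ℝ V] (u v : V) :
    wedge V u v = exteriorPower.ιMulti ℝ 2 ![u, v] := rfl

lemma wedge_swap {V : Type*} [AddCommGroup V] [Module ℝ V] (u v : V) :
    wedge V u v = -wedge V v u := by
  rw [wedge_apply, wedge_apply, ← AlternatingMap.map_swap _ _ (show (0 : Fin 2) ≠ 1 by decide)]
  congr 1
  funext i
  fin_cases i <;> rfl

/-- The alternating matrix belonging to a pair of vectors with given coordinates. -/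
def wedgeMatrix {n : ℕ} {V : Type*} [AddCommGroup V] [Module ℝ V] (β : Fin n → V →ₗ[ℝ] ℝ) :
    V [⋀^Fin 2]→ₗ[ℝ] Matrix (Fin n) (Fin n) ℝ where
  toFun w := Matrix.of fun i j => β i (w 1) * β j (w 0) - β i (w 0) * β j (w 1)
  map_update_add' w k x y := by
    ext i j
    fin_cases k <;> simp <;> ring
  map_update_smul' w k r x := by
    ext i j
    fin_cases k <;> simp <;> ring
  map_eq_zero_of_eq' w k l hkl hne := by
    have : w 0 = w 1 := by
      fin_cases k <;> fin_cases l <;> simp_all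
    ext i j
    simp [this]

/-- If a vector space is identified with the alternating matrices, it is identified with the second
exterior power of a vector space with coordinates. -/
lemma exists_wedge_equiv {n : ℕ} {V W : Type*} [AddCommGroup V] [Module ℝ V] [AddCommGroup W]
    [Module ℝ W] (β : Fin n → V →ₗ[ℝ] ℝ) (e : Fin n → V)
    (he : ∀ i j, β j (e i) = if i = j then 1 else 0) (hsum : ∀ v, ∑ i, β i v • e i = v)
    (γ : W →ₗ[ℝ] Matrix (Fin n) (Fin n) ℝ) (hγ : Function.Injective γ)
    (hγalt : ∀ w i j, γ w i j = -γ w j i)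
    (hγsurj : ∀ A : Matrix (Fin n) (Fin n) ℝ, (∀ i j, A i j = -A j i) → ∃ w, γ w = A) :
    ∃ L : (⋀[ℝ]^2 V) ≃ₗ[ℝ] W, ∀ u v z, (∀ i j, γ z i j = β i v * β j u - β i u * β j v) →
      L (exteriorPower.ιMulti ℝ 2 ![u, v]) = z := by
  let Λ : ⋀[ℝ]^2 V →ₗ[ℝ] Matrix (Fin n) (Fin n) ℝ :=
    exteriorPower.alternatingMapLinearEquiv (wedgeMatrix β)
  have hΛ : ∀ u v i j, Λ (wedge V u v) i j = β i v * β j u - β i u * β j v := fun u v i j => by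
    simp only [Λ, wedge_apply, exteriorPower.alternatingMapLinearEquiv_apply_ιMulti]
    rfl
  -- The matrix of u ∧ v has entries v_i u_j - u_i v_j, so summing it against e_i ∧ e_j gives v ∧ u
  -- - u ∧ v = -2 u ∧ v; hence the factor -1/2.
  let R : Matrix (Fin n) (Fin n) ℝ →ₗ[ℝ] ⋀[ℝ]^2 V :=
    (-1 / 2 : ℝ) • ∑ i, ∑ j, (Matrix.entryLinearMap ℝ ℝ i j).smulRight (wedge V (e i) (e j))
  have hR : ∀ A, R A = (-1 / 2 : ℝ) • ∑ i, ∑ j, A i j • wedge V (e i) (e j) := fun A => by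
    simp [R]
  have hexp : ∀ u v, wedge V u v = ∑ i, ∑ j, (β i u * β j v) • wedge V (e i) (e j) := fun u v => by
    conv_lhs => rw [← hsum u, ← hsum v]
    simp only [map_sum, LinearMap.sum_apply, map_smul, LinearMap.smul_apply, Finset.smul_sum,
      smul_smul]
    rw [Finset.sum_comm]
    refine Finset.sum_congr rfl fun i _ => Finset.sum_congr rfl fun j _ => ?_
    first | rfl | rw [mul_comm]
  have hRw : ∀ u v (A : Matrix (Fin n) (Fin n) ℝ), (∀ i j, A i j = β i v * β j u - β i u * β j v) →
      R A = wedge V u v := by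
    intro u v A hA
    rw [hR]
    have h1 : ∑ i, ∑ j, A i j • wedge V (e i) (e j) = wedge V v u - wedge V u v := by
      rw [hexp v u, hexp u v, ← Finset.sum_sub_distrib]
      refine Finset.sum_congr rfl fun i _ => ?_
      rw [← Finset.sum_sub_distrib]
      refine Finset.sum_congr rfl fun j _ => ?_
      rw [hA]
      exact sub_smul (β i v * β j u) (β i u * β j v) (wedge V (e i) (e j))
    rw [h1, wedge_swap v u]
    module
  have hRΛ : R ∘ₗ Λ = LinearMap.id := by
    refine exteriorPower.linearMap_ext ?_
    ext a : 1
    have ha : a = ![a 0, a 1] := by funext i; fin_cases i <;> rfl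
    rw [ha]
    exact hRw (a 0) (a 1) _ (hΛ _ _)
  have hΛR : ∀ A : Matrix (Fin n) (Fin n) ℝ, (∀ i j, A i j = -A j i) → Λ (R A) = A := by
    intro A hA
    ext i j
    rw [hR]
    simp only [map_smul, map_sum, Matrix.smul_apply, Matrix.sum_apply, hΛ, he, smul_eq_mul]
    have h1 : ∀ k l : Fin n, A k l * ((if l = i then (1 : ℝ) else 0) * (if k = j then 1 else 0) -
        (if k = i then 1 else 0) * (if l = j then 1 else 0)) =
        (if l = i then (if k = j then A k l else 0) else 0) -
        (if k = i then (if l = j then A k l else 0) else 0) := by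
      intro k l
      split_ifs <;> ring
    simp only [h1, Finset.sum_sub_distrib]
    simp
    linarith [hA i j]
  have halt : ∀ w i j, Λ w i j = -Λ w j i := by
    intro w i j
    have h : (Matrix.entryLinearMap ℝ ℝ i j ∘ₗ Λ) = -(Matrix.entryLinearMap ℝ ℝ j i ∘ₗ Λ) := by
      refine exteriorPower.linearMap_ext ?_
      ext a : 1
      have ha : a = ![a 0, a 1] := by funext i; fin_cases i <;> rfl
      rw [ha]
      change Λ (wedge V (a 0) (a 1)) i j = -Λ (wedge V (a 0) (a 1)) j i
      rw [hΛ, hΛ]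
      ring
    exact LinearMap.congr_fun h w
  -- The map `R` inverts `Λ` on alternating matrices, and these are exactly the values of `γ`.
  have hbij : Function.Bijective (R ∘ₗ γ) := by
    constructor
    · intro w w' hw
      refine hγ ?_
      rw [← hΛR _ (hγalt w), ← hΛR _ (hγalt w')]
      exact congrArg Λ hw
    · intro w
      obtain ⟨z, hz⟩ := hγsurj (Λ w) (halt w)
      exact ⟨z, by rw [LinearMap.comp_apply, hz]; exact LinearMap.congr_fun hRΛ w⟩
  refine ⟨(LinearEquiv.ofBijective _ hbij).symm, fun u v z hz => ?_⟩
  rw [LinearEquiv.symm_apply_eq]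
  exact (hRw u v _ hz).symm

/-- The t-x entries of the gauge form are coordinates on the distribution H, and its y-x block
identifies TM/H with the alternating matrices. By regularity and `commutator_apply`, the Lie bracket
corresponds to the matrix of the wedge product. -/
lemma IsRegular.isFree (hC : IsRegular C) : IsFree n (distribution C) := by
  refine ⟨isSmoothDistribution C, fun b => ?_⟩
  obtain ⟨x, hx⟩ := C.exists_proj_eq b
  obtain ⟨U, s, hb, hs, -⟩ := C.exists_section x
  rw [hx] at hb
  obtain ⟨V, hVU, hV, hbV, X, hX, hf⟩ := exists_smooth_frame hs hb
  have hfb := hf b hbV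
  -- The y-x block of the gauge form; its kernel is the distribution.
  let γ : TangentSpace (𝓡 m) b →ₗ[ℝ] Matrix (Fin n) (Fin n) ℝ :=
    { toFun := fun X => Matrix.of fun i j => C.pullM s b X (iy i) (ix j)
      map_add' := fun X Y => by ext i j; simp
      map_smul' := fun r X => by ext i j; simp }
  have hγ : ∀ X i j, γ X i j = C.pull (𝓡 m) s b X (iy i) (ix j) := fun X i j => rfl
  have hmem : ∀ X, X ∈ distribution C b ↔ γ X = 0 := by
    intro X
    rw [mem_distribution_iff hs hb, mem_filtNegOne, ← Matrix.ext_iff]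
    exact ⟨fun h => h.2, fun h => ⟨C.pull_mem b X, h⟩⟩
  have halt : ∀ X i j, γ X i j = -γ X j i := by
    intro X i j
    have := mem_lieG_iff.1 (C.pull_mem (s := s) b X) (ix j) (ix i)
    exact this
  have hsurj : ∀ A : Matrix (Fin n) (Fin n) ℝ, (∀ i j, A i j = -A j i) → ∃ X, γ X = A := by
    intro A hA
    obtain ⟨ξ, hξ⟩ := hs.exists_pull_sub_mem (parabolicPair n).toIsCayleyPair hb (negPart_mem 0 hA)
    refine ⟨ξ, ?_⟩
    ext i j
    have := (mem_lieP_iff.1 hξ).2 (Sum.inr i) j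
    rw [Matrix.sub_apply, sub_eq_zero] at this
    exact this
  obtain ⟨L, hL⟩ := exists_wedge_equiv (V := distribution C b) (W := TangentSpace (𝓡 m) b ⧸ distribution C b)
    (fun j => tCoord s b j ∘ₗ (distribution C b).subtype)
    (fun i => ⟨X i b, hfb.mem hs hb i⟩) (fun i j => hfb.tCoord i j)
    (fun v => by
      refine Subtype.ext ?_
      have := hfb.sum_smul hs hb v.2
      simpa using this)
    ((distribution C b).liftQ γ fun X hX => (hmem X).1 hX)
    (by
      rw [← LinearMap.ker_eq_bot]
      refine Submodule.ker_liftQ_eq_bot _ _ _ fun X hX => (hmem X).2 hX)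
    (by
      intro w i j
      obtain ⟨X, rfl⟩ := Submodule.Quotient.mk_surjective _ w
      exact halt X i j)
    (by
      intro A hA
      obtain ⟨X, hX⟩ := hsurj A hA
      exact ⟨Submodule.Quotient.mk X, hX⟩)
  refine ⟨L, fun W hbW Y Z hW hY hZ hYH hZH => hL _ _ _ fun i j => ?_⟩
  have hmd : ∀ Y : (b : M) → TangentSpace (𝓡 m) b, IsSmoothField Y W →
      MDifferentiableAt (𝓡 m) (𝓡 m).tangent (fun y => (⟨y, Y y⟩ : TangentBundle (𝓡 m) M)) b :=
    fun Y hY => (hY.contMDiffAt (hW.mem_nhds hbW)).mdifferentiableAt (by simp)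
  have hev : ∀ Y : (b : M) → TangentSpace (𝓡 m) b, (∀ b' ∈ W, Y b' ∈ distribution C b') →
      ∀ᶠ y in 𝓝 b, C.pull (𝓡 m) s y (Y y) ∈ filtNegOne n := by
    intro Y hY
    filter_upwards [hW.mem_nhds hbW, hs.isOpen.mem_nhds hb] with y h1 h2
    exact (mem_distribution_iff hs h2).1 (hY y h1)
  have h1 := hC.pull_mlieBracket_apply hs hb (hmd Y hY) (hmd Z hZ) (hev Y hYH) (hev Z hZH) i j
  rw [commutator_apply (hev Y hYH).self_of_nhds (hev Z hZH).self_of_nhds] at h1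
  exact h1

end Distribution

/-! ## Reductions and extensions of Cartan geometries -/

section Reductions

variable {n m : ℕ}

/-- `inclGL`, on the parabolic subgroups. -/
def inclP (n : ℕ) (c : ℝˣ) : P n →* PHat n :=
  ((inclGL n c).comp (P n).subtype).codRestrict (PHat n) fun g =>
    (inclGL_mem_iff c g.2.1).2 g.2

lemma inclP_val (c : ℝˣ) (g : P n) : (inclP n c g).1 = inclGL n c g.1 := rfl

lemma eq_inclP {c : ℝˣ} {g : P n} {g' : PHat n} (h : g'.1 = inclGL n c g) : g' = inclP n c g :=
  Subtype.ext h

/-- `dincl` as a linear map. -/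
def dinclL (n : ℕ) (c : ℝˣ) : Matrix (Idx n) (Idx n) ℝ →ₗ[ℝ] Matrix (IdxHat n) (IdxHat n) ℝ where
  toFun := dincl n c
  map_add' X Y := by
    rw [dincl, dincl, dincl, ← Matrix.add_mul, ← Matrix.mul_add, Matrix.fromBlocks_add]
    simp
  map_smul' r X := by
    rw [dincl, dincl, RingHom.id_apply, ← Matrix.smul_mul, ← Matrix.mul_smul,
      Matrix.fromBlocks_smul]
    simp

lemma dinclL_apply (c : ℝˣ) (X : Matrix (Idx n) (Idx n) ℝ) : dinclL n c X = dincl n c X := rfl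

/-- The inclusion is affine on matrices with linear part `dinclL`, which gives its smoothness and
its derivative. -/
lemma inclGL_val_eq (c : ℝˣ) (g : (Matrix (Idx n) (Idx n) ℝ)ˣ) : (inclGL n c g).val =
    dinclL n c g.val + simMat n c * Matrix.fromBlocks 0 0 0 1 * simMat n (c⁻¹ : ℝˣ) := by
  rw [inclGL_val, dinclL_apply, dincl, ← Matrix.add_mul, ← Matrix.mul_add, Matrix.fromBlocks_add]
  simp

lemma dincl_mul (c : ℝˣ) (g : (Matrix (Idx n) (Idx n) ℝ)ˣ) (X : Matrix (Idx n) (Idx n) ℝ) :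
    dincl n c (g.val * X) = (inclGL n c g).val * dincl n c X := by
  rw [inclGL_val, dincl, dincl]
  calc _ = simMat n c * (Matrix.fromBlocks g.val 0 0 1 * Matrix.fromBlocks X 0 0 0) *
        simMat n (c⁻¹ : ℝˣ) := by simp [Matrix.fromBlocks_multiply]
    _ = simMat n c * (Matrix.fromBlocks g.val 0 0 1 * (simMat n (c⁻¹ : ℝˣ) * simMat n c) *
        Matrix.fromBlocks X 0 0 0) * simMat n (c⁻¹ : ℝˣ) := by
          rw [simMat_inv_mul, Matrix.mul_one]
    _ = _ := by simp only [Matrix.mul_assoc]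

section Smooth

variable {E : Type*} [NormedAddCommGroup E] [NormedSpace ℝ E] {H : Type*} [TopologicalSpace H]
  {I : ModelWithCorners ℝ E H} {X : Type*} [TopologicalSpace X] [ChartedSpace H X]

lemma GSmoothAt.inclP {k : X → P n} {x : X} (hk : GSmoothAt I k x) (c : ℝˣ) :
    GSmoothAt I (fun y => inclP n c (k y)) x :=
  MSmoothAt.congr ((MSmoothAt.mlinear hk (dinclL n c)).add (MSmoothAt.const _ x))
    (Filter.Eventually.of_forall fun y => inclGL_val_eq c (k y).1)

lemma gderiv_inclP {k : X → P n} {x : X} (hk : GSmoothAt I k x) (c : ℝˣ) (ξ : TangentSpace I x) :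
    gderiv I (fun y => FreeDist.inclP n c (k y)) x ξ = dincl n c (gderiv I k x ξ) := by
  have h1 := MSmoothAt.mlinear hk (dinclL n c)
  have h2 := mderiv_add h1 (MSmoothAt.const
    (simMat n c * Matrix.fromBlocks 0 0 0 1 * simMat n (c⁻¹ : ℝˣ)) x) ξ
  rw [mderiv_linear hk, mderiv_const, add_zero] at h2
  refine (mderiv_congr ?_ ξ).trans h2
  exact Filter.Eventually.of_forall fun y => inclGL_val_eq c (k y).1

end Smooth

/-- The effect of `dincl` on gauge transformations. -/
lemma dincl_gauge (c : ℝˣ) (g : P n) (X Y : Matrix (Idx n) (Idx n) ℝ) :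
    dincl n c ((g⁻¹).1.val * X * g.1.val + (g⁻¹).1.val * Y) =
      ((inclP n c g)⁻¹).1.val * dincl n c X * (inclP n c g).1.val +
        ((inclP n c g)⁻¹).1.val * dincl n c Y := by
  have h1 := dincl_conj c g.1 X
  have h2 := dincl_mul c (g⁻¹).1 Y
  rw [← dinclL_apply, map_add, dinclL_apply, dinclL_apply, h2]
  refine congrArg₂ _ h1 ?_
  rw [← map_inv]
  rfl

namespace CartanGeometry

variable {N : Type} [Fintype N] [DecidableEq N] {𝔤 : Submodule ℝ (Matrix N N ℝ)}
  {P : Subgroup (Matrix N N ℝ)ˣ} {M : Type u} [TopologicalSpace M]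
  [ChartedSpace (EuclideanSpace ℝ (Fin m)) M] [IsManifold (𝓡 m) ∞ M]
  {C : CartanGeometry.{u, v} 𝔤 P (m := m) M}

lemma IsSection.act_coord_section {U V : Set M} {s t : M → C.Total} (hs : C.IsSection U s)
    (ht : C.IsSection V t) {y : M} (hU : y ∈ U) (hV : y ∈ V) :
    C.act (s y) (C.coord s (t y)) = t y := by
  have h := hs.act_coord (x := t y) (by rwa [ht.proj_eq y hV])
  rwa [ht.proj_eq y hV] at h

lemma IsSection.coord_section_smooth {U V : Set M} {s t : M → C.Total} (hs : C.IsSection U s)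
    (ht : C.IsSection V t) {y : M} (hU : y ∈ U) (hV : y ∈ V) :
    GSmoothAt (𝓡 m) (fun z => C.coord s (t z)) y :=
  GSmoothAt.comp (I' := 𝓡 C.dim) (hs.coord_smooth (by rwa [ht.proj_eq y hV])) (ht.smooth y hV)

lemma IsSection.pull_gauge {U V : Set M} {s t : M → C.Total} (hs : C.IsSection U s)
    (ht : C.IsSection V t) {y : M} (hU : y ∈ U) (hV : y ∈ V) (ξ : TangentSpace (𝓡 m) y) :
    C.pull (𝓡 m) t y ξ =
      ((C.coord s (t y))⁻¹).1.val * C.pull (𝓡 m) s y ξ * (C.coord s (t y)).1.val +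
      ((C.coord s (t y))⁻¹).1.val * gderiv (𝓡 m) (fun z => C.coord s (t z)) y ξ := by
  have hev : ∀ᶠ z in 𝓝 y, z ∈ U ∩ V := (hs.isOpen.inter ht.isOpen).mem_nhds ⟨hU, hV⟩
  have h := C.conn_act (hs.smooth y hU)
    (hev.mono fun z hz => hs.coord_section_smooth ht hz.1 hz.2) ξ
  rw [← h]
  refine C.pull_congr ?_ ξ
  filter_upwards [hev] with z hz
  exact (hs.act_coord_section ht hz.1 hz.2).symm

end CartanGeometry

variable {M : Type u} [TopologicalSpace M] [ChartedSpace (EuclideanSpace ℝ (Fin m)) M]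
  [IsManifold (𝓡 m) ∞ M] {C : FreeGeometry.{u, v} n m M} {B B' : AlmostSpinorial.{u, v} n m M}

/-- A map which is locally determined by sections and compatible with the Cartan connections. -/
lemma isReduction_of_sections {c : M → ℝˣ} {j : C.Total → B.Total}
    (h : ∀ x, ∃ (U : Set M) (s : M → C.Total) (t : M → B.Total), C.proj x ∈ U ∧
      C.IsSection U s ∧ B.IsSection U t ∧ (∀ y ∈ U, c y = c (C.proj x)) ∧
      (∀ z, C.proj z ∈ U →
        j z = B.act (t (C.proj z)) (inclP n (c (C.proj x)) (C.coord s z))) ∧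
      ∀ y ∈ U, ∀ ξ, B.pull (𝓡 m) t y ξ = dincl n (c (C.proj x)) (C.pull (𝓡 m) s y ξ)) :
    IsReduction c C B j := by
  refine ⟨fun x => ?_, fun x => ?_, fun x g g' hg => ?_, fun x ξ => ?_⟩
  · obtain ⟨U, s, t, hx, hs, ht, hc, hj, hp⟩ := h x
    have hU : ∀ᶠ z in 𝓝 x, C.proj z ∈ U :=
      (hs.isOpen.preimage C.proj_smooth.continuous).mem_nhds hx
    have h1 := B.act_smoothAt ((ht.smooth _ hx).comp x (C.proj_smooth x))
      ((hs.coord_smooth hx).inclP (c (C.proj x)))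
    exact h1.congr_of_eventuallyEq (hU.mono fun z hz => hj z hz)
  · obtain ⟨U, s, t, hx, hs, ht, hc, hj, hp⟩ := h x
    rw [hj x hx, B.proj_act, ht.proj_eq _ hx]
  · obtain ⟨U, s, t, hx, hs, ht, hc, hj, hp⟩ := h x
    rw [eq_inclP hg, hj x hx, hj _ (by rwa [C.proj_act]), C.proj_act, hs.coord_act hx, map_mul,
      B.act_mul]
  · obtain ⟨U, s, t, hx, hs, ht, hc, hj, hp⟩ := h x
    have hU : ∀ᶠ z in 𝓝 x, C.proj z ∈ U :=
      (hs.isOpen.preimage C.proj_smooth.continuous).mem_nhds hx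
    -- Both connections are computed in the gauges given by `s` and `t`; the results match because
    -- `dincl` intertwines gauge transformations.
    have h1 := B.conn_act (z := fun z => t (C.proj z))
      (k := fun z => inclP n (c (C.proj x)) (C.coord s z)) (x := x)
      ((ht.smooth _ hx).comp x (C.proj_smooth x))
      (hU.mono fun z hz => (hs.coord_smooth hz).inclP _) ξ
    have h2 := B.pull_congr (f := j) (hU.mono fun z hz => hj z hz) ξ
    have h3 := B.pull_comp ((ht.smooth _ hx).mdifferentiableAt (by simp))
      ((C.proj_smooth x).mdifferentiableAt (by simp)) ξ
    refine h2.trans (h1.trans ?_)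
    rw [h3, hp _ hx, gderiv_inclP (hs.coord_smooth hx), hs.conn_eq hx, dincl_gauge]

lemma IsReduction.isSection {c : M → ℝˣ} {j : C.Total → B.Total} (hj : IsReduction c C B j)
    {U : Set M} {s : M → C.Total} (hs : C.IsSection U s) : B.IsSection U fun y => j (s y) :=
  ⟨hs.isOpen, fun y hy => (hj.1 _).comp y (hs.smooth y hy),
    fun y hy => by rw [hj.2.1, hs.proj_eq y hy]⟩

lemma IsReduction.pull_section {c : M → ℝˣ} {j : C.Total → B.Total} (hj : IsReduction c C B j)
    {U : Set M} {s : M → C.Total} (hs : C.IsSection U s) {y : M} (hy : y ∈ U)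
    (ξ : TangentSpace (𝓡 m) y) :
    B.pull (𝓡 m) (fun y => j (s y)) y ξ = dincl n (c y) (C.pull (𝓡 m) s y ξ) := by
  have h1 := B.pull_comp ((hj.1 (s y)).mdifferentiableAt (by simp))
    ((hs.smooth y hy).mdifferentiableAt (by simp)) ξ
  have h2 := hj.2.2.2 (s y) (mfderiv (𝓡 m) (𝓡 C.dim) s y ξ)
  rw [hs.proj_eq y hy] at h2
  exact h1.trans h2

lemma IsReduction.act {c : M → ℝˣ} {j : C.Total → B.Total} (hj : IsReduction c C B j) (x : C.Total)
    (g : P n) : j (C.act x g) = B.act (j x) (inclP n (c (C.proj x)) g) :=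
  hj.2.2.1 x g _ rfl

/-- Two extensions of a Cartan geometry are related by a unique morphism. -/
lemma exists_morphism {c : M → ℝˣ} {j : C.Total → B.Total} {j' : C.Total → B'.Total}
    (hj : IsReduction c C B j) (hj' : IsReduction c C B' j') :
    ∃ φ : B.Total → B'.Total, ContMDiff (𝓡 B.dim) (𝓡 B'.dim) ∞ φ ∧
      (∀ x, B'.proj (φ x) = B.proj x) ∧ (∀ x g, φ (B.act x g) = B'.act (φ x) g) ∧
      (∀ x ξ, B'.conn (φ x) (mfderiv (𝓡 B.dim) (𝓡 B'.dim) φ x ξ) = B.conn x ξ) ∧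
      ∀ x, φ (j x) = j' x := by
  have hex : ∀ x : B.Total, ∃ z : C.Total × PHat n, B.act (j z.1) z.2 = x := by
    intro x
    obtain ⟨z, hz⟩ := C.exists_proj_eq (B.proj x)
    obtain ⟨g, hg⟩ := B.exists_act_eq (x := j z) (y := x) (by rw [hj.2.1, hz])
    exact ⟨(z, g), hg⟩
  choose r hr using hex
  -- Each point is j(z)g; two such presentations differ by an element of `P`, which `j` and `j'`
  -- carry along in the same way. So the choice `r` does not matter.
  let φ : B.Total → B'.Total := fun x => B'.act (j' (r x).1) (r x).2
  have key : ∀ z g, φ (B.act (j z) g) = B'.act (j' z) g := by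
    intro z g
    set x := B.act (j z) g with hx
    have h1 := hr x
    have h2 : C.proj (r x).1 = C.proj z := by
      have := congrArg B.proj h1
      rwa [hx, B.proj_act, B.proj_act, hj.2.1, hj.2.1] at this
    obtain ⟨p, hp⟩ := C.exists_act_eq h2.symm
    rw [← hp, hj.act, ← B.act_mul, hx] at h1
    have h3 := B.act_cancel h1
    change B'.act (j' (r x).1) (r x).2 = _
    rw [← h3, B'.act_mul, ← hj'.act, hp]
  -- In terms of a section of `C` the map is smooth, and it matches the gauges j∘s and j'∘s, whose
  -- gauge forms coincide.
  have hloc : ∀ {U : Set M} {s : M → C.Total} (hs : C.IsSection U s) {x : B.Total},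
      B.proj x ∈ U → φ x = B'.act (j' (s (B.proj x))) (B.coord (fun y => j (s y)) x) := by
    intro U s hs x hx
    conv_lhs => rw [← (hj.isSection hs).act_coord hx]
    exact key _ _
  have hsec : ∀ x : B.Total, ∃ U s, B.proj x ∈ U ∧ C.IsSection U s := by
    intro x
    obtain ⟨z, hz⟩ := C.exists_proj_eq (B.proj x)
    obtain ⟨U, s, hU, hs, -⟩ := C.exists_section z
    exact ⟨U, s, hz ▸ hU, hs⟩
  have hequiv : ∀ x g, φ (B.act x g) = B'.act (φ x) g := by
    intro x g
    obtain ⟨z, hz⟩ : ∃ z : C.Total × PHat n, B.act (j z.1) z.2 = x := ⟨r x, hr x⟩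
    rw [← hz, ← B.act_mul, key, key, B'.act_mul]
  refine ⟨φ, fun x => ?_, fun x => ?_, hequiv, fun x ξ => ?_, fun x => ?_⟩
  · obtain ⟨U, s, hx, hs⟩ := hsec x
    have hU : ∀ᶠ z in 𝓝 x, B.proj z ∈ U :=
      (hs.isOpen.preimage B.proj_smooth.continuous).mem_nhds hx
    exact (B'.act_smoothAt (((hj'.isSection hs).smooth _ hx).comp x (B.proj_smooth x))
      ((hj.isSection hs).coord_smooth hx)).congr_of_eventuallyEq (hU.mono fun z hz => hloc hs hz)
  · rw [← hr x, key, B'.proj_act, hj'.2.1, B.proj_act, hj.2.1]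
  · obtain ⟨U, s, hx, hs⟩ := hsec x
    have hU : ∀ᶠ z in 𝓝 x, B.proj z ∈ U :=
      (hs.isOpen.preimage B.proj_smooth.continuous).mem_nhds hx
    have h1 := B'.conn_act (z := fun z => j' (s (B.proj z)))
      (k := B.coord fun y => j (s y)) (x := x)
      (((hj'.isSection hs).smooth _ hx).comp x (B.proj_smooth x))
      (hU.mono fun z hz => (hj.isSection hs).coord_smooth hz) ξ
    have h2 := B'.pull_congr (f := φ) (hU.mono fun z hz => hloc hs hz) ξ
    have h3 := B'.pull_comp (((hj'.isSection hs).smooth _ hx).mdifferentiableAt (by simp))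
      ((B.proj_smooth x).mdifferentiableAt (by simp)) ξ
    refine h2.trans (h1.trans ?_)
    rw [h3, hj'.pull_section hs hx, (hj.isSection hs).conn_eq hx, hj.pull_section hs hx]
  · have := key x 1
    rwa [B.act_one, B'.act_one] at this

/-- The morphisms in both directions are inverse to each other, since an equivariant map fixing the
image of the inclusion is the identity. -/
lemma exists_isIso {c : M → ℝˣ} {j : C.Total → B.Total} {j' : C.Total → B'.Total}
    (hj : IsReduction c C B j) (hj' : IsReduction c C B' j') :
    ∃ φ : Diffeomorph (𝓡 B.dim) (𝓡 B'.dim) B.Total B'.Total ∞,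
      IsIso B B' φ ∧ ∀ x, φ (j x) = j' x := by
  obtain ⟨φ, h1, h2, h3, h4, h5⟩ := exists_morphism hj hj'
  obtain ⟨ψ, k1, k2, k3, k4, k5⟩ := exists_morphism hj' hj
  have hgen : ∀ {B : AlmostSpinorial.{u, v} n m M} {j : C.Total → B.Total}, IsReduction c C B j →
      ∀ f : B.Total → B.Total, (∀ x g, f (B.act x g) = B.act (f x) g) → (∀ x, f (j x) = j x) →
      ∀ x, f x = x := by
    intro B j hj f hf hfj x
    obtain ⟨z, hz⟩ := C.exists_proj_eq (B.proj x)
    obtain ⟨g, hg⟩ := B.exists_act_eq (x := j z) (y := x) (by rw [hj.2.1, hz])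
    rw [← hg, hf, hfj]
  refine ⟨⟨⟨φ, ψ, ?_, ?_⟩, h1, k1⟩, ⟨h2, h3, h4⟩, h5⟩
  · exact hgen hj (fun x => ψ (φ x)) (fun x g => by rw [h3, k3]) (fun x => by rw [h5, k5])
  · exact hgen hj' (fun x => φ (ψ x)) (fun x g => by rw [k3, h3]) (fun x => by rw [k5, h5])

end Reductions

/-! ## The Fefferman construction -/

section Extension

variable {n m : ℕ} {M : Type u} [TopologicalSpace M] [ChartedSpace (EuclideanSpace ℝ (Fin m)) M]
  [IsManifold (𝓡 m) ∞ M]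

lemma CartanGeometry.exists_section_at {N : Type} [Fintype N] [DecidableEq N]
    {𝔤 : Submodule ℝ (Matrix N N ℝ)} {P : Subgroup (Matrix N N ℝ)ˣ}
    (C : CartanGeometry.{u, v} 𝔤 P (m := m) M) (b : M) : ∃ U s, b ∈ U ∧ C.IsSection U s := by
  obtain ⟨x, hx⟩ := C.exists_proj_eq b
  obtain ⟨U, s, hU, hs, -⟩ := C.exists_section x
  exact ⟨U, s, hx ▸ hU, hs⟩

lemma CartanGeometry.isOpenMap_proj {N : Type} [Fintype N] [DecidableEq N]
    {𝔤 : Submodule ℝ (Matrix N N ℝ)} {P : Subgroup (Matrix N N ℝ)ˣ}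
    (C : CartanGeometry.{u, v} 𝔤 P (m := m) M) : IsOpenMap C.proj := by
  refine isOpenMap_iff_nhds_le.2 fun x V hV => ?_
  obtain ⟨U, s, hU, hs, hx⟩ := C.exists_section x
  have h1 : ContinuousAt s (C.proj x) := (hs.smooth _ hU).continuousAt
  have h2 : C.proj ⁻¹' V ∈ 𝓝 (s (C.proj x)) := by rw [hx]; exact hV
  filter_upwards [h1 h2, hs.isOpen.mem_nhds hU] with y hy hyU
  have h3 : C.proj (s y) ∈ V := hy
  rwa [hs.proj_eq y hyU] at h3

/-- As `P` is mapped into `PHat`, the relation is that of lying in the same fibre; the projection is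
open because it has local sections. -/
lemma exists_feffermanBase_homeomorph (C : FreeGeometry.{u, v} n m M) :
    ∃ e : FeffermanBase C ≃ₜ M, ∀ x : C.Total, e (Quot.mk _ x) = C.proj x := by
  let f : FeffermanBase C → M := Quot.lift C.proj (by
    rintro x y ⟨g, -, rfl⟩
    exact (C.proj_act x g).symm)
  have hf : Continuous f := continuous_quot_lift _ C.proj_smooth.continuous
  have hinj : Function.Injective f := by
    rintro ⟨x⟩ ⟨y⟩ h
    obtain ⟨g, hg⟩ := C.exists_act_eq (x := x) (y := y) h
    exact Quot.sound ⟨g, (inclGL_mem_iff 1 g.2.1).2 g.2, hg.symm⟩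
  have hsurj : Function.Surjective f := fun b => by
    obtain ⟨x, hx⟩ := C.exists_proj_eq b
    exact ⟨Quot.mk _ x, hx⟩
  have hopen : IsOpenMap f := by
    intro V hV
    have h1 : f '' V = C.proj '' (Quot.mk _ ⁻¹' V) := by
      ext b
      constructor
      · rintro ⟨⟨x⟩, hx, rfl⟩
        exact ⟨x, hx, rfl⟩
      · rintro ⟨x, hx, rfl⟩
        exact ⟨_, hx, rfl⟩
    rw [h1]
    exact C.isOpenMap_proj _ (hV.preimage continuous_quot_mk)
  exact ⟨(Equiv.ofBijective f ⟨hinj, hsurj⟩).toHomeomorphOfContinuousOpen hf hopen, fun x => rfl⟩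

/-- The equivalence relation defining `C.Total ×_P PHat`. -/
def extSetoid (C : FreeGeometry.{u, v} n m M) : Setoid (C.Total × PHat n) where
  r z w := ∃ p : P n, C.act z.1 p = w.1 ∧ (inclP n 1 p)⁻¹ * z.2 = w.2
  iseqv :=
    { refl := fun z => ⟨1, C.act_one _, by simp⟩
      symm := by
        rintro ⟨x, h⟩ ⟨y, k⟩ ⟨p, hp, hk⟩
        refine ⟨p⁻¹, ?_, ?_⟩
        · simp only at hp ⊢
          rw [← hp, ← C.act_mul, mul_inv_cancel, C.act_one]
        · simp only at hk ⊢
          rw [← hk, map_inv, inv_inv, mul_inv_cancel_left]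
      trans := by
        rintro ⟨x, h⟩ ⟨y, k⟩ ⟨z, l⟩ ⟨p, hp, hk⟩ ⟨q, hq, hl⟩
        refine ⟨p * q, ?_, ?_⟩
        · simp only at hp hq ⊢
          rw [C.act_mul, hp, hq]
        · simp only at hk hl ⊢
          rw [← hl, ← hk, map_mul, _root_.mul_inv_rev, mul_assoc] }

/-- The total space `C.Total ×_P PHat` of the extended bundle. -/
abbrev Ext (C : FreeGeometry.{u, v} n m M) : Type v := Quotient (extSetoid C)

variable {C : FreeGeometry.{u, v} n m M}

/-- The point of the extended bundle represented by a pair. -/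
def Ext.mk (x : C.Total) (h : PHat n) : Ext C := Quotient.mk (extSetoid C) (x, h)

lemma Ext.mk_act (x : C.Total) (p : P n) (h : PHat n) :
    Ext.mk (C.act x p) h = Ext.mk x (inclP n 1 p * h) :=
  (Quotient.sound (s := extSetoid C) ⟨p, rfl, by simp⟩).symm

lemma Ext.mk_eq_mk {x y : C.Total} {h k : PHat n} :
    Ext.mk x h = Ext.mk y k ↔ ∃ p : P n, C.act x p = y ∧ (inclP n 1 p)⁻¹ * h = k :=
  Quotient.eq (r := extSetoid C)

lemma Ext.ind {motive : Ext C → Prop} (h : ∀ x g, motive (Ext.mk x g)) (z : Ext C) : motive z :=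
  Quotient.ind (s := extSetoid C) (fun z => h z.1 z.2) z

/-- The gauge data of the extension of a Cartan geometry. -/
def extData (U : M → Set M) (s : M → M → C.Total) (hU : ∀ b, b ∈ U b)
    (hs : ∀ b, C.IsSection (U b) (s b)) :
    GaugeData.{u, v} (lieGHat n) (liePHat n) (PHat n) (m := m) M where
  pair := parabolicPairHat n
  T := Ext C
  proj := Quotient.lift (s := extSetoid C) (fun z => C.proj z.1) (by
    rintro ⟨x, h⟩ ⟨y, k⟩ ⟨p, hp, -⟩
    simp only at hp ⊢
    rw [← hp, C.proj_act])
  act z g := Quotient.map (sa := extSetoid C) (sb := extSetoid C) (fun z => (z.1, z.2 * g)) (by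
    rintro ⟨x, h⟩ ⟨y, k⟩ ⟨p, hp, hk⟩
    refine ⟨p, hp, ?_⟩
    simp only at hk ⊢
    rw [← hk, mul_assoc]) z
  act_one := Ext.ind fun x h => congrArg (Ext.mk x) (mul_one h)
  act_mul := Ext.ind fun x h g k => congrArg (Ext.mk x) (mul_assoc h g k).symm
  act_free := Ext.ind fun x h g hg => by
    obtain ⟨p, hp, hk⟩ := Ext.mk_eq_mk.1 (show Ext.mk x (h * g) = Ext.mk x h from hg)
    rw [C.act_free x p hp, map_one, inv_one, one_mul] at hk
    exact mul_eq_left.1 hk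
  proj_act := Ext.ind fun x h g => rfl
  act_trans := Ext.ind fun x h => Ext.ind fun y k hxy => by
    obtain ⟨p, hp⟩ := C.exists_act_eq (x := x) (y := y) hxy
    refine ⟨h⁻¹ * inclP n 1 p * k, ?_⟩
    refine (show Ext.mk x (h * (h⁻¹ * inclP n 1 p * k)) = Ext.mk y k from ?_)
    refine Ext.mk_eq_mk.2 ⟨p, hp, ?_⟩
    group
  U := U
  isOpen b := (hs b).isOpen
  mem := hU
  sec b y := Ext.mk (s b y) 1
  proj_sec b y hy := (hs b).proj_eq y hy
  trans a b y := inclP n 1 (C.coord (s a) (s b y))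
  sec_eq a b y ha hb := by
    refine (show Ext.mk (s a y) (1 * inclP n 1 _) = Ext.mk (s b y) 1 from ?_)
    rw [← (hs a).act_coord_section (hs b) ha hb, Ext.mk_act, one_mul, mul_one,
      (hs a).act_coord_section (hs b) ha hb]
  trans_smooth a b y ha hb := ((hs a).coord_section_smooth (hs b) ha hb).inclP 1
  -- The gauge form of the extension is the image of the given gauge form, and the transition
  -- functions are the images of the given ones.
  form b y := dinclL n 1 ∘ₗ C.pullM (s b) y
  form_smooth b ξ hξ := MSmoothAt.mlinear ((hs b).pull_smooth ξ hξ) (dinclL n 1)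
  form_mem b y hy ξ := dincl_mem 1 (C.pull_mem y ξ)
  form_trans a b y ha hb ξ := by
    have h1 := congrArg (dincl n 1) ((hs a).pull_gauge (hs b) ha hb ξ)
    rw [dincl_gauge] at h1
    rw [gderiv_inclP ((hs a).coord_section_smooth (hs b) ha hb)]
    exact h1
  form_injective b y hy ξ h :=
    (hs b).eq_zero_of_pull_mem (parabolicPair n).toIsCayleyPair hy
      ((dincl_mem_iff 1 (C.pull_mem y ξ)).1 h)
  -- The class of `A` modulo `liePHat` is represented by an element of `lieG`, which the given gauge
  -- form reaches modulo `lieP`.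
  form_surjective b y hy A hA := by
    obtain ⟨X, hX, h1⟩ := exists_sub_dincl_mem 1 hA
    obtain ⟨ξ, h2⟩ := (hs b).exists_pull_sub_mem (parabolicPair n).toIsCayleyPair hy hX
    refine ⟨ξ, ?_⟩
    have h3 := (dincl_mem_iff 1 ((lieG n).sub_mem (C.pull_mem y ξ) hX)).2 h2
    rw [dincl_sub] at h3
    have h4 := (liePHat n).sub_mem h3 h1
    rwa [sub_sub_sub_cancel_right] at h4

/-- A function which is constant along local sections with gauge form annihilating the constant. -/
lemma isTractor_isParallel_of_sections {B : AlmostSpinorial.{u, v} n m M}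
    {t : B.Total → IdxHat n → ℝ} {v : IdxHat n → ℝ}
    (ht : ∀ x (g : PHat n), t (B.act x g) = (g⁻¹).1.val *ᵥ t x)
    (h : ∀ b : M, ∃ (U : Set M) (s : M → B.Total), b ∈ U ∧ B.IsSection U s ∧
      ∀ y ∈ U, t (s y) = v ∧ ∀ ξ, B.pull (𝓡 m) s y ξ *ᵥ v = 0) :
    IsTractor B t ∧ IsParallel B t := by
  let L : Matrix (IdxHat n) (IdxHat n) ℝ →ₗ[ℝ] (IdxHat n → ℝ) :=
    { toFun := fun A => A *ᵥ v
      map_add' := fun A A' => Matrix.add_mulVec A A' v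
      map_smul' := fun r A => Matrix.smul_mulVec r A v }
  have key : ∀ x : B.Total, ∃ (U : Set M) (s : M → B.Total), B.proj x ∈ U ∧ B.IsSection U s ∧
      (∀ z, B.proj z ∈ U → t z = L ((B.coord s z)⁻¹).1.val) ∧
      ∀ y ∈ U, ∀ ξ, B.pull (𝓡 m) s y ξ *ᵥ v = 0 := by
    intro x
    obtain ⟨U, s, hx, hs, hv⟩ := h (B.proj x)
    refine ⟨U, s, hx, hs, fun z hz => ?_, fun y hy => (hv y hy).2⟩
    conv_lhs => rw [← hs.act_coord hz]
    rw [ht, (hv _ hz).1]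
    rfl
  refine ⟨⟨fun x => ?_, ht⟩, fun x ξ => ?_⟩
  · obtain ⟨U, s, hx, hs, hz, -⟩ := key x
    have hU : ∀ᶠ z in 𝓝 x, B.proj z ∈ U :=
      (hs.isOpen.preimage B.proj_smooth.continuous).mem_nhds hx
    exact (MSmoothAt.linear (hs.coord_smooth hx).inv L).congr_of_eventuallyEq
      (hU.mono fun z hz' => hz z hz')
  · obtain ⟨U, s, hx, hs, hz, hp⟩ := key x
    have hU : ∀ᶠ z in 𝓝 x, B.proj z ∈ U :=
      (hs.isOpen.preimage B.proj_smooth.continuous).mem_nhds hx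
    have hk := hs.coord_smooth hx
    have h1 := vderiv_congr (F := IdxHat n → ℝ) (hU.mono fun z hz' => hz z hz') ξ
    have h2 := vderiv_linear hk.inv L ξ
    have h3 := gderiv_inv hk ξ
    refine h1.trans (h2.trans ((congrArg L h3).trans ?_))
    -- With k the fibre coordinate and A the gauge form, t = k⁻¹v and dt = -k⁻¹(dk)k⁻¹v. This equals
    -- -(k⁻¹Ak + k⁻¹dk)k⁻¹v because Av = 0.
    rw [hs.conn_eq hx, hz x hx]
    change -(_ * _ * _) *ᵥ v = -(_ *ᵥ (_ *ᵥ v))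
    have h4 : ∀ A D : Matrix (IdxHat n) (IdxHat n) ℝ, A *ᵥ v = 0 → ∀ k : PHat n,
        -((k⁻¹).1.val * D * (k⁻¹).1.val) *ᵥ v =
        -(((k⁻¹).1.val * A * k.1.val + (k⁻¹).1.val * D) *ᵥ ((k⁻¹).1.val *ᵥ v)) := by
      intro A D hA k
      have h5 : ((k⁻¹).1.val * A * k.1.val + (k⁻¹).1.val * D) * (k⁻¹).1.val =
          (k⁻¹).1.val * A + (k⁻¹).1.val * D * (k⁻¹).1.val := by
        rw [Matrix.add_mul, Matrix.mul_assoc _ k.1.val, mul_inv_val, Matrix.mul_one]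
      rw [Matrix.mulVec_mulVec, h5, Matrix.add_mulVec, ← Matrix.mulVec_mulVec v _ A, hA,
        Matrix.mulVec_zero, zero_add, Matrix.neg_mulVec]
    exact h4 _ _ (hp _ hx _) _

/-- The extension of a Cartan geometry, with its parallel tractor. -/
lemma exists_extension (C : FreeGeometry.{u, v} n m M) :
    ∃ (B : AlmostSpinorial.{u, v} n m M) (j : C.Total → B.Total), IsReduction (fun _ => 1) C B j ∧
      ∃ t : B.Total → IdxHat n → ℝ, IsTractor B t ∧ IsParallel B t ∧
        (∀ x, sqLen (t x) = -1) ∧ ∀ x, t (j x) = vec n 1 := by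
  choose U s hU hs using C.exists_section_at
  let D := extData U s hU hs
  let j : C.Total → D.geometry.Total := fun x => Ext.mk x 1
  -- The function [x, h] ↦ h⁻¹v₁ is well defined because the image of `P` fixes v₁.
  let t : D.geometry.Total → IdxHat n → ℝ :=
    Quotient.lift (s := extSetoid C) (fun z => (z.2⁻¹).1.val *ᵥ vec n 1) (by
      rintro ⟨x, h⟩ ⟨y, k⟩ ⟨p, -, hk⟩
      simp only at hk ⊢
      rw [← hk, _root_.mul_inv_rev, inv_inv, Subgroup.coe_mul, Units.val_mul,
        ← Matrix.mulVec_mulVec, inclP_val, inclGL_vec])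
  have htj : ∀ x, t (j x) = vec n 1 := fun x => by
    change ((1 : PHat n)⁻¹).1.val *ᵥ vec n 1 = _
    simp
  have hta : ∀ x (g : PHat n), t (D.geometry.act x g) = (g⁻¹).1.val *ᵥ t x :=
    Ext.ind fun x h g => by
      change ((h * g)⁻¹).1.val *ᵥ vec n 1 = _ *ᵥ ((h⁻¹).1.val *ᵥ vec n 1)
      rw [_root_.mul_inv_rev, Subgroup.coe_mul, Units.val_mul, Matrix.mulVec_mulVec]
  have htl : ∀ x, sqLen (t x) = -1 := Ext.ind fun x h => by
    change sqLen ((h⁻¹).1.val *ᵥ vec n 1) = -1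
    rw [sqLen_mulVec (h⁻¹).2.1, sqLen_vec, Units.val_one]
  obtain ⟨h1, h2⟩ := isTractor_isParallel_of_sections hta fun b =>
    ⟨D.U b, D.secT b, D.mem b, D.geometry_isSection b, fun y hy => ⟨htj _, fun ξ => by
      rw [D.geometry_pull hy]; exact dincl_vec 1 _⟩⟩
  refine ⟨D.geometry, j, isReduction_of_sections fun x => ?_, t, h1, h2, htl, htj⟩
  refine ⟨U (C.proj x), s (C.proj x), D.secT (C.proj x), hU _, hs _, D.geometry_isSection _,
    fun _ _ => rfl, fun z hz => ?_, fun y hy ξ => D.geometry_pull hy ξ⟩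
  change Ext.mk z 1 = Ext.mk (s _ (C.proj z)) (1 * inclP n 1 _)
  rw [one_mul, ← mul_one (inclP n 1 _), ← Ext.mk_act, (hs _).act_coord hz]

end Extension

/-! ## Reductions defined by parallel tractors -/

section Converse

variable {n m : ℕ} {M : Type u} [TopologicalSpace M] [ChartedSpace (EuclideanSpace ℝ (Fin m)) M]
  [IsManifold (𝓡 m) ∞ M]

/-- In a chart the function has zero derivative on a ball, which is convex. -/
lemma eventually_eq_of_vderiv_eq_zero {f : M → ℝ} {b : M}
    (h : ∀ᶠ y in 𝓝 b, ContMDiffAt (𝓡 m) 𝓘(ℝ, ℝ) ∞ f y ∧ ∀ ξ, vderiv (𝓡 m) f y ξ = 0) :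
    ∀ᶠ y in 𝓝 b, f y = f b := by
  set φ := extChartAt (𝓡 m) b with hφ
  have hsymm : ContinuousAt φ.symm (φ b) := continuousAt_extChartAt_symm b
  have h1 : ∀ᶠ e in 𝓝 (φ b), e ∈ φ.target ∧ ContMDiffAt (𝓡 m) 𝓘(ℝ, ℝ) ∞ f (φ.symm e) ∧
      ∀ ξ, vderiv (𝓡 m) f (φ.symm e) ξ = 0 := by
    refine Filter.Eventually.and (extChartAt_target_mem_nhds (I := 𝓡 m) b) ?_
    rw [ContinuousAt, hφ, extChartAt_to_inv] at hsymm
    exact hsymm.eventually h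
  obtain ⟨r, hr, hball⟩ := Metric.eventually_nhds_iff_ball.1 h1
  have hd : ∀ e ∈ Metric.ball (φ b) r, HasFDerivAt (fun e => f (φ.symm e))
      (0 : EuclideanSpace ℝ (Fin m) →L[ℝ] ℝ) e := by
    intro e he
    obtain ⟨h2, h3, h4⟩ := hball e he
    have h5 : ContMDiffAt 𝓘(ℝ, EuclideanSpace ℝ (Fin m)) (𝓡 m) ∞ φ.symm e :=
      (contMDiffOn_extChartAt_symm b).contMDiffAt (extChartAt_target_mem_nhds' h2)
    have h6 : ContMDiffAt 𝓘(ℝ, EuclideanSpace ℝ (Fin m)) 𝓘(ℝ, ℝ) ∞ (fun e => f (φ.symm e)) e :=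
      ContMDiffAt.comp e h3 h5
    have h7 : fderiv ℝ (fun e => f (φ.symm e)) e = 0 := by
      ext w
      have h8 := vderiv_comp (I := 𝓘(ℝ, EuclideanSpace ℝ (Fin m))) (I' := 𝓡 m) (f := f)
        (g := φ.symm) (h3.mdifferentiableAt (by simp)) (h5.mdifferentiableAt (by simp)) w
      rw [h4] at h8
      rw [← mfderiv_eq_fderiv]
      exact h8
    rw [← h7]
    exact (h6.mdifferentiableAt (by simp)).differentiableAt.hasFDerivAt
  have hconst : ∀ e ∈ Metric.ball (φ b) r, f (φ.symm e) = f b := by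
    intro e he
    have := (convex_ball (φ b) r).is_const_of_fderivWithin_eq_zero (𝕜 := ℝ)
      (f := fun e => f (φ.symm e))
      (fun e he => (hd e he).differentiableAt.differentiableWithinAt)
      (fun e he => ((hd e he).hasFDerivWithinAt.fderivWithin
        (Metric.isOpen_ball.uniqueDiffWithinAt he))) he (Metric.mem_ball_self hr)
    rw [this, hφ, extChartAt_to_inv]
  have hcont : ContinuousAt φ b := continuousAt_extChartAt b
  filter_upwards [hcont (Metric.ball_mem_nhds _ hr), extChartAt_source_mem_nhds (I := 𝓡 m) b]
    with y hy hys
  rw [← hconst _ hy, φ.left_inv hys]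

/-- The polarization of `sqLen`. -/
def sqForm (n : ℕ) : (IdxHat n → ℝ) →L[ℝ] (IdxHat n → ℝ) →L[ℝ] ℝ :=
  LinearMap.toContinuousBilinearMap (Matrix.toLinearMap₂' ℝ (formHat n))

lemma sqForm_apply (w w' : IdxHat n → ℝ) : sqForm n w w' = w ⬝ᵥ (formHat n *ᵥ w') :=
  Matrix.toLinearMap₂'_apply' _ _ _

lemma sqForm_skew {Y : Matrix (IdxHat n) (IdxHat n) ℝ} (hY : Y ∈ lieGHat n) (w : IdxHat n → ℝ) :
    sqForm n (Y *ᵥ w) w + sqForm n w (Y *ᵥ w) = 0 := by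
  unfold lieGHat at hY
  rw [mem_skew_iff] at hY
  rw [sqForm_apply, sqForm_apply, Matrix.mulVec_mulVec, Matrix.dotProduct_mulVec,
    Matrix.vecMul_mulVec, ← Matrix.dotProduct_mulVec, ← dotProduct_add, ← Matrix.add_mulVec, hY,
    Matrix.zero_mulVec, dotProduct_zero]

variable {B : AlmostSpinorial.{u, v} n m M} {t : B.Total → IdxHat n → ℝ}

lemma IsTractor.smooth_section (ht : IsTractor B t) {U : Set M} {s : M → B.Total}
    (hs : B.IsSection U s) {y : M} (hy : y ∈ U) :
    ContMDiffAt (𝓡 m) 𝓘(ℝ, IdxHat n → ℝ) ∞ (fun y => t (s y)) y :=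
  (ht.1 _).comp y (hs.smooth y hy)

lemma IsParallel.vderiv_section (ht : IsTractor B t) (hp : IsParallel B t) {U : Set M}
    {s : M → B.Total} (hs : B.IsSection U s) {y : M} (hy : y ∈ U) (ξ : TangentSpace (𝓡 m) y) :
    vderiv (𝓡 m) (fun y => t (s y)) y ξ = -(B.pull (𝓡 m) s y ξ *ᵥ t (s y)) :=
  (vderiv_comp (I' := 𝓡 B.dim) ((ht.1 _).mdifferentiableAt (by simp))
    ((hs.smooth y hy).mdifferentiableAt (by simp)) ξ).trans (hp _ _)

/-- The square length of a parallel tractor is a locally constant function on the base. -/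
lemma exists_sqLen_eq (ht : IsTractor B t) (hp : IsParallel B t) (h0 : ∀ x, sqLen (t x) ≠ 0) :
    ∃ c : M → ℝˣ, IsLocallyConstant c ∧ ∀ x, sqLen (t x) = -(c (B.proj x) : ℝ) := by
  -- An arbitrary choice of points in the fibres: the square length is invariant under `PHat`, so it
  -- descends to the base, and its smoothness is checked with smooth local sections.
  choose r hr using fun b : M => B.exists_proj_eq b
  let f : M → ℝ := fun b => sqLen (t (r b))
  have hf : ∀ x, sqLen (t x) = f (B.proj x) := by
    intro x
    obtain ⟨g, hg⟩ := B.exists_act_eq (x := r (B.proj x)) (y := x) (hr _)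
    conv_lhs => rw [← hg, ht.2, sqLen_mulVec (g⁻¹).2.1]
  have hloc : ∀ b, ∀ᶠ y in 𝓝 b, f y = f b := by
    intro b
    obtain ⟨U, s, hb, hs⟩ := B.exists_section_at b
    refine eventually_eq_of_vderiv_eq_zero (m := m) ?_
    filter_upwards [hs.isOpen.mem_nhds hb] with y hy
    have hts := ht.smooth_section hs hy
    have hev : f =ᶠ[𝓝 y] fun y => sqForm n (t (s y)) (t (s y)) := by
      filter_upwards [hs.isOpen.mem_nhds hy] with z hz
      rw [sqForm_apply]
      conv_lhs => rw [← hs.proj_eq z hz, ← hf]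
      rfl
    constructor
    · refine ContMDiffAt.congr_of_eventuallyEq ?_ hev
      have h1 : ContMDiffAt (𝓡 m) 𝓘(ℝ, (IdxHat n → ℝ) →L[ℝ] ℝ) ∞
          (fun y => sqForm n (t (s y))) y := (sqForm n).contMDiff.contMDiffAt.comp y hts
      exact h1.clm_apply hts
    · intro ξ
      have hd := hts.mdifferentiableAt (by simp)
      -- Parallelism replaces each derivative of the tractor by minus the connection applied to it,
      -- and the two terms cancel by skewness.
      rw [vderiv_congr hev, mfderiv_bilinear (sqForm n) hd hd, hp.vderiv_section ht hs hy, map_neg,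
        map_neg, _root_.neg_apply, ← neg_add, sqForm_skew (B.pull_mem y ξ), neg_zero]
  have hfne : ∀ b, -f b ≠ 0 := fun b => neg_ne_zero.2 (h0 _)
  refine ⟨fun b => Units.mk0 (-f b) (hfne b), ?_, fun x => by simp [hf]⟩
  refine (IsLocallyConstant.iff_eventually_eq _).2 fun b => ?_
  filter_upwards [hloc b] with y hy
  exact Units.ext (congrArg Neg.neg hy)

/-- Local sections along which a parallel tractor is constant. -/
lemma exists_adapted_section (ht : IsTractor B t) (hp : IsParallel B t) {c : M → ℝˣ}
    (hc : IsLocallyConstant c) (hcl : ∀ x, sqLen (t x) = -(c (B.proj x) : ℝ)) (b : M) :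
    ∃ (U : Set M) (s : M → B.Total), b ∈ U ∧ B.IsSection U s ∧ ∀ y ∈ U, c y = c b ∧
      t (s y) = vec n (c b) ∧ ∀ ξ, B.pull (𝓡 m) s y ξ *ᵥ vec n (c b) = 0 := by
  obtain ⟨U₀, s₀, hb, hs₀⟩ := B.exists_section_at b
  have hl : ∀ y ∈ U₀, sqLen (t (s₀ y)) = -(c y : ℝ) := fun y hy => by
    rw [hcl, hs₀.proj_eq y hy]
  obtain ⟨V, h, hV, hbV, hh, hhv⟩ := exists_mover (c b) (t (s₀ b)) (hl b hb)
  have hcont : ContinuousOn (fun y => t (s₀ y)) U₀ := fun y hy =>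
    (ht.smooth_section hs₀ hy).continuousAt.continuousWithinAt
  have hU : IsOpen ((U₀ ∩ (fun y => t (s₀ y)) ⁻¹' V) ∩ c ⁻¹' {c b}) :=
    (hcont.isOpen_inter_preimage hs₀.isOpen hV).inter (hc {c b})
  -- Translating by the mover h, which satisfies hv_c = t(s₀), turns the value of the tractor into
  -- h⁻¹t(s₀) = v_c.
  have hs := (hs₀.mono hU fun y hy => hy.1.1).act (k := fun y => h (t (s₀ y))) fun y hy =>
    GSmoothAt.comp (I' := 𝓘(ℝ, IdxHat n → ℝ)) (g := fun y => t (s₀ y)) (hh _ hy.1.2)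
      (ht.smooth_section hs₀ hy.1.1)
  have hts : ∀ y ∈ (U₀ ∩ (fun y => t (s₀ y)) ⁻¹' V) ∩ c ⁻¹' {c b},
      t (B.act (s₀ y) (h (t (s₀ y)))) = vec n (c b) := by
    rintro y ⟨⟨hy, hyV⟩, hyc⟩
    have hyc' : c y = c b := hyc
    have h1 := congrArg (((h (t (s₀ y)))⁻¹).1.val *ᵥ ·)
      (hhv (t (s₀ y)) hyV (by rw [hl y hy, hyc']))
    simp only [Matrix.mulVec_mulVec, inv_mul_val, Matrix.one_mulVec] at h1
    rw [ht.2, ← h1]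
  refine ⟨(U₀ ∩ (fun y => t (s₀ y)) ⁻¹' V) ∩ c ⁻¹' {c b}, _, ⟨⟨hb, hbV⟩, rfl⟩, hs, fun y hy => ⟨hy.2, hts y hy, fun ξ => ?_⟩⟩
  -- The tractor is constant along the section, so parallelism says that the gauge form annihilates
  -- this constant.
  have h2 := hp.vderiv_section ht hs hy ξ
  rw [vderiv_congr (g := fun _ => vec n (c b))
    (Filter.mem_of_superset (hU.mem_nhds hy) hts), vderiv_const, hts y hy] at h2
  exact neg_eq_zero.1 h2.symm

lemma inclP_injective (c : ℝˣ) : Function.Injective (inclP n c) := fun g h hgh =>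
  Subtype.ext (inclGL_injective c (congrArg Subtype.val hgh))

/-- The stabilizer of v_c in `PHat` is the image of `P`: it comes from `G`, and `PHat` meets the
image of `G` in the image of `P`. -/
lemma exists_inclP_eq {c : ℝˣ} {g : PHat n} (hg : g.1.val *ᵥ vec n c = vec n c) :
    ∃ k : P n, inclP n c k = g := by
  obtain ⟨k, hk, h⟩ := exists_inclGL_eq c g.2.1 hg
  exact ⟨⟨k, (inclGL_mem_iff c hk).1 (h ▸ g.2)⟩, Subtype.ext h⟩

lemma dincl_injective (c : ℝˣ) : Function.Injective (dincl n c) :=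
  Function.LeftInverse.injective (restr_dincl c)

/-- `restr` as a linear map. -/
def restrL (n : ℕ) (c : ℝˣ) : Matrix (IdxHat n) (IdxHat n) ℝ →ₗ[ℝ] Matrix (Idx n) (Idx n) ℝ where
  toFun := restr c
  map_add' X Y := by
    rw [restr, Matrix.mul_add, Matrix.add_mul]
    rfl
  map_smul' r X := by
    rw [restr, Matrix.mul_smul, Matrix.smul_mul]
    rfl

lemma restrL_apply (c : ℝˣ) (Y : Matrix (IdxHat n) (IdxHat n) ℝ) : restrL n c Y = restr c Y := rfl

end Converse

/-! ### The reduction of the bundle to the points where the tractor takes its normal form -/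

section Converse

variable {n m : ℕ} {M : Type u} [TopologicalSpace M] [ChartedSpace (EuclideanSpace ℝ (Fin m)) M]
  [IsManifold (𝓡 m) ∞ M]

/-- The points at which the tractor `t` takes its normal form. -/
abbrev Red (B : AlmostSpinorial.{u, v} n m M) (t : B.Total → IdxHat n → ℝ) (c : M → ℝˣ) : Type v :=
  {x : B.Total // t x = vec n (c (B.proj x))}

variable {B : AlmostSpinorial.{u, v} n m M} {t : B.Total → IdxHat n → ℝ}

/-- Local sections along which the tractor `t` has its normal form and is constant. -/
structure IsAdapted (B : AlmostSpinorial.{u, v} n m M) (t : B.Total → IdxHat n → ℝ) (c : M → ℝˣ)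
    (b : M) (U : Set M) (s : M → B.Total) : Prop where
  mem : b ∈ U
  isSection : B.IsSection U s
  eq : ∀ y ∈ U, c y = c b
  val : ∀ y ∈ U, t (s y) = vec n (c b)
  pull : ∀ y ∈ U, ∀ ξ, B.pull (𝓡 m) s y ξ *ᵥ vec n (c b) = 0

namespace IsAdapted

variable {c : M → ℝˣ} {a b : M} {U V : Set M} {s s' : M → B.Total}

lemma exists_dincl (h : IsAdapted B t c b U s) {y : M} (hy : y ∈ U) (ξ : TangentSpace (𝓡 m) y) :
    restr (c b) (B.pull (𝓡 m) s y ξ) ∈ lieG n ∧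
      dincl n (c b) (restr (c b) (B.pull (𝓡 m) s y ξ)) = B.pull (𝓡 m) s y ξ := by
  obtain ⟨X, hX, h1⟩ := exists_dincl_eq (c b) (B.pull_mem y ξ) (h.pull y hy ξ)
  rw [← h1, restr_dincl]
  exact ⟨hX, rfl⟩

lemma exists_inclP (ht : ∀ x (g : PHat n), t (B.act x g) = (g⁻¹).1.val *ᵥ t x)
    (h : IsAdapted B t c a U s) (h' : IsAdapted B t c b V s') {y : M}
    (hy : y ∈ U) (hy' : y ∈ V) : ∃ k : P n, inclP n (c a) k = B.coord s (s' y) := by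
  refine exists_inclP_eq ?_
  have h1 := h.isSection.act_coord_section h'.isSection hy hy'
  have h2 := ht (s y) (B.coord s (s' y))
  rw [h1, h.val y hy, h'.val y hy', ← h'.eq y hy', h.eq y hy] at h2
  conv_lhs => rw [h2]
  rw [Matrix.mulVec_mulVec, mul_inv_val, Matrix.one_mulVec]

/-- The transition functions between adapted sections. -/
def trans (c : M → ℝˣ) (a : M) (s s' : M → B.Total) (y : M) : P n :=
  Function.invFun (inclP n (c a)) (B.coord s (s' y))

lemma inclP_trans (ht : ∀ x (g : PHat n), t (B.act x g) = (g⁻¹).1.val *ᵥ t x)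
    (h : IsAdapted B t c a U s) (h' : IsAdapted B t c b V s') {y : M}
    (hy : y ∈ U) (hy' : y ∈ V) : inclP n (c a) (trans c a s s' y) = B.coord s (s' y) :=
  Function.invFun_eq (exists_inclP ht h h' hy hy')

/-- The values are obtained from the smooth transition functions by `restr`, a linear map that
inverts the inclusion on its image; the pointwise inverse used in the definition is harmless. -/
lemma trans_smooth (ht : ∀ x (g : PHat n), t (B.act x g) = (g⁻¹).1.val *ᵥ t x)
    (h : IsAdapted B t c a U s) (h' : IsAdapted B t c b V s') {y : M}
    (hy : y ∈ U) (hy' : y ∈ V) : GSmoothAt (𝓡 m) (trans c a s s') y := by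
  refine MSmoothAt.congr (MSmoothAt.mlinear
    (h.isSection.coord_section_smooth h'.isSection hy hy') (restrL n (c a))) ?_
  filter_upwards [h.isSection.isOpen.mem_nhds hy, h'.isSection.isOpen.mem_nhds hy'] with z hz hz'
  rw [← inclP_trans ht h h' hz hz', restrL_apply, inclP_val, restr_inclGL]

end IsAdapted

lemma Red.act_mem {c : M → ℝˣ} (ht : ∀ x (g : PHat n), t (B.act x g) = (g⁻¹).1.val *ᵥ t x)
    (x : Red B t c) (g : P n) :
    t (B.act x.1 (inclP n (c (B.proj x.1)) g)) =
      vec n (c (B.proj (B.act x.1 (inclP n (c (B.proj x.1)) g)))) := by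
  rw [ht, B.proj_act, x.2, ← map_inv, inclP_val, inclGL_vec]

open Classical in
/-- The gauge data of the reduction defined by a parallel tractor. -/
def redData (c : M → ℝˣ) (U : M → Set M) (s : M → M → B.Total)
    (ht : ∀ x (g : PHat n), t (B.act x g) = (g⁻¹).1.val *ᵥ t x)
    (hs : ∀ b, IsAdapted B t c b (U b) (s b)) :
    GaugeData.{u, v} (lieG n) (lieP n) (P n) (m := m) M where
  pair := parabolicPair n
  T := Red B t c
  proj x := B.proj x.1
  act x g := ⟨B.act x.1 (inclP n (c (B.proj x.1)) g), Red.act_mem ht x g⟩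
  act_one x := Subtype.ext ((congrArg (B.act x.1) (map_one _)).trans (B.act_one _))
  act_mul x g h := Subtype.ext (by simp only [B.proj_act, map_mul, B.act_mul])
  act_free x g h := inclP_injective _
    ((B.act_free x.1 _ (congrArg Subtype.val h)).trans (map_one _).symm)
  proj_act x g := B.proj_act _ _
  act_trans x y h := by
    obtain ⟨g, hg⟩ := B.exists_act_eq h
    have h1 := ht x.1 g
    rw [hg, x.2, y.2, ← h] at h1
    obtain ⟨k, hk⟩ := exists_inclP_eq (c := c (B.proj x.1)) (g := g) (by
      conv_lhs => rw [h1]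
      rw [Matrix.mulVec_mulVec, mul_inv_val, Matrix.one_mulVec])
    exact ⟨k, Subtype.ext ((congrArg (B.act x.1) hk).trans hg)⟩
  U := U
  isOpen b := (hs b).isSection.isOpen
  mem b := (hs b).mem
  sec b y :=
    -- Outside `U b` the value is arbitrary; the value of the section at `b` serves as a default
    -- inside the reduction.
    if h : y ∈ U b then ⟨s b y, by
      rw [(hs b).val y h, (hs b).isSection.proj_eq y h, (hs b).eq y h]⟩
    else ⟨s b b, by
      rw [(hs b).val b (hs b).mem, (hs b).isSection.proj_eq b (hs b).mem]⟩
  proj_sec b y hy := by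
    rw [dif_pos hy]
    exact (hs b).isSection.proj_eq y hy
  trans a b := IsAdapted.trans c a (s a) (s b)
  sec_eq a b y ha hb := by
    rw [dif_pos ha, dif_pos hb]
    refine Subtype.ext ?_
    simp only
    rw [(hs a).isSection.proj_eq y ha, (hs a).eq y ha, IsAdapted.inclP_trans ht (hs a) (hs b) ha hb,
      (hs a).isSection.act_coord_section (hs b).isSection ha hb]
  trans_smooth a b y ha hb := IsAdapted.trans_smooth ht (hs a) (hs b) ha hb
  form b y := restrL n (c b) ∘ₗ B.pullM (s b) y
  form_smooth b ξ hξ :=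
    MSmoothAt.mlinear ((hs b).isSection.pull_smooth ξ hξ) (restrL n (c b))
  form_mem b y hy ξ := ((hs b).exists_dincl hy ξ).1
  form_trans a b y ha hb ξ := by
    -- The gauge transformation law is known in the ambient geometry and is transferred along the
    -- injective map `dincl`. On the overlap both sections have the same value of `c`.
    refine dincl_injective (c a) ?_
    rw [dincl_gauge, IsAdapted.inclP_trans ht (hs a) (hs b) ha hb]
    have h1 : c b = c a := ((hs b).eq y hb).symm.trans ((hs a).eq y ha)
    have h2 := ((hs b).exists_dincl hb ξ).2
    rw [h1] at h2
    have h3 := ((hs a).exists_dincl ha ξ).2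
    have h4 := gderiv_inclP (IsAdapted.trans_smooth ht (hs a) (hs b) ha hb) (c a) ξ
    have h5 : (fun y => inclP n (c a) (IsAdapted.trans c a (s a) (s b) y)) =ᶠ[𝓝 y]
        fun y => B.coord (s a) (s b y) := by
      filter_upwards [(hs a).isSection.isOpen.mem_nhds ha, (hs b).isSection.isOpen.mem_nhds hb]
        with z hz hz'
      exact IsAdapted.inclP_trans ht (hs a) (hs b) hz hz'
    rw [gderiv_congr h5] at h4
    have h6 := (hs a).isSection.pull_gauge (hs b).isSection ha hb ξ
    rw [← h4]
    change dincl n (c a) (restr (c b) _) = _ * dincl n (c a) (restr (c a) _) * _ + _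
    rw [h1]
    refine h2.trans (h6.trans ?_)
    rw [← h3]
    rfl
  -- Here and in surjectivity, the isomorphism with the ambient Lie algebra modulo `liePHat`
  -- descends to lieG/lieP by `dincl_mem_iff`.
  form_injective b y hy ξ h := by
    have h1 := (dincl_mem_iff (c b) ((hs b).exists_dincl hy ξ).1).2 h
    rw [((hs b).exists_dincl hy ξ).2] at h1
    exact (hs b).isSection.eq_zero_of_pull_mem (parabolicPairHat n).toIsCayleyPair hy h1
  form_surjective b y hy A hA := by
    obtain ⟨ξ, h2⟩ := (hs b).isSection.exists_pull_sub_mem (parabolicPairHat n).toIsCayleyPair hy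
      (dincl_mem (c b) hA)
    obtain ⟨h3, h4⟩ := (hs b).exists_dincl hy ξ
    rw [← h4, ← dincl_sub] at h2
    exact ⟨ξ, (dincl_mem_iff (c b) ((lieG n).sub_mem h3 hA)).1 h2⟩

/-- The reduction of an almost-spinorial geometry defined by a parallel tractor. -/
lemma exists_reduction (ht : IsTractor B t) (hp : IsParallel B t) {c : M → ℝˣ}
    (hc : IsLocallyConstant c) (hcl : ∀ x, sqLen (t x) = -(c (B.proj x) : ℝ)) :
    ∃ (C : FreeGeometry.{u, v} n m M) (j : C.Total → B.Total), IsReduction c C B j ∧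
      Function.Injective j ∧ Set.range j = {x | t x = vec n (c (B.proj x))} := by
  have hex : ∀ b, ∃ U s, IsAdapted B t c b U s := fun b => by
    obtain ⟨U, s, h1, h2, h3⟩ := exists_adapted_section ht hp hc hcl b
    exact ⟨U, s, h1, h2, fun y hy => (h3 y hy).1, fun y hy => (h3 y hy).2.1,
      fun y hy => (h3 y hy).2.2⟩
  choose U s hs using hex
  let D := redData c U s ht.2 hs
  -- The inclusion of the reduction; by construction it maps the sections of the gauge data to the
  -- adapted sections.
  let j : D.geometry.Total → B.Total := fun x => Subtype.val (p := fun x => t x = _) x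
  refine ⟨D.geometry, j, isReduction_of_sections fun x => ?_, Subtype.val_injective,
    Subtype.range_val⟩
  set b := D.geometry.proj x with hb
  have hsec : ∀ y ∈ U b, j (D.secT b y) = s b y := fun y hy => by
    exact congrArg Subtype.val (dif_pos hy)
  refine ⟨U b, D.secT b, s b, (hs b).mem, D.geometry_isSection b, (hs b).isSection,
    (hs b).eq, fun z hz => ?_, fun y hy ξ => ?_⟩
  · have h1 := congrArg j ((D.geometry_isSection b).act_coord (x := z) hz)
    rw [← hsec _ hz]
    refine h1.symm.trans ?_
    have h2 : B.proj (j (D.secT b (D.geometry.proj z))) = D.geometry.proj z := by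
      rw [hsec _ hz, (hs b).isSection.proj_eq _ hz]
    have h3 : c (B.proj (j (D.secT b (D.geometry.proj z)))) = c b := by
      rw [h2]
      exact (hs b).eq _ hz
    exact congrArg (fun r => B.act (j (D.secT b (D.geometry.proj z)))
      (inclP n r (D.geometry.coord (D.secT b) z))) h3
  · rw [D.geometry_pull hy]
    exact ((hs b).exists_dincl hy ξ).2.symm

end Converse

end FreeDist

end

/-! ### The theorem -/

open FreeDist in
theorem mainTheorem11 (n m : ℕ) (M : Type u) [TopologicalSpace M] [T2Space M]
    [SecondCountableTopology M] [ChartedSpace (EuclideanSpace ℝ (Fin m)) M]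
    [IsManifold (𝓡 m) ∞ M] :
    -- the algebraic conditions for the Fefferman construction
    (∀ c : ℝˣ, Function.Injective (incl n c) ∧
      Set.range (incl n c) = {g : GHat n | g.1.val *ᵥ vec n c = vec n c} ∧
      ((PHat n).subgroupOf (GHat n)).comap (incl n c) = (P n).subgroupOf (G n) ∧
      ∃ f : G n ⧸ (P n).subgroupOf (G n) → GHat n ⧸ (PHat n).subgroupOf (GHat n),
        (∀ g : G n, f (QuotientGroup.mk g) = QuotientGroup.mk (incl n c g)) ∧
        Topology.IsOpenEmbedding f) ∧
    -- the Fefferman construction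
    (∀ C : FreeGeometry.{u, v} n m M,
      IsSmoothDistribution n (distribution C) ∧
      (IsRegular C → IsFree n (distribution C)) ∧
      (∃ e : FeffermanBase C ≃ₜ M, ∀ x : C.Total, e (Quot.mk _ x) = C.proj x) ∧
      ∃ (B : AlmostSpinorial.{u, v} n m M) (j : C.Total → B.Total),
        IsReduction (fun _ => 1) C B j ∧
        (∀ (B' : AlmostSpinorial.{u, v} n m M) (j' : C.Total → B'.Total),
          IsReduction (fun _ => 1) C B' j' →
          ∃ φ : Diffeomorph (𝓡 B.dim) (𝓡 B'.dim) B.Total B'.Total ∞,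
            IsIso B B' φ ∧ ∀ x, φ (j x) = j' x) ∧
        ∃ t : B.Total → IdxHat n → ℝ, IsTractor B t ∧ IsParallel B t ∧
          (∀ x, sqLen (t x) = -1) ∧ ∀ x, t (j x) = vec n 1) ∧
    -- the converse
    (∀ (B : AlmostSpinorial.{u, v} n m M) (t : B.Total → IdxHat n → ℝ),
      IsTractor B t → IsParallel B t → (∀ x, sqLen (t x) ≠ 0) →
      ∃ c : M → ℝˣ, IsLocallyConstant c ∧ (∀ x, sqLen (t x) = -(c (B.proj x) : ℝ)) ∧
        ∃ (C : FreeGeometry.{u, v} n m M) (j : C.Total → B.Total),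
          IsReduction c C B j ∧ Function.Injective j ∧
          Set.range j = {x | t x = vec n (c (B.proj x))} ∧
          IsSmoothDistribution n (distribution C) ∧
          (IsRegular C → IsFree n (distribution C))) := by
  refine ⟨fun c => ⟨incl_injective c, range_incl c, comap_incl c, exists_isOpenEmbedding c⟩,
    fun C => ⟨isSmoothDistribution C, IsRegular.isFree, exists_feffermanBase_homeomorph C, ?_⟩,
    fun B t ht hp h0 => ?_⟩
  · obtain ⟨B, j, hj, ht⟩ := exists_extension C
    exact ⟨B, j, hj, fun B' j' hj' => exists_isIso hj hj', ht⟩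
  · obtain ⟨c, hc, hcl⟩ := exists_sqLen_eq ht hp h0
    obtain ⟨C, j, hj, hinj, hrange⟩ := exists_reduction ht hp hc hcl
    exact ⟨c, hc, hcl, C, j, hj, hinj, hrange, isSmoothDistribution C, IsRegular.isFree⟩
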